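/- Let $\mathfrak g=\mathfrak{sl}(3,\mathbb R)=\bigoplus_{p=-2}^{2}\mathfrak g_p$ with the contact grading ($\mathfrak g_{-2}=\langle E_{31}\rangle$, $\mathfrak g_{-1}=\langle E_{21},E_{32}\rangle$, $\mathfrak g^0=\bigoplus_{p\ge 0}\mathfrak g_p$ the upper triangular matrices, $\mathfrak g_-=\mathfrak g_{-2}\oplus\mathfrak g_{-1}$), and put $e_0=E_{31}$, $e_1=E_{21}$, $e_2=E_{32}$. Let $V=\mathfrak g$ be the adjoint module, graded by $V_q=\mathfrak g_{q-2}$ and filtered by $\phi^qV=\bigoplus_{i\ge q}V_i$, let $\kappa$ be the Killing form, $L=O(V,\kappa)$ with Lie algebra $\mathfrak l=\mathfrak o(V,\kappa)$, $\phi^0L\subset L$ the stabiliser of the filtration, and $G^0\subset SL(3,\mathbb R)$ the group of upper triangular matrices, embedded in $L$ by $\mathrm{Ad}$. Decompose $\mathfrak l=\mathfrak g\oplus\mathfrak g^\perp$, $\mathfrak g^\perp=\Gamma_{3,0}\oplus\Gamma_{0,3}$, into irreducible $\mathfrak g$-modules, where $\Gamma_{a,b}$ has highest weight $a\lambda_1+b\lambda_2$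 ($\lambda_1,\lambda_2$ the fundamental weights). Let $(M,\mathfrak f)$ be a $3$-dimensional contact manifold, filtered by $\mathfrak f^{-1}\subset\mathfrak f^{-2}=TM$ with $\mathfrak f^{-1}$ the contact distribution, and let $\varphi\colon(M,\mathfrak f)\to L/\phi^0L\subset\mathrm{Flag}(V,\phi)$ be a smooth osculating map (sections of $\varphi^q$ differentiated along $\mathfrak f^p$ are sections of $\varphi^{p+q}$) whose symbol at every point is $(\mathfrak g_-,V;L)$. Let $P\to M$ be its normal extrinsic Cartan bundle: a reduction $P\subset\varphi^*L$ to the structure group $G^0$ such that, for the restriction $\omega=\omega_I+\omega_{II}$ to $P$ of the Maurer--Cartan form of $L$, decomposed along $\mathfrak l=\mathfrak g\oplus\mathfrak g^\perp$, the map $\omega_I\colon T_zP\to\mathfrak g$ is an isomorphism for all $z\in P$, and the structure function $\chi\colon P\to\mathrm{Hom}(\mathfrak g_-,\mathfrak g^\perp)$ given by $\omega_{II}=\chi\,\omega_I$ has only components of positive degree and satisfies $\partial^*\chi=0$, where $\partial^*\chi=[E_{13},\chi(e_0)]+[E_{12},\chi(e_1)]+[E_{23},\chi(e_2)]$. Write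 $\chi=\chi^R+\chi^S$ with $\chi^R$, $\chi^S$ valued in $\mathrm{Hom}(\mathfrak g_-,\Gamma_{3,0})$ and $\mathrm{Hom}(\mathfrak g_-,\Gamma_{0,3})$ respectively. The $R$-asymptotic curves (resp. $S$-asymptotic curves) are the integral curves in $M$ of the line field $l^R=\pi_*\omega_I^{-1}(\mathbb R e_2)$ (resp. $l^S=\pi_*\omega_I^{-1}(\mathbb R e_1)$), where $\pi\colon P\to M$ is the projection. Then all $R$-asymptotic curves (resp. all $S$-asymptotic curves) are mapped into straight lines of $P^7=P(V)$ by $x\mapsto\varphi^4(x)$ if and only if $\chi^R$ (resp. $\chi^S$) vanishes identically on $P$. -/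

import Mathlib

open scoped Manifold ContDiff Matrix

noncomputable section

namespace Sl3Geometry

/-! ### The graded Lie algebra sl(3) and its adjoint representation on `V = k⁸` -/

section Algebra

variable (k : Type*) [CommRing k]

/-- The matrix unit `E_{i+1,j+1}` of size three. -/
def E (i j : Fin 3) : Matrix (Fin 3) (Fin 3) k := Matrix.single i j 1

/-- The basis `E₁₃, E₁₂, E₂₃, H₁, H₂, E₃₂, E₂₁, E₃₁` of sl(3). -/
def basisA : Fin 8 → Matrix (Fin 3) (Fin 3) k :=
  ![E k 0 2, E k 0 1, E k 1 2, E k 0 0 - E k 1 1, E k 1 1 - E k 2 2, E k 2 1, E k 1 0, E k 2 0]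

variable {k}

/-- The coordinates of a trace-free matrix in the basis `basisA`. -/
def coord (Y : Matrix (Fin 3) (Fin 3) k) : Fin 8 → k :=
  ![Y 0 2, Y 0 1, Y 1 2, Y 0 0, -Y 2 2, Y 2 1, Y 1 0, Y 2 0]

/-- The matrix of `ad X : Y ↦ XY - YX` on sl(3) in the basis `basisA`. -/
def ad (X : Matrix (Fin 3) (Fin 3) k) : Matrix (Fin 8) (Fin 8) k :=
  Matrix.of fun i j => coord (X * basisA k j - basisA k j * X) i

/-- The matrix of `Ad g : Y ↦ g Y g⁻¹` on sl(3) in the basis `basisA`. -/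
def Ad (g : Matrix.SpecialLinearGroup (Fin 3) k) : Matrix (Fin 8) (Fin 8) k :=
  Matrix.of fun i j =>
    coord ((g : Matrix (Fin 3) (Fin 3) k) * basisA k j * (g⁻¹ : Matrix.SpecialLinearGroup (Fin 3) k)) i

variable (k)

/-- The Gram matrix of the Killing form `κ(X, Y) = tr (ad X ad Y)` of sl(3). -/
def killing : Matrix (Fin 8) (Fin 8) k :=
  Matrix.of fun i j => (ad (basisA k i) * ad (basisA k j)).trace

/-! Weight vectors of the irreducible submodule `Γ₃₀` of `o(V, κ)` (highest weight vector
`R_{2,1} = A₁ ⊗ A₇* - A₂ ⊗ A₈*`); a letter `m` stands for a minus sign in the weight. -/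

def R_2_1 : Matrix (Fin 8) (Fin 8) k := Matrix.single 0 6 1 - Matrix.single 1 7 1
def R_1_1 : Matrix (Fin 8) (Fin 8) k := ⁅ad (E k 1 0), R_2_1 k⁆
def R_1_0 : Matrix (Fin 8) (Fin 8) k := ⁅ad (E k 2 1), R_1_1 k⁆
def R_0_1 : Matrix (Fin 8) (Fin 8) k := ⁅ad (E k 1 0), R_1_1 k⁆
def R_0_0 : Matrix (Fin 8) (Fin 8) k := ⁅ad (E k 2 1), R_0_1 k⁆
def R_0_m1 : Matrix (Fin 8) (Fin 8) k := ⁅ad (E k 2 1), R_0_0 k⁆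
def R_m1_1 : Matrix (Fin 8) (Fin 8) k := ⁅ad (E k 1 0), R_0_1 k⁆
def R_m1_0 : Matrix (Fin 8) (Fin 8) k := ⁅ad (E k 2 1), R_m1_1 k⁆
def R_m1_m1 : Matrix (Fin 8) (Fin 8) k := ⁅ad (E k 2 1), R_m1_0 k⁆
def R_m1_m2 : Matrix (Fin 8) (Fin 8) k := ⁅ad (E k 2 1), R_m1_m1 k⁆

/-! Weight vectors of the irreducible submodule `Γ₀₃` of `o(V, κ)` (highest weight vector
`S_{1,2} = A₁ ⊗ A₆* - A₃ ⊗ A₈*`). -/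

def S_1_2 : Matrix (Fin 8) (Fin 8) k := Matrix.single 0 5 1 - Matrix.single 2 7 1
def S_1_1 : Matrix (Fin 8) (Fin 8) k := ⁅ad (E k 2 1), S_1_2 k⁆
def S_0_1 : Matrix (Fin 8) (Fin 8) k := ⁅ad (E k 1 0), S_1_1 k⁆
def S_1_0 : Matrix (Fin 8) (Fin 8) k := ⁅ad (E k 2 1), S_1_1 k⁆
def S_0_0 : Matrix (Fin 8) (Fin 8) k := ⁅ad (E k 1 0), S_1_0 k⁆
def S_m1_0 : Matrix (Fin 8) (Fin 8) k := ⁅ad (E k 1 0), S_0_0 k⁆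
def S_1_m1 : Matrix (Fin 8) (Fin 8) k := ⁅ad (E k 2 1), S_1_0 k⁆
def S_0_m1 : Matrix (Fin 8) (Fin 8) k := ⁅ad (E k 1 0), S_1_m1 k⁆
def S_m1_m1 : Matrix (Fin 8) (Fin 8) k := ⁅ad (E k 1 0), S_0_m1 k⁆
def S_m2_m1 : Matrix (Fin 8) (Fin 8) k := ⁅ad (E k 1 0), S_m1_m1 k⁆

/-- The basis of weight vectors of `Γ₃₀`. -/
def vecR : Fin 10 → Matrix (Fin 8) (Fin 8) k :=
  ![R_2_1 k, R_1_1 k, R_1_0 k, R_0_1 k, R_0_0 k, R_0_m1 k, R_m1_1 k, R_m1_0 k, R_m1_m1 k,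
    R_m1_m2 k]

/-- The basis of weight vectors of `Γ₀₃`; the weight of `vecS i` is minus that of `vecR i`. -/
def vecS : Fin 10 → Matrix (Fin 8) (Fin 8) k :=
  ![S_m2_m1 k, S_m1_m1 k, S_m1_0 k, S_0_m1 k, S_0_0 k, S_0_1 k, S_1_m1 k, S_1_0 k, S_1_1 k,
    S_1_2 k]

end Algebra

/-- Real `8 × 8` matrices: endomorphisms of `V = ℝ⁸ ≅ sl(3, ℝ)` in the basis `basisA`. -/
abbrev Mat8 : Type := Matrix (Fin 8) (Fin 8) ℝ

/-- The sl(3)-component of `X ∈ o(V, κ)` in the decomposition `o(V, κ) = sl(3) ⊕ sl(3)^⊥`,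
orthogonal for the trace form of `V` (a multiple of the Killing form of `o(V, κ)`). Since
`tr (ad Y · ad Z) = 6 tr (Y Z)` for `Y` trace-free, it is the unique trace-free `Y` with
`tr (X · ad Z) = tr (ad Y · ad Z)` for all `Z`. -/
def projI (X : Mat8) : Matrix (Fin 3) (Fin 3) ℝ :=
  Matrix.of fun i j => (X * ad (E ℝ j i)).trace / 6

/-- The component of `X ∈ o(V, κ)` in `sl(3)^⊥ = Γ₃₀ ⊕ Γ₀₃`. -/
def projII (X : Mat8) : Mat8 := X - ad (projI X)

/-- The projection of `sl(3)^⊥ = Γ₃₀ ⊕ Γ₀₃` onto `Γ₃₀`. For the trace form, `Γ₃₀` and `Γ₀₃` are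
isotropic and `vecR`, `vecS` are dual bases up to nonzero factors. -/
def projR (X : Mat8) : Mat8 :=
  ∑ i, ((X * vecS ℝ i).trace / (vecR ℝ i * vecS ℝ i).trace) • vecR ℝ i

/-- The projection of `sl(3)^⊥ = Γ₃₀ ⊕ Γ₀₃` onto `Γ₀₃`. -/
def projS (X : Mat8) : Mat8 :=
  ∑ i, ((X * vecR ℝ i).trace / (vecS ℝ i * vecR ℝ i).trace) • vecS ℝ i

/-- The element `u₀ e₀ + u₁ e₁ + u₂ e₂` of `g₋`, where `e₀ = E₃₁` spans `g₋₂` and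
`e₁ = E₂₁`, `e₂ = E₃₂` span `g₋₁`. -/
def toNeg (u : Fin 3 → ℝ) : Matrix (Fin 3) (Fin 3) ℝ :=
  u 0 • E ℝ 2 0 + u 1 • E ℝ 1 0 + u 2 • E ℝ 2 1

/-- The component in `g₋`, along the upper triangular matrices, of an element of sl(3). -/
def negPart (Y : Matrix (Fin 3) (Fin 3) ℝ) : Fin 3 → ℝ := ![Y 2 0, Y 1 0, Y 2 1]

/-- `u ∈ g₋` is homogeneous of degree `p`. -/
def IsHomogeneousNeg (p : ℤ) (u : Fin 3 → ℝ) : Prop :=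
  (p ≠ -2 → u 0 = 0) ∧ (p ≠ -1 → u 1 = 0 ∧ u 2 = 0)

/-- The degree in `V = V₀ ⊕ ⋯ ⊕ V₄`, `V_q = g_{q-2}`, of the vectors of the basis `basisA`. -/
def degV : Fin 8 → ℤ := ![4, 3, 3, 2, 2, 1, 1, 0]

/-- The standard filtration `φ^q V = ⨁_{i ≥ q} V_i`. -/
def filV (q : ℤ) : Submodule ℝ (Fin 8 → ℝ) where
  carrier := {v | ∀ i, degV i < q → v i = 0}
  add_mem' := by
    intro a b ha hb i hi
    simp [ha i hi, hb i hi]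
  zero_mem' := by
    intro i _
    rfl
  smul_mem' := by
    intro c a ha i hi
    simp [ha i hi]

/-- The filtration `φ^p gl(V)`: matrices raising the degree by at least `p`. -/
def filGl (p : ℤ) : Set Mat8 := {X | ∀ i j, degV i - degV j < p → X i j = 0}

/-- The group `L = O(V, κ)`. -/
def groupL : Set Mat8 := {a | aᵀ * killing ℝ * a = killing ℝ}

/-- The image in `L` of the group `G⁰` of upper triangular matrices in SL(3, ℝ) under the
(faithful) adjoint representation. -/
def groupG0 : Set Mat8 :=
  {b | ∃ g : Matrix.SpecialLinearGroup (Fin 3) ℝ,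
    (g : Matrix (Fin 3) (Fin 3) ℝ).BlockTriangular id ∧ b = Ad g}

/-- The codifferential `∂* : Hom(g₋, sl(3)^⊥) → sl(3)^⊥`, the adjoint of the differential
`(∂ w)(u) = [ad u, w]`: the elements `E₁₃, E₁₂, E₂₃` are, up to a common factor, dual to
`e₀, e₁, e₂` for the Killing form. -/
def codiff (c : (Fin 3 → ℝ) → Mat8) : Mat8 :=
  ⁅ad (E ℝ 0 2), c (Pi.single 0 1)⁆ + ⁅ad (E ℝ 0 1), c (Pi.single 1 1)⁆
    + ⁅ad (E ℝ 1 2), c (Pi.single 2 1)⁆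

/-! ### Contact manifolds and osculating maps -/

section Geometry

variable {M : Type*} [TopologicalSpace M] [ChartedSpace (EuclideanSpace ℝ (Fin 3)) M]

/-- `X` is a smooth vector field on `U`. -/
def IsSmoothField [IsManifold (𝓡 3) ∞ M] (X : (x : M) → TangentSpace (𝓡 3) x) (U : Set M) : Prop :=
  ContMDiffOn (𝓡 3) (𝓡 3).tangent ∞
    (fun y => (⟨y, X y⟩ : TangentBundle (𝓡 3) M)) U

/-- `D` is a contact distribution on the 3-manifold `M`: it is locally spanned by two smooth vector
fields `X, Y` such that `X, Y, [X, Y]` are linearly independent. -/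
def IsContact [IsManifold (𝓡 3) ∞ M] (D : (x : M) → Submodule ℝ (TangentSpace (𝓡 3) x)) : Prop :=
  ∀ x : M, ∃ (U : Set M) (X Y : (x : M) → TangentSpace (𝓡 3) x),
    IsOpen U ∧ x ∈ U ∧ IsSmoothField X U ∧ IsSmoothField Y U ∧
    ∀ y ∈ U, D y = Submodule.span ℝ {X y, Y y} ∧
      LinearIndependent ℝ ![X y, Y y, VectorField.mlieBracket (𝓡 3) X Y y]

/-- The tangential filtration of a contact manifold: `f^p = 0` for `p ≥ 0`, `f^{-1} = D`,
and `f^p = TM` for `p ≤ -2`. -/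
def tangentFil (D : (x : M) → Submodule ℝ (TangentSpace (𝓡 3) x)) (p : ℤ) (x : M) :
    Submodule ℝ (TangentSpace (𝓡 3) x) :=
  if 0 ≤ p then ⊥ else if p = -1 then D x else ⊤

/-- `s` is a smooth map on the open set `U` with values in the `8 × 8` matrices. -/
def IsSmoothMat (s : M → Mat8) (U : Set M) : Prop :=
  ∀ i j, ContMDiffOn (𝓡 3) 𝓘(ℝ, ℝ) ∞ (fun y => s y i j) U

/-- A field of filtrations `x ↦ (φ^q(x))_q` of `V` is a smooth map from `M` to
`L/φ⁰L ⊂ Flag(V, φ)`: locally it is the translate of the standard filtration by a smooth map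
to `L`. -/
def IsSmoothFlagMap (φ : M → ℤ → Submodule ℝ (Fin 8 → ℝ)) : Prop :=
  ∀ x : M, ∃ (U : Set M) (s : M → Mat8), IsOpen U ∧ x ∈ U ∧ IsSmoothMat s U ∧
    ∀ y ∈ U, s y ∈ groupL ∧ ∀ q, φ y q = (filV q).map (s y).mulVecLin

/-- `w` is a smooth section of `φ^q` over the open set `U`. -/
def IsFlagSection (φ : M → ℤ → Submodule ℝ (Fin 8 → ℝ)) (q : ℤ) (U : Set M)
    (w : M → Fin 8 → ℝ) : Prop :=
  IsOpen U ∧ ContMDiffOn (𝓡 3) 𝓘(ℝ, Fin 8 → ℝ) ∞ w U ∧ ∀ y ∈ U, w y ∈ φ y q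

/-- The derivative of the vector-valued function `w` at `x` in the direction `v`. -/
def dirDeriv (w : M → Fin 8 → ℝ) (x : M) (v : TangentSpace (𝓡 3) x) : Fin 8 → ℝ :=
  mfderiv (𝓡 3) 𝓘(ℝ, Fin 8 → ℝ) w x v

/-- The map `φ` is osculating: differentiating a section of `φ^q` along `f^p` gives a
section of `φ^{p+q}`. -/
def IsOsculating (D : (x : M) → Submodule ℝ (TangentSpace (𝓡 3) x))
    (φ : M → ℤ → Submodule ℝ (Fin 8 → ℝ)) : Prop :=
  ∀ (p q : ℤ) (U : Set M) (w : M → Fin 8 → ℝ), IsFlagSection φ q U w →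
    ∀ x ∈ U, ∀ v ∈ tangentFil D p x, dirDeriv w x v ∈ φ x (p + q)

/-- The symbol of `φ` at every point is `(g₋, V; L)`: there are a (graded isomorphism
`gr V → gr φ_x` induced by some) `a ∈ L` with `a φ^q V = φ^q(x)`, and a (graded Lie algebra
isomorphism `g₋ → gr f_x` induced by some) linear isomorphism `ψ : g₋ → T_x M`, such that the
action of `gr f_x` on `gr φ_x` by differentiation corresponds to the adjoint action of `g₋` on
`gr V = sl(3)`. -/
def HasSymbolSl3 [IsManifold (𝓡 3) ∞ M] (D : (x : M) → Submodule ℝ (TangentSpace (𝓡 3) x))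
    (φ : M → ℤ → Submodule ℝ (Fin 8 → ℝ)) : Prop :=
  ∀ x : M, ∃ a ∈ groupL, ∃ ψ : (Fin 3 → ℝ) ≃ₗ[ℝ] TangentSpace (𝓡 3) x,
    (∀ q, φ x q = (filV q).map a.mulVecLin) ∧
    (∀ u, ψ u ∈ D x ↔ u 0 = 0) ∧
    (∀ (U : Set M) (X Y : (x : M) → TangentSpace (𝓡 3) x), IsOpen U → x ∈ U →
      IsSmoothField X U → IsSmoothField Y U → (∀ y ∈ U, X y ∈ D y ∧ Y y ∈ D y) →
      ψ.symm (VectorField.mlieBracket (𝓡 3) X Y x) 0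
        = negPart ⁅toNeg (ψ.symm (X x)), toNeg (ψ.symm (Y x))⁆ 0) ∧
    (∀ (p q : ℤ) (u : Fin 3 → ℝ), IsHomogeneousNeg p u →
      ∀ (U : Set M) (w : M → Fin 8 → ℝ), IsFlagSection φ q U w → x ∈ U →
        dirDeriv w x (ψ u) - (a * ad (toNeg u) * a⁻¹) *ᵥ w x ∈ φ x (p + q + 1))

/-- An osculating map `φ : (M, f) → L/φ⁰L ⊂ Flag(V, φ)` of type `(g₋, V; L)`. -/
structure IsOsculatingMapOfTypeSl3 [IsManifold (𝓡 3) ∞ M]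
    (D : (x : M) → Submodule ℝ (TangentSpace (𝓡 3) x))
    (φ : M → ℤ → Submodule ℝ (Fin 8 → ℝ)) : Prop where
  smooth : IsSmoothFlagMap φ
  osculating : IsOsculating D φ
  symbol : HasSymbolSl3 D φ

/-! ### The normal extrinsic Cartan bundle and its structure function

The bundle is realised as a reduction `P ⊂ φ^* L` of the pull-back of `L → L/φ⁰L` to the subgroup
`G⁰`, with `P x ⊂ L` its fibre over `x`, and `ω` is the restriction of the Maurer-Cartan form of
`L`. On the vertical directions `ω` is the Maurer-Cartan form of `G⁰`, so everything is
determined by the pull-backs of `ω` along local sections `s : U → P`. -/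

/-- `s` is a smooth local section over the open set `U` of the bundle with fibres `P x`. -/
def IsSection (P : M → Set Mat8) (U : Set M) (s : M → Mat8) : Prop :=
  IsOpen U ∧ IsSmoothMat s U ∧ ∀ x ∈ U, s x ∈ P x

/-- The pull-back `s^* ω = s⁻¹ ds` of the Maurer-Cartan form, evaluated at `v ∈ T_x M`. -/
def omega (s : M → Mat8) (x : M) (v : TangentSpace (𝓡 3) x) : Mat8 :=
  (s x)⁻¹ * Matrix.of fun i j =>
    (mfderiv (𝓡 3) 𝓘(ℝ, ℝ) (fun y => s y i j) x v : ℝ)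

/-- The component `ω₋ : T_x M → g₋` of `ω_I`. -/
def omegaNeg (s : M → Mat8) (x : M) (v : TangentSpace (𝓡 3) x) : Fin 3 → ℝ :=
  negPart (projI (omega s x v))

/-- The structure function `χ : P → Hom(g₋, sl(3)^⊥)`, `ω_II = χ ω_I`, at the frame `s x`;
here `ω₋ : T_x M → g₋` is bijective. -/
def chi (s : M → Mat8) (x : M) (u : Fin 3 → ℝ) : Mat8 :=
  projII (omega s x (Function.invFun (omegaNeg s x) u))

/-- The component `χ^R` of `χ` with values in `Hom(g₋, Γ₃₀)`. -/
def chiR (s : M → Mat8) (x : M) (u : Fin 3 → ℝ) : Mat8 := projR (chi s x u)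

/-- The component `χ^S` of `χ` with values in `Hom(g₋, Γ₀₃)`. -/
def chiS (s : M → Mat8) (x : M) (u : Fin 3 → ℝ) : Mat8 := projS (chi s x u)

/-- `P` is the normal extrinsic Cartan bundle of `φ`: a smooth reduction of `φ^* L` to
`G⁰` for which `ω_I` is a coframe, `χ` has only components of positive degree, and
`∂* χ = 0`. -/
structure IsNormalCartanBundle (φ : M → ℤ → Submodule ℝ (Fin 8 → ℝ)) (P : M → Set Mat8) :
    Prop where
  mem_groupL : ∀ x, ∀ a ∈ P x, a ∈ groupL
  covers : ∀ x, ∀ a ∈ P x, ∀ q, φ x q = (filV q).map a.mulVecLin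
  torsor : ∀ x, ∀ a ∈ P x, ∀ b, b ∈ P x ↔ ∃ g ∈ groupG0, b = a * g
  exists_section : ∀ x, ∃ U s, x ∈ U ∧ IsSection P U s
  coframe : ∀ U s, IsSection P U s → ∀ x ∈ U, Function.Bijective (omegaNeg s x)
  positive : ∀ U s, IsSection P U s → ∀ x ∈ U, ∀ (p : ℤ) (u : Fin 3 → ℝ),
    IsHomogeneousNeg p u → chi s x u ∈ filGl (p + 1)
  normal : ∀ U s, IsSection P U s → ∀ x ∈ U, codiff (chi s x) = 0

/-- `χ^R` vanishes identically on `P`. -/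
def ChiRVanishes (P : M → Set Mat8) : Prop :=
  ∀ U s, IsSection P U s → ∀ x ∈ U, ∀ u, chiR s x u = 0

/-- `χ^S` vanishes identically on `P`. -/
def ChiSVanishes (P : M → Set Mat8) : Prop :=
  ∀ U s, IsSection P U s → ∀ x ∈ U, ∀ u, chiS s x u = 0

/-! ### Asymptotic curves -/

/-- The projection to `T_x M` of `ω_I⁻¹(ℝ e)`, for `e ∈ g₋`: as vertical vectors correspond
to `g⁰` under `ω_I`, these are the `v` with `ω₋(v) ∈ ℝ e`. -/
def direction (P : M → Set Mat8) (e : Fin 3 → ℝ) (x : M) : Set (TangentSpace (𝓡 3) x) :=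
  {v | ∃ U s, x ∈ U ∧ IsSection P U s ∧ ∃ c : ℝ, omegaNeg s x v = c • e}

/-- The asymptotic direction `l^R`, given by `e₂ = E₃₂`. -/
def dirR (P : M → Set Mat8) (x : M) : Set (TangentSpace (𝓡 3) x) :=
  direction P (Pi.single 2 1) x

/-- The asymptotic direction `l^S`, given by `e₁ = E₂₁`. -/
def dirS (P : M → Set Mat8) (x : M) : Set (TangentSpace (𝓡 3) x) :=
  direction P (Pi.single 1 1) x

/-- `γ`, restricted to the open interval `I`, is a (regular, smooth) integral curve of the line
field `l`. -/
def IsIntegralCurveOfLineField (l : (x : M) → Set (TangentSpace (𝓡 3) x)) (γ : ℝ → M)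
    (I : Set ℝ) : Prop :=
  IsOpen I ∧ IsPreconnected I ∧ ContMDiffOn 𝓘(ℝ, ℝ) (𝓡 3) ∞ γ I ∧
    ∀ t ∈ I, mfderiv 𝓘(ℝ, ℝ) (𝓡 3) γ t (1 : ℝ) ≠ 0 ∧
      mfderiv 𝓘(ℝ, ℝ) (𝓡 3) γ t (1 : ℝ) ∈ l (γ t)

/-- The curve `t ↦ φ⁴(γ t)`, the image of `γ` in `P(V) = P⁷` (`φ⁴(x)` is the line in `V` that is
the last term of the flag at `x`), lies in a straight line of `P⁷`, that is, in the
projectivisation of a plane `W ⊂ V`. -/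
def MapsIntoLine (φ : M → ℤ → Submodule ℝ (Fin 8 → ℝ)) (γ : ℝ → M) (I : Set ℝ) : Prop :=
  ∃ W : Submodule ℝ (Fin 8 → ℝ), Module.finrank ℝ W = 2 ∧ ∀ t ∈ I, φ (γ t) 4 ≤ W

end Geometry

end Sl3Geometry

end

/-!
The proof uses the method of moving frames. Let `ω = s⁻¹ ds` be the pull-back of the Maurer-Cartan
form along a section `s` of the normal bundle, evaluated on the vector fields dual to the components
of `ω₋`. It has values in `o(V, κ) = sl(3) ⊕ Γ₃₀ ⊕ Γ₀₃`, and the values of its components in `Γ₃₀`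
and `Γ₀₃` are the coefficients of `χ^R` and `χ^S` (`ofCoords`, `coefR`, `coefS`). The structure
equation `dω + ω ∧ ω = 0` (`exists_structure_equation`) and the normalisation `∂* χ = 0` are
equations for these coefficients (`exists_coefficients`).

Sorted by degree and by weight, these equations determine `χ^R`: by induction on the degree, all
components whose weight has second coordinate at most one vanish (`vanish_degree_four`), and if the
coefficient of `e₂^* ⊗ R_{-1,1}`, a harmonic component of degree one, vanishes identically, so do
all the others (`chiR_vanishes_iff_harmonic`). The components of `χ^S` enter the equations for
`χ^R`; the outer automorphism of `sl(3)` preserving the grading exchanges `R` and `S`, so that every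
statement on `χ^R` for the bundle `flipBundle P` is one on `χ^S` for `P`
(`IsNormalCartanBundle.flipBundle`).

Let `a₁, a₂, a₃, …` be the columns of the frame `s` along a curve, so that `a₁` spans `φ⁴`. The
curve is `R`-asymptotic if and only if the derivative of `a₁` lies in `⟨a₁, a₂⟩`
(`col_zero_mem_plane_iff`). In this case the derivative of `a₂` is a multiple of the harmonic
coefficient times `a₃`, modulo `⟨a₁, a₂⟩` (`omega_col_one`). If `χ^R = 0`, then the plane `⟨a₁,
a₂⟩`, which does not depend on the section, is constant along asymptotic curves by uniqueness for
linear differential equations, and contains `φ⁴` (`mapsIntoLine_of_chiRVanishes`). Conversely, the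
integral curve through a given point of the vector field dual to `e₂` is asymptotic. If a plane
contains `a₁` along this curve, it contains the derivatives of `a₁`, hence `a₂`, and also `a₃`
unless the harmonic coefficient is zero (`chiRVanishes_of_mapsIntoLine`). The statement on `S` is
that on `R` for `flipBundle P`.
-/

noncomputable section

namespace Sl3Geometry

/-! ### Explicit matrices for the weight vectors -/

section

open Matrix (single)

theorem R_2_1_int : R_2_1 ℤ = single 0 6 1 - single 1 7 1 := rfl

theorem R_1_1_int : R_1_1 ℤ =
    single 0 4 1 + single 2 6 1 + single 3 7 1 - single 0 3 2 - single 1 5 1 := by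
  rw [R_1_1, R_2_1_int]; decide +kernel

theorem R_1_0_int : R_1_0 ℤ =
    single 0 2 1 + single 1 3 1 + single 1 4 1 - single 3 6 1 - single 4 6 1 - single 5 7 1 := by
  rw [R_1_0, R_1_1_int]; decide +kernel

theorem R_0_1_int : R_0_1 ℤ =
    single 2 4 2 + single 3 5 2 + single 6 7 2 - single 0 1 2 - single 2 3 4 := by
  rw [R_0_1, R_1_1_int]; decide +kernel

theorem R_0_0_int : R_0_0 ℤ =
    single 1 1 2 + single 2 2 2 + single 3 3 2 + single 4 3 4 + single 7 7 2 - single 0 0 2 -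
        single 3 4 4 - single 4 4 2 - single 5 5 2 - single 6 6 2 := by
  rw [R_0_0, R_0_1_int]; decide +kernel

theorem R_0_m1_int : R_0_m1 ℤ =
    single 1 0 4 + single 5 3 4 + single 5 4 4 - single 3 2 4 - single 4 2 4 - single 7 6 4 := by
  rw [R_0_m1, R_0_0_int]; decide +kernel

theorem R_m1_1_int : R_m1_1 ℤ =
    single 6 5 6 - single 2 1 6 := by
  rw [R_m1_1, R_0_1_int]; decide +kernel

theorem R_m1_0_int : R_m1_0 ℤ =
    single 4 1 6 + single 6 3 6 + single 7 5 6 - single 2 0 6 - single 6 4 12 := by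
  rw [R_m1_0, R_m1_1_int]; decide +kernel

theorem R_m1_m1_int : R_m1_m1 ℤ =
    single 4 0 12 + single 5 1 12 + single 7 3 12 - single 6 2 12 - single 7 4 24 := by
  rw [R_m1_m1, R_m1_0_int]; decide +kernel

theorem R_m1_m2_int : R_m1_m2 ℤ =
    single 5 0 36 - single 7 2 36 := by
  rw [R_m1_m2, R_m1_m1_int]; decide +kernel

theorem S_1_2_int : S_1_2 ℤ = single 0 5 1 - single 2 7 1 := rfl

theorem S_1_1_int : S_1_1 ℤ =
    single 0 3 1 + single 2 6 1 + single 4 7 1 - single 0 4 2 - single 1 5 1 := by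
  rw [S_1_1, S_1_2_int]; decide +kernel

theorem S_0_1_int : S_0_1 ℤ =
    single 0 1 1 + single 3 5 1 + single 4 5 1 - single 2 3 1 - single 2 4 1 - single 6 7 1 := by
  rw [S_0_1, S_1_1_int]; decide +kernel

theorem S_1_0_int : S_1_0 ℤ =
    single 1 4 4 + single 5 7 2 - single 0 2 2 - single 1 3 2 - single 4 6 2 := by
  rw [S_1_0, S_1_1_int]; decide +kernel

theorem S_0_0_int : S_0_0 ℤ =
    single 0 0 2 + single 3 3 2 + single 4 3 4 + single 5 5 2 + single 6 6 2 - single 1 1 2 -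
        single 2 2 2 - single 3 4 4 - single 4 4 2 - single 7 7 2 := by
  rw [S_0_0, S_1_0_int]; decide +kernel

theorem S_m1_0_int : S_m1_0 ℤ =
    single 2 0 4 + single 3 1 4 + single 4 1 4 - single 6 3 4 - single 6 4 4 - single 7 5 4 := by
  rw [S_m1_0, S_0_0_int]; decide +kernel

theorem S_1_m1_int : S_1_m1 ℤ =
    single 1 2 6 - single 5 6 6 := by
  rw [S_1_m1, S_1_0_int]; decide +kernel

theorem S_0_m1_int : S_0_m1 ℤ =
    single 5 3 12 + single 7 6 6 - single 1 0 6 - single 3 2 6 - single 5 4 6 := by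
  rw [S_0_m1, S_1_m1_int]; decide +kernel

theorem S_m1_m1_int : S_m1_m1 ℤ =
    single 3 0 12 + single 5 1 12 + single 7 4 12 - single 6 2 12 - single 7 3 24 := by
  rw [S_m1_m1, S_0_m1_int]; decide +kernel

theorem S_m2_m1_int : S_m2_m1 ℤ =
    single 6 0 36 - single 7 1 36 := by
  rw [S_m2_m1, S_m1_m1_int]; decide +kernel

/-- The recursive definition of the weight vectors, evaluated over `ℤ`, where equality of matrices
is decidable. -/
theorem vecR_int : vecR ℤ = ![single 0 6 1 - single 1 7 1,
    single 0 4 1 + single 2 6 1 + single 3 7 1 - single 0 3 2 - single 1 5 1,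
    single 0 2 1 + single 1 3 1 + single 1 4 1 - single 3 6 1 - single 4 6 1 - single 5 7 1,
    single 2 4 2 + single 3 5 2 + single 6 7 2 - single 0 1 2 - single 2 3 4,
    single 1 1 2 + single 2 2 2 + single 3 3 2 + single 4 3 4 + single 7 7 2 - single 0 0 2 -
        single 3 4 4 - single 4 4 2 - single 5 5 2 - single 6 6 2,
    single 1 0 4 + single 5 3 4 + single 5 4 4 - single 3 2 4 - single 4 2 4 - single 7 6 4,
    single 6 5 6 - single 2 1 6,
    single 4 1 6 + single 6 3 6 + single 7 5 6 - single 2 0 6 - single 6 4 12,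
    single 4 0 12 + single 5 1 12 + single 7 3 12 - single 6 2 12 - single 7 4 24,
    single 5 0 36 - single 7 2 36] := by
  rw [vecR, R_2_1_int, R_1_1_int, R_1_0_int, R_0_1_int, R_0_0_int, R_0_m1_int, R_m1_1_int,
    R_m1_0_int, R_m1_m1_int, R_m1_m2_int]

theorem vecS_int : vecS ℤ = ![single 6 0 36 - single 7 1 36,
    single 3 0 12 + single 5 1 12 + single 7 4 12 - single 6 2 12 - single 7 3 24,
    single 2 0 4 + single 3 1 4 + single 4 1 4 - single 6 3 4 - single 6 4 4 - single 7 5 4,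
    single 5 3 12 + single 7 6 6 - single 1 0 6 - single 3 2 6 - single 5 4 6,
    single 0 0 2 + single 3 3 2 + single 4 3 4 + single 5 5 2 + single 6 6 2 - single 1 1 2 -
        single 2 2 2 - single 3 4 4 - single 4 4 2 - single 7 7 2,
    single 0 1 1 + single 3 5 1 + single 4 5 1 - single 2 3 1 - single 2 4 1 - single 6 7 1,
    single 1 2 6 - single 5 6 6,
    single 1 4 4 + single 5 7 2 - single 0 2 2 - single 1 3 2 - single 4 6 2,
    single 0 3 1 + single 2 6 1 + single 4 7 1 - single 0 4 2 - single 1 5 1,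
    single 0 5 1 - single 2 7 1] := by
  rw [vecS, S_1_2_int, S_1_1_int, S_1_0_int, S_0_1_int, S_0_0_int, S_0_m1_int, S_m1_0_int,
    S_1_m1_int, S_m1_m1_int, S_m2_m1_int]

section Map

variable {k l : Type*} [CommRing k] [CommRing l] (f : k →+* l)

theorem E_map (i j : Fin 3) : (E k i j).map f = E l i j := by
  simp [E]

theorem lie_map {n : Type*} [Fintype n] [DecidableEq n] (A B : Matrix n n k) :
    (⁅A, B⁆ : Matrix n n k).map f = ⁅A.map f, B.map f⁆ := by
  simp only [Ring.lie_def, Matrix.map_sub f (map_sub f), Matrix.map_mul]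

theorem basisA_map (j : Fin 8) : (basisA k j).map f = basisA l j := by
  fin_cases j <;> simp [basisA, E_map, Matrix.map_sub f (map_sub f)]

theorem coord_map (Y : Matrix (Fin 3) (Fin 3) k) (i : Fin 8) :
    f (coord Y i) = coord (Y.map f) i := by
  fin_cases i <;> simp [coord]

theorem ad_map (X : Matrix (Fin 3) (Fin 3) k) : (ad X).map f = ad (X.map f) := by
  ext i j
  simp only [ad, Matrix.map_apply, Matrix.of_apply, coord_map, Matrix.map_sub f (map_sub f),
    Matrix.map_mul, basisA_map]

theorem ad_E_map (i j : Fin 3) : (ad (E k i j)).map f = ad (E l i j) := by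
  rw [ad_map, E_map]

theorem killing_map : (killing k).map f = killing l := by
  ext i j
  simp only [killing, Matrix.map_apply, Matrix.of_apply, ← basisA_map f, ← ad_map f,
    ← Matrix.map_mul, Matrix.trace, Matrix.diag_apply, map_sum]

theorem vecR_map (i : Fin 10) : (vecR k i).map f = vecR l i := by
  fin_cases i <;>
  simp [vecR, R_2_1, R_1_1, R_1_0, R_0_1, R_0_0, R_0_m1, R_m1_1, R_m1_0, R_m1_m1, R_m1_m2,
    lie_map, ad_E_map, Matrix.map_sub f (map_sub f)]

theorem vecS_map (i : Fin 10) : (vecS k i).map f = vecS l i := by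
  fin_cases i <;>
  simp [vecS, S_1_2, S_1_1, S_1_0, S_0_1, S_0_0, S_0_m1, S_m1_0, S_1_m1, S_m1_m1, S_m2_m1,
    lie_map, ad_E_map, Matrix.map_sub f (map_sub f)]

end Map

theorem single_intCast (p q : Fin 8) (c : ℤ) :
    (single p q c).map (Int.cast : ℤ → ℝ) = single p q (c : ℝ) := by
  ext a b
  simp only [Matrix.map_apply, Matrix.single_apply]
  split_ifs <;> simp

theorem vecR_real : vecR ℝ = ![single 0 6 1 - single 1 7 1,
    single 0 4 1 + single 2 6 1 + single 3 7 1 - single 0 3 2 - single 1 5 1,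
    single 0 2 1 + single 1 3 1 + single 1 4 1 - single 3 6 1 - single 4 6 1 - single 5 7 1,
    single 2 4 2 + single 3 5 2 + single 6 7 2 - single 0 1 2 - single 2 3 4,
    single 1 1 2 + single 2 2 2 + single 3 3 2 + single 4 3 4 + single 7 7 2 - single 0 0 2 -
        single 3 4 4 - single 4 4 2 - single 5 5 2 - single 6 6 2,
    single 1 0 4 + single 5 3 4 + single 5 4 4 - single 3 2 4 - single 4 2 4 - single 7 6 4,
    single 6 5 6 - single 2 1 6,
    single 4 1 6 + single 6 3 6 + single 7 5 6 - single 2 0 6 - single 6 4 12,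
    single 4 0 12 + single 5 1 12 + single 7 3 12 - single 6 2 12 - single 7 4 24,
    single 5 0 36 - single 7 2 36] := by
  funext i
  rw [← vecR_map (Int.castRingHom ℝ), vecR_int]
  fin_cases i <;> simp [Matrix.map_add (Int.cast : ℤ → ℝ) Int.cast_add,
      Matrix.map_sub (Int.cast : ℤ → ℝ) Int.cast_sub, single_intCast]

theorem vecS_real : vecS ℝ = ![single 6 0 36 - single 7 1 36,
    single 3 0 12 + single 5 1 12 + single 7 4 12 - single 6 2 12 - single 7 3 24,
    single 2 0 4 + single 3 1 4 + single 4 1 4 - single 6 3 4 - single 6 4 4 - single 7 5 4,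
    single 5 3 12 + single 7 6 6 - single 1 0 6 - single 3 2 6 - single 5 4 6,
    single 0 0 2 + single 3 3 2 + single 4 3 4 + single 5 5 2 + single 6 6 2 - single 1 1 2 -
        single 2 2 2 - single 3 4 4 - single 4 4 2 - single 7 7 2,
    single 0 1 1 + single 3 5 1 + single 4 5 1 - single 2 3 1 - single 2 4 1 - single 6 7 1,
    single 1 2 6 - single 5 6 6,
    single 1 4 4 + single 5 7 2 - single 0 2 2 - single 1 3 2 - single 4 6 2,
    single 0 3 1 + single 2 6 1 + single 4 7 1 - single 0 4 2 - single 1 5 1,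
    single 0 5 1 - single 2 7 1] := by
  funext i
  rw [← vecS_map (Int.castRingHom ℝ), vecS_int]
  fin_cases i <;> simp [Matrix.map_add (Int.cast : ℤ → ℝ) Int.cast_add,
      Matrix.map_sub (Int.cast : ℤ → ℝ) Int.cast_sub, single_intCast]

theorem killing_real : killing ℝ = !![0,0,0,0,0,0,0,6; 0,0,0,0,0,0,6,0; 0,0,0,0,0,6,0,0;
    0,0,0,12,-6,0,0,0; 0,0,0,-6,12,0,0,0; 0,0,6,0,0,0,0,0; 0,6,0,0,0,0,0,0; 6,0,0,0,0,0,0,0] := by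
  have h : killing ℤ = !![0,0,0,0,0,0,0,6; 0,0,0,0,0,0,6,0; 0,0,0,0,0,6,0,0;
    0,0,0,12,-6,0,0,0; 0,0,0,-6,12,0,0,0; 0,0,6,0,0,0,0,0; 0,6,0,0,0,0,0,0;
    6,0,0,0,0,0,0,0] := by decide +kernel
  rw [← killing_map (Int.castRingHom ℝ), h]
  ext i j
  fin_cases i <;> fin_cases j <;> simp

end

/-! ### Coordinates on `o(V, κ) = sl(3) ⊕ Γ₃₀ ⊕ Γ₀₃` -/

section

open Matrix (single)

/-- The matrix `ad Y + ∑ rᵢ Rᵢ + ∑ sᵢ Sᵢ`, where `Rᵢ` and `Sᵢ` are the weight vectors `vecR i` and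
`vecS i`. The diagonal entries of `Y` enter in such a way that the `ad Y`-part is correct also for
`Y` of nonzero trace. -/
def ofCoords (Y : Matrix (Fin 3) (Fin 3) ℝ) (r s : Fin 10 → ℝ) : Mat8 :=
  !![Y 0 0 - Y 2 2 - 2 * r 4 + 2 * s 4, -Y 1 2 - 2 * r 3 + s 5, Y 0 1 + r 2 - 2 * s 7,
      -Y 0 2 - 2 * r 1 + s 8, -Y 0 2 + r 1 - 2 * s 8, s 9, r 0, 0;
    -Y 2 1 + 4 * r 5 - 6 * s 3, Y 0 0 - Y 1 1 + 2 * r 4 - 2 * s 4, 6 * s 6,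
        -2 * Y 0 1 + r 2 - 2 * s 7, Y 0 1 + r 2 + 4 * s 7, Y 0 2 - r 1 - s 8, 0, -r 0;
    Y 1 0 - 6 * r 7 + 4 * s 2, -6 * r 6, Y 1 1 - Y 2 2 + 2 * r 4 - 2 * s 4, Y 1 2 - 4 * r 3 - s 5,
        -2 * Y 1 2 + 2 * r 3 - s 5, 0, -Y 0 2 + r 1 + s 8, -s 9;
    -Y 2 0 + 12 * s 1, -Y 1 0 + 4 * s 2, -4 * r 5 - 6 * s 3, 2 * r 4 + 2 * s 4, -4 * r 4 - 4 * s 4,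
        2 * r 3 + s 5, Y 0 1 - r 2, Y 0 2 + r 1;
    -Y 2 0 + 12 * r 8, 6 * r 7 + 4 * s 2, -Y 2 1 - 4 * r 5, 4 * r 4 + 4 * s 4, -2 * r 4 - 2 * s 4,
        Y 1 2 + s 5, -r 2 - 2 * s 7, Y 0 2 + s 8;
    36 * r 9, Y 2 0 + 12 * r 8 + 12 * s 1, 0, -Y 2 1 + 4 * r 5 + 12 * s 3,
        2 * Y 2 1 + 4 * r 5 - 6 * s 3, -Y 1 1 + Y 2 2 - 2 * r 4 + 2 * s 4, -6 * s 6,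
            -Y 0 1 - r 2 + 2 * s 7;
    36 * s 0, 0, -Y 2 0 - 12 * r 8 - 12 * s 1, 2 * Y 1 0 + 6 * r 7 - 4 * s 2,
        -Y 1 0 - 12 * r 7 - 4 * s 2, 6 * r 6, -Y 0 0 + Y 1 1 - 2 * r 4 + 2 * s 4,
            Y 1 2 + 2 * r 3 - s 5;
    0, -36 * s 0, -36 * r 9, Y 2 0 + 12 * r 8 - 24 * s 1, Y 2 0 - 24 * r 8 + 12 * s 1,
        -Y 1 0 + 6 * r 7 - 4 * s 2, Y 2 1 - 4 * r 5 + 6 * s 3, -Y 0 0 + Y 2 2 + 2 * r 4 - 2 * s 4]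

/-- The coefficients of the `Γ₃₀`-component of a matrix in the basis `vecR`. -/
def coefR (X : Mat8) : Fin 10 → ℝ :=
  ![(36 * X 0 6 - 36 * X 1 7) / 72,
    (12 * X 0 3 + 12 * X 1 5 - 12 * X 2 6 - 24 * X 3 7 + 12 * X 4 7) / (-72),
    (4 * X 0 2 + 4 * X 1 3 + 4 * X 1 4 - 4 * X 3 6 - 4 * X 4 6 - 4 * X 5 7) / 24,
    (-6 * X 0 1 - 6 * X 2 3 + 12 * X 3 5 - 6 * X 4 5 + 6 * X 6 7) / 72,
    (2 * X 0 0 - 2 * X 1 1 - 2 * X 2 2 + 2 * X 3 3 - 4 * X 4 3 + 4 * X 3 4 - 2 * X 4 4 +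
        2 * X 5 5 + 2 * X 6 6 - 2 * X 7 7) / (-48),
    (X 1 0 - X 3 2 - X 4 2 + X 5 3 + X 5 4 - X 7 6) / 24,
    (6 * X 2 1 - 6 * X 6 5) / (-72),
    (-2 * X 2 0 - 2 * X 3 1 + 4 * X 4 1 - 2 * X 6 4 + 2 * X 7 5) / 72,
    (X 3 0 - 2 * X 4 0 - X 5 1 + X 6 2 + X 7 4) / (-72),
    (X 5 0 - X 7 2) / 72]

/-- The coefficients of the `Γ₀₃`-component of a matrix in the basis `vecS`. -/
def coefS (X : Mat8) : Fin 10 → ℝ :=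
  ![(X 6 0 - X 7 1) / 72,
    (-2 * X 3 0 + X 4 0 - X 5 1 + X 6 2 + X 7 3) / (-72),
    (X 2 0 + X 3 1 + X 4 1 - X 6 3 - X 6 4 - X 7 5) / 24,
    (-2 * X 1 0 - 4 * X 3 2 + 2 * X 4 2 + 2 * X 5 3 + 2 * X 7 6) / 72,
    (-2 * X 0 0 + 2 * X 1 1 + 2 * X 2 2 + 2 * X 3 3 - 4 * X 4 3 + 4 * X 3 4 - 2 * X 4 4 -
        2 * X 5 5 - 2 * X 6 6 + 2 * X 7 7) / (-48),
    (4 * X 0 1 - 4 * X 2 3 - 4 * X 2 4 + 4 * X 3 5 + 4 * X 4 5 - 4 * X 6 7) / 24,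
    (-6 * X 1 2 + 6 * X 5 6) / (-72),
    (-6 * X 0 2 + 6 * X 1 4 + 6 * X 3 6 - 12 * X 4 6 + 6 * X 5 7) / 72,
    (12 * X 0 4 + 12 * X 1 5 - 12 * X 2 6 + 12 * X 3 7 - 24 * X 4 7) / (-72),
    (36 * X 0 5 - 36 * X 2 7) / 72]

/-- The action of a matrix on `Γ₃₀` in the basis `vecR`. -/
def actR (Y : Matrix (Fin 3) (Fin 3) ℝ) (r : Fin 10 → ℝ) : Fin 10 → ℝ :=
  ![2 * Y 0 0 * r 0 - Y 1 1 * r 0 - Y 2 2 * r 0 + 3 * Y 0 1 * r 1 + 3 * Y 0 2 * r 2,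
    Y 1 0 * r 0 + Y 0 0 * r 1 - Y 2 2 * r 1 + Y 1 2 * r 2 + 4 * Y 0 1 * r 3 + 4 * Y 0 2 * r 4,
    Y 2 0 * r 0 + Y 2 1 * r 1 + Y 0 0 * r 2 - Y 1 1 * r 2 + 4 * Y 0 1 * r 4 + 8 * Y 0 2 * r 5,
    Y 1 0 * r 1 + Y 1 1 * r 3 - Y 2 2 * r 3 + 2 * Y 1 2 * r 4 + 3 * Y 0 1 * r 6 + 3 * Y 0 2 * r 7,
    Y 2 0 * r 1 / 2 + Y 1 0 * r 2 / 2 + Y 2 1 * r 3 + 2 * Y 1 2 * r 5 + 3 * Y 0 1 * r 7 +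
        6 * Y 0 2 * r 8,
    Y 2 0 * r 2 / 2 + Y 2 1 * r 4 - Y 1 1 * r 5 + Y 2 2 * r 5 + 3 * Y 0 1 * r 8 + 9 * Y 0 2 * r 9,
    Y 1 0 * r 3 - Y 0 0 * r 6 + 2 * Y 1 1 * r 6 - Y 2 2 * r 6 + 3 * Y 1 2 * r 7,
    Y 2 0 * r 3 / 3 + 2 / 3 * Y 1 0 * r 4 + Y 2 1 * r 6 - Y 0 0 * r 7 + Y 1 1 * r 7 +
        4 * Y 1 2 * r 8,
    Y 2 0 * r 4 / 3 + Y 1 0 * r 5 / 3 + Y 2 1 * r 7 - Y 0 0 * r 8 + Y 2 2 * r 8 + 3 * Y 1 2 * r 9,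
    Y 2 0 * r 5 / 3 + Y 2 1 * r 8 - Y 0 0 * r 9 - Y 1 1 * r 9 + 2 * Y 2 2 * r 9]

/-- The bracket `Γ₀₃ × Γ₀₃ → Γ₃₀` of `o(V, κ)` in the bases `vecS` and `vecR`. -/
def bracketSS (s t : Fin 10 → ℝ) : Fin 10 → ℝ :=
  ![6 * (s 6 * t 9 - s 9 * t 6) - 6 * (s 7 * t 8 - s 8 * t 7),
    6 * (s 3 * t 9 - s 9 * t 3) - 4 * (s 4 * t 8 - s 8 * t 4) + 2 * (s 5 * t 7 - s 7 * t 5),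
    6 * (s 3 * t 8 - s 8 * t 3) - 8 * (s 4 * t 7 - s 7 * t 4) + 6 * (s 5 * t 6 - s 6 * t 5),
    6 * (s 1 * t 9 - s 9 * t 1) - 2 * (s 2 * t 8 - s 8 * t 2) - 2 * (s 4 * t 5 - s 5 * t 4),
    6 * (s 1 * t 8 - s 8 * t 1) - 4 * (s 2 * t 7 - s 7 * t 2) - 3 * (s 3 * t 5 - s 5 * t 3),
    6 * (s 1 * t 7 - s 7 * t 1) - 6 * (s 2 * t 6 - s 6 * t 2) - 6 * (s 3 * t 4 - s 4 * t 3),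
    6 * (s 0 * t 9 - s 9 * t 0) - 2 * (s 2 * t 5 - s 5 * t 2),
    6 * (s 0 * t 8 - s 8 * t 0) - 2 * (s 1 * t 5 - s 5 * t 1) - 8 / 3 * (s 2 * t 4 - s 4 * t 2),
    6 * (s 0 * t 7 - s 7 * t 0) - 4 * (s 1 * t 4 - s 4 * t 1) - 2 * (s 2 * t 3 - s 3 * t 2),
    6 * (s 0 * t 6 - s 6 * t 0) - 6 * (s 1 * t 3 - s 3 * t 1)]

/-- The `g₋`-component of the bracket `Γ₃₀ × Γ₀₃ → sl(3)` of `o(V, κ)`. -/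
def bracketRS (r s : Fin 10 → ℝ) : Fin 3 → ℝ :=
  ![36 * r 2 * s 0 - 48 * r 4 * s 1 + 32 * r 5 * s 2 + 36 * r 7 * s 3 - 48 * r 8 * s 4 +
      36 * r 9 * s 5,
    36 * r 1 * s 0 - 48 * r 3 * s 1 + 16 * r 4 * s 2 + 36 * r 6 * s 3 - 24 * r 7 * s 4 +
        12 * r 8 * s 5,
    -12 * r 2 * s 1 + 24 * r 4 * s 3 - 16 * r 5 * s 4 - 36 * r 7 * s 6 + 48 * r 8 * s 7 -
        36 * r 9 * s 8]

set_option maxHeartbeats 2000000 in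
theorem ad_eq_ofCoords (Y : Matrix (Fin 3) (Fin 3) ℝ) : ad Y = ofCoords Y 0 0 := by
  ext i j
  fin_cases i <;> fin_cases j <;>
    simp only [Fin.reduceFinMk, Fin.zero_eta, Fin.mk_one, ad, ofCoords, coord, basisA, E,
      Matrix.mul_apply, Fin.sum_univ_three, Matrix.of_apply, Matrix.cons_val, Matrix.sub_apply,
      Pi.zero_apply] <;>
    simp <;> try ring

/-- The coefficients as quotients of traces, as in the definition of `projR`. -/
theorem coefR_apply (X : Mat8) (i : Fin 10) :
    coefR X i = (X * vecS ℝ i).trace / (vecR ℝ i * vecS ℝ i).trace := by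
  rw [vecR_real, vecS_real]
  fin_cases i <;>
    simp [coefR, mul_add, mul_sub, add_mul, sub_mul, Matrix.trace_mul_single] <;> norm_num <;> ring

end

/-! ### Elements of `o(V, κ)` and their brackets in coordinates -/

section

set_option maxHeartbeats 4000000 in
/-- The entries of the `sl(3)`-component. -/
theorem projI_eq (X : Mat8) : projI X = !![(X 0 0 + X 1 1 - X 6 6 - X 7 7) / 6,
    (X 0 2 - X 1 3 + 2 * X 3 6 - X 4 6 - X 5 7) / 6,
    (-X 0 3 - X 0 4 + X 1 5 - X 2 6 + X 3 7 + X 4 7) / 6;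
    (X 2 0 - 2 * X 3 1 + X 4 1 + X 6 3 - X 7 5) / 6,
    (-X 1 1 + X 2 2 - X 5 5 + X 6 6) / 6,
    (-X 0 1 - X 2 4 - X 3 5 + 2 * X 4 5 + X 6 7) / 6;
    (-X 3 0 - X 4 0 + X 5 1 - X 6 2 + X 7 3 + X 7 4) / 6,
    (-X 1 0 + X 3 2 - 2 * X 4 2 + X 5 4 + X 7 6) / 6,
    (-X 0 0 - X 2 2 + X 5 5 + X 7 7) / 6] := by
  ext i j
  fin_cases i <;> fin_cases j <;>
    simp only [Fin.reduceFinMk, Fin.zero_eta, Fin.mk_one, projI, ad_eq_ofCoords, ofCoords,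
      Matrix.trace, Matrix.diag_apply, Matrix.mul_apply, Fin.sum_univ_eight, Matrix.of_apply,
      Matrix.cons_val, Pi.zero_apply, E] <;>
    simp <;>
    ring

set_option maxHeartbeats 4000000 in
/-- An element of `o(V, κ)` is determined by its component in `sl(3)` and its coordinates in
`Γ₃₀` and `Γ₀₃`. The proof solves the equations `XᵀK + KX = 0` for 36 of the entries. -/
theorem eq_ofCoords_of_skew (X : Mat8) (h : Xᵀ * killing ℝ + killing ℝ * X = 0) :
    X = ofCoords (projI X) (coefR X) (coefS X) := by
  let kX : Fin 8 → Fin 8 → ℝ := fun p q => ![6 * X 7 q, 6 * X 6 q, 6 * X 5 q,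
    12 * X 3 q - 6 * X 4 q, -6 * X 3 q + 12 * X 4 q, 6 * X 2 q, 6 * X 1 q, 6 * X 0 q] p
  have hk : ∀ p q, (killing ℝ * X) p q = kX p q := by
    intro p q
    rw [killing_real]
    fin_cases p <;> simp [kX, Matrix.mul_apply, Fin.sum_univ_eight]; ring
  have hk' : ∀ p q, (Xᵀ * killing ℝ) p q = kX q p := by
    intro p q
    have : Xᵀ * killing ℝ = (killing ℝ * X)ᵀ := by
      rw [Matrix.transpose_mul]
      congr 1
      rw [killing_real]
      ext i j
      fin_cases i <;> fin_cases j <;> rfl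
    rw [this, Matrix.transpose_apply, hk]
  have k : ∀ p q, kX q p + kX p q = 0 := fun p q => by
    have := congrFun₂ h p q
    rwa [Matrix.add_apply, hk, hk'] at this
  replace k : ∀ p q : Fin 8, ![6 * X 7 p, 6 * X 6 p, 6 * X 5 p, 12 * X 3 p - 6 * X 4 p,
      -6 * X 3 p + 12 * X 4 p, 6 * X 2 p, 6 * X 1 p, 6 * X 0 p] q +
      ![6 * X 7 q, 6 * X 6 q, 6 * X 5 q, 12 * X 3 q - 6 * X 4 q, -6 * X 3 q + 12 * X 4 q,
        6 * X 2 q, 6 * X 1 q, 6 * X 0 q] p = 0 := k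
  clear hk hk' h
  have e70 : X 7 0 = 0 := by
    have := k 0 0
    simp at this
    linarith
  have e71 : X 7 1 = -X 6 0 := by
    have := k 0 1
    simp at this
    linarith
  have e72 : X 7 2 = -X 5 0 := by
    have := k 0 2
    simp at this
    linarith
  have e75 : X 7 5 = -X 2 0 := by
    have := k 0 5
    simp at this
    linarith
  have e76 : X 7 6 = -X 1 0 := by
    have := k 0 6
    simp at this
    linarith
  have e77 : X 7 7 = -X 0 0 := by
    have := k 0 7
    simp at this
    linarith
  have e61 : X 6 1 = 0 := by
    have := k 1 1
    simp at this
    linarith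
  have e62 : X 6 2 = -X 5 1 := by
    have := k 1 2
    simp at this
    linarith
  have e65 : X 6 5 = -X 2 1 := by
    have := k 1 5
    simp at this
    linarith
  have e66 : X 6 6 = -X 1 1 := by
    have := k 1 6
    simp at this
    linarith
  have e67 : X 6 7 = -X 0 1 := by
    have := k 1 7
    simp at this
    linarith
  have e52 : X 5 2 = 0 := by
    have := k 2 2
    simp at this
    linarith
  have e55 : X 5 5 = -X 2 2 := by
    have := k 2 5
    simp at this
    linarith
  have e56 : X 5 6 = -X 1 2 := by
    have := k 2 6
    simp at this
    linarith
  have e57 : X 5 7 = -X 0 2 := by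
    have := k 2 7
    simp at this
    linarith
  have e25 : X 2 5 = 0 := by
    have := k 5 5
    simp at this
    linarith
  have e26 : X 2 6 = -X 1 5 := by
    have := k 5 6
    simp at this
    linarith
  have e27 : X 2 7 = -X 0 5 := by
    have := k 5 7
    simp at this
    linarith
  have e16 : X 1 6 = 0 := by
    have := k 6 6
    simp at this
    linarith
  have e17 : X 1 7 = -X 0 6 := by
    have := k 6 7
    simp at this
    linarith
  have e07 : X 0 7 = 0 := by
    have := k 7 7
    simp at this
    linarith
  have e73 : X 7 3 = -2 * X 3 0 + X 4 0 := by
    have := k 0 3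
    simp at this
    linarith
  have e74 : X 7 4 = X 3 0 - 2 * X 4 0 := by
    have := k 0 4
    simp at this
    linarith
  have e63 : X 6 3 = -2 * X 3 1 + X 4 1 := by
    have := k 1 3
    simp at this
    linarith
  have e64 : X 6 4 = X 3 1 - 2 * X 4 1 := by
    have := k 1 4
    simp at this
    linarith
  have e53 : X 5 3 = -2 * X 3 2 + X 4 2 := by
    have := k 2 3
    simp at this
    linarith
  have e54 : X 5 4 = X 3 2 - 2 * X 4 2 := by
    have := k 2 4
    simp at this
    linarith
  have e23 : X 2 3 = -2 * X 3 5 + X 4 5 := by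
    have := k 5 3
    simp at this
    linarith
  have e24 : X 2 4 = X 3 5 - 2 * X 4 5 := by
    have := k 5 4
    simp at this
    linarith
  have e13 : X 1 3 = -2 * X 3 6 + X 4 6 := by
    have := k 6 3
    simp at this
    linarith
  have e14 : X 1 4 = X 3 6 - 2 * X 4 6 := by
    have := k 6 4
    simp at this
    linarith
  have e03 : X 0 3 = -2 * X 3 7 + X 4 7 := by
    have := k 7 3
    simp at this
    linarith
  have e04 : X 0 4 = X 3 7 - 2 * X 4 7 := by
    have := k 7 4
    simp at this
    linarith
  have e43 : X 4 3 = 2 * X 3 3 := by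
    have := k 3 3
    simp at this
    linarith
  have e34 : X 3 4 = 2 * X 4 4 := by
    have := k 4 4
    simp at this
    linarith
  have e44 : X 4 4 = -X 3 3 := by
    have := k 3 4
    simp at this
    linarith
  clear k kX
  ext p q
  fin_cases p <;> fin_cases q <;>
    simp only [Fin.reduceFinMk, Fin.zero_eta, Fin.mk_one, ofCoords, projI_eq, coefR, coefS,
      Matrix.of_apply, Matrix.cons_val,
      e70, e71, e72, e75, e76, e77, e61, e62, e65, e66, e67, e52, e55, e56, e57, e25, e26, e27,
      e16, e17, e07, e73, e74, e63, e64, e53, e54, e23, e24, e13, e14, e03, e04, e43, e34, e44] <;>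
    ring

set_option maxHeartbeats 4000000 in
/-- The `Γ₃₀`-component of the bracket of `o(V, κ)`, which is graded modulo 3 by
`sl(3) ⊕ Γ₃₀ ⊕ Γ₀₃`. -/
theorem coefR_lie (Y Z : Matrix (Fin 3) (Fin 3) ℝ) (r s t u : Fin 10 → ℝ) :
    coefR ⁅ofCoords Y r s, ofCoords Z t u⁆ = actR Y t - actR Z r + bracketSS s u := by
  funext i
  fin_cases i <;>
    simp only [Fin.reduceFinMk, Fin.zero_eta, Fin.mk_one, Ring.lie_def, coefR, Matrix.cons_val,
      Matrix.sub_apply, Matrix.mul_apply, Fin.sum_univ_eight, Pi.add_apply, Pi.sub_apply, actR,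
      bracketSS] <;>
    simp only [ofCoords, Matrix.of_apply, Matrix.cons_val] <;>
    ring

set_option maxHeartbeats 4000000 in
/-- The `g₋`-component of the bracket of `o(V, κ)`; the brackets of `sl(3)` with `Γ₃₀ ⊕ Γ₀₃` do not
contribute. -/
theorem negPart_projI_lie (Y Z : Matrix (Fin 3) (Fin 3) ℝ) (r s t u : Fin 10 → ℝ) :
    negPart (projI ⁅ofCoords Y r s, ofCoords Z t u⁆) =
      negPart ⁅Y, Z⁆ + bracketRS r u - bracketRS t s := by
  funext i
  fin_cases i <;>
    simp only [Fin.reduceFinMk, Fin.zero_eta, Fin.mk_one, Ring.lie_def, negPart, projI_eq,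
      Matrix.cons_val, Matrix.of_apply, Matrix.sub_apply, Matrix.mul_apply, Fin.sum_univ_eight,
      Fin.sum_univ_three, Pi.add_apply, Pi.sub_apply, bracketRS] <;>
    simp only [ofCoords, Matrix.of_apply, Matrix.cons_val] <;>
    ring

theorem coefR_ofCoords (Y : Matrix (Fin 3) (Fin 3) ℝ) (r s : Fin 10 → ℝ) :
    coefR (ofCoords Y r s) = r := by
  funext i
  fin_cases i <;> simp only [Fin.reduceFinMk, Fin.zero_eta, Fin.mk_one, coefR, ofCoords,
    Matrix.of_apply, Matrix.cons_val] <;> ring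

theorem coefS_ofCoords (Y : Matrix (Fin 3) (Fin 3) ℝ) (r s : Fin 10 → ℝ) :
    coefS (ofCoords Y r s) = s := by
  funext i
  fin_cases i <;> simp only [Fin.reduceFinMk, Fin.zero_eta, Fin.mk_one, coefS, ofCoords,
    Matrix.of_apply, Matrix.cons_val] <;> ring

end

/-! ### The structure equation of a moving frame -/

section MovingFrame

variable {E T A : Type*} [NormedAddCommGroup E] [NormedSpace ℝ E]
  [NormedAddCommGroup T] [NormedSpace ℝ T]
  [NormedRing A] [NormedAlgebra ℝ A]

/-- The logarithmic derivative `f⁻¹ df` of a map to a normed algebra. -/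
def logDeriv (f : E → A) (z : E) : E →L[ℝ] A :=
  (ContinuousLinearMap.mul ℝ A (Ring.inverse (f z))).comp (fderiv ℝ f z)

theorem logDeriv_apply (f : E → A) (z v : E) :
    logDeriv f z v = Ring.inverse (f z) * fderiv ℝ f z v := rfl

/-- The vector field `v` with `N (f⁻¹ df) v = t`, for `N ∘ f⁻¹ df` an isomorphism. -/
def dualField (f : E → A) (N : A →L[ℝ] T) (t : T) (z : E) : E :=
  (N.comp (logDeriv f z)).inverse t

theorem exists_equiv_of_bijective [CompleteSpace E] [CompleteSpace T] {θ : E →L[ℝ] T}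
    (h : Function.Bijective θ) :
    ∃ e : E ≃L[ℝ] T, (e : E →L[ℝ] T) = θ :=
  ⟨ContinuousLinearEquiv.ofBijective θ (LinearMap.ker_eq_bot.2 h.1)
    (LinearMap.range_eq_top.2 h.2), ContinuousLinearEquiv.coe_ofBijective _ _ _⟩

theorem apply_dualField [CompleteSpace E] [CompleteSpace T] {f : E → A} {N : A →L[ℝ] T} {z : E}
    (h : Function.Bijective (N.comp (logDeriv f z))) (t : T) :
    N (logDeriv f z (dualField f N t z)) = t := by
  obtain ⟨e, he⟩ := exists_equiv_of_bijective h
  change (N.comp (logDeriv f z)) (dualField f N t z) = t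
  rw [dualField, ← he, ContinuousLinearMap.inverse_equiv]
  simp

variable {O : Set E} {f : E → A} {N : A →L[ℝ] T}

theorem contDiffOn_logDeriv [CompleteSpace A] (hO : IsOpen O) (hf : ContDiffOn ℝ ∞ f O)
    (hu : ∀ z ∈ O, IsUnit (f z)) : ContDiffOn ℝ ∞ (logDeriv f) O := by
  intro z hz
  have hfz : ContDiffAt ℝ ∞ f z := hf.contDiffAt (hO.mem_nhds hz)
  obtain ⟨u, hu⟩ := hu z hz
  have h1 : ContDiffAt ℝ ∞ (fun y => Ring.inverse (f y)) z :=
    ContDiffAt.comp (g := Ring.inverse) z (hu ▸ contDiffAt_ringInverse ℝ u) hfz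
  have h2 : ContDiffAt ℝ ∞ (fderiv ℝ f) z := hfz.fderiv_right (by simp)
  exact (((ContinuousLinearMap.mul ℝ A).contDiff.contDiffAt.comp z h1).clm_comp
    h2).contDiffWithinAt

theorem contDiffOn_dualField [CompleteSpace E] [CompleteSpace T] [CompleteSpace A] (hO : IsOpen O)
    (hf : ContDiffOn ℝ ∞ f O)
    (hu : ∀ z ∈ O, IsUnit (f z))
    (hN : ∀ z ∈ O, Function.Bijective (N.comp (logDeriv f z))) (t : T) :
    ContDiffOn ℝ ∞ (dualField f N t) O := by
  intro z hz
  obtain ⟨e, he⟩ := exists_equiv_of_bijective (hN z hz)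
  have h1 : ContDiffAt ℝ ∞ (fun y => N.comp (logDeriv f y)) z :=
    contDiffAt_const.clm_comp ((contDiffOn_logDeriv hO hf hu).contDiffAt (hO.mem_nhds hz))
  have h2 : ContDiffAt ℝ ∞ (fun y => (N.comp (logDeriv f y)).inverse) z :=
    ContDiffAt.comp (g := ContinuousLinearMap.inverse) z (he ▸ contDiffAt_map_inverse e) h1
  exact (h2.clm_apply contDiffAt_const).contDiffWithinAt

/-- The structure equation `dω + ω ∧ ω = 0` of `ω = f⁻¹ df`, evaluated on the vector fields `vᵢ`
dual to the coframe `N ω`: `D i j` is the derivative of `ω vⱼ` in the direction `vᵢ`, and the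
`c i j k` are the structure functions of the frame. -/
theorem exists_structure_equation [CompleteSpace E] [CompleteSpace A] {ι : Type*} [Fintype ι]
    [DecidableEq ι] {N : A →L[ℝ] (ι → ℝ)}
    (hO : IsOpen O) (hf : ContDiffOn ℝ ∞ f O) (hu : ∀ z ∈ O, IsUnit (f z))
    (hN : ∀ z ∈ O, Function.Bijective (N.comp (logDeriv f z))) {z : E} (hz : z ∈ O)
    {Ω : ι → E → A} (hΩ : ∀ i, ∀ y ∈ O, Ω i y = logDeriv f y (dualField f N (Pi.single i 1) y)) :
    ∃ (D : ι → ι → A) (c : ι → ι → ι → ℝ),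
      (∀ i j, D i j - D j i - ∑ k, c i j k • Ω k z + ⁅Ω i z, Ω j z⁆ = 0) ∧
      ∀ (ℓ : A →L[ℝ] ℝ) (a : ℝ) (j : ι), (∀ y ∈ O, ℓ (Ω j y) = a) → ∀ i, ℓ (D i j) = 0 := by
  set V : ι → E → E := fun i => dualField f N (Pi.single i 1) with hV
  have hOz := hO.mem_nhds hz
  have hVd : ∀ i, DifferentiableAt ℝ (V i) z := fun i =>
    ((contDiffOn_dualField hO hf hu hN _).contDiffAt hOz).differentiableAt (by simp)
  have hΩe : ∀ i, Ω i =ᶠ[nhds z] fun y => logDeriv f y (V i y) := fun i =>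
    Filter.eventually_of_mem hOz (hΩ i)
  have hΩd : ∀ i, DifferentiableAt ℝ (Ω i) z := fun i =>
    (DifferentiableAt.clm_apply (((contDiffOn_logDeriv hO hf hu).contDiffAt hOz).differentiableAt
      (by simp)) (hVd i)).congr_of_eventuallyEq (hΩe i)
  have hfz : ContDiffAt ℝ ∞ f z := hf.contDiffAt hOz
  have hfd : DifferentiableAt ℝ f z := hfz.differentiableAt (by simp)
  have hfd2 : DifferentiableAt ℝ (fderiv ℝ f) z :=
    (hfz.fderiv_right (m := ∞) (by simp)).differentiableAt (by simp)
  have hmul : ∀ y ∈ O, ∀ v, f y * logDeriv f y v = fderiv ℝ f y v := fun y hy v => by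
    rw [logDeriv_apply, Ring.mul_inverse_cancel_left _ _ (hu y hy)]
  -- the derivative of `f * Ω j = df (V j)` in the direction `V i`
  have key : ∀ i j, f z * Ω i z * Ω j z + f z * fderiv ℝ (Ω j) z (V i z) =
      fderiv ℝ (fderiv ℝ f) z (V i z) (V j z) + fderiv ℝ f z (fderiv ℝ (V j) z (V i z)) := by
    intro i j
    have e1 : (fun y => f y * Ω j y) =ᶠ[nhds z] fun y => fderiv ℝ f y (V j y) :=
      Filter.eventually_of_mem hOz fun y hy => by
        change f y * Ω j y = _
        rw [hΩ j y hy, hmul y hy]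
    have e2 := (hfd.hasFDerivAt.mul' (hΩd j).hasFDerivAt).congr_of_eventuallyEq e1.symm
    have e3 := hfd2.hasFDerivAt.clm_apply (hVd j).hasFDerivAt
    have e4 := congrArg (fun L => L (V i z)) (e2.unique e3)
    simp only [add_apply, smul_apply, smul_eq_mul,
      MulOpposite.smul_eq_mul_unop, MulOpposite.unop_op, ContinuousLinearMap.comp_apply,
      ContinuousLinearMap.flip_apply] at e4
    rw [hΩ i z hz, hmul z hz, add_comm, e4, add_comm]
  have hsymm := (hfz.isSymmSndFDerivAt
    (by simpa using WithTop.coe_le_coe.2 (le_top (a := (2 : ℕ∞))))).eq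
  refine ⟨fun i j => fderiv ℝ (Ω j) z (V i z), fun i j k =>
    N (logDeriv f z (fderiv ℝ (V j) z (V i z) - fderiv ℝ (V i) z (V j z))) k, ?_, ?_⟩
  · intro i j
    set w := fderiv ℝ (V j) z (V i z) - fderiv ℝ (V i) z (V j z) with hw
    have hc : ∑ k, N (logDeriv f z w) k • Ω k z = logDeriv f z w := by
      have h1 : ∑ k, N (logDeriv f z w) k • Ω k z =
          logDeriv f z (∑ k, N (logDeriv f z w) k • V k z) := by
        simp only [map_sum, map_smul, hΩ _ z hz, hV]
      rw [h1]
      congr 1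
      apply (hN z hz).1
      change N (logDeriv f z _) = N (logDeriv f z w)
      simp only [map_sum, map_smul, hV, apply_dualField (hN z hz)]
      ext k
      simp [Finset.sum_apply, Pi.single_apply]
    rw [hc]
    have h2 : f z * (fderiv ℝ (Ω j) z (V i z) - fderiv ℝ (Ω i) z (V j z) - logDeriv f z w +
        ⁅Ω i z, Ω j z⁆) = 0 := by
      have a := key i j
      have b := key j i
      rw [hsymm (V i z) (V j z)] at a
      rw [mul_add, mul_sub, hmul z hz, Ring.lie_def, hw, map_sub, mul_sub, mul_sub, ← mul_assoc,
        ← mul_assoc]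
      have h3 := congrArg₂ HSub.hSub a b
      rw [← sub_eq_zero] at h3
      rw [← h3]
      abel
    exact (hu z hz).mul_right_eq_zero.1 h2
  · intro ℓ a j h i
    have h1 : (fun y => ℓ (Ω j y)) =ᶠ[nhds z] fun _ => a := Filter.eventually_of_mem hOz h
    have h2 := (ℓ.hasFDerivAt.comp z (hΩd j).hasFDerivAt).congr_of_eventuallyEq h1.symm
    have h3 := h2.unique (hasFDerivAt_const a z)
    exact congrArg (fun L => L (V i z)) h3

end MovingFrame

/-! ### Frames in a chart -/

section

attribute [local instance] Matrix.linftyOpNormedRing Matrix.linftyOpNormedAlgebra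

/-- A matrix entry, as a continuous linear form. -/
def entryCLM (i j : Fin 8) : Mat8 →L[ℝ] ℝ :=
  LinearMap.toContinuousLinearMap (Matrix.entryLinearMap ℝ ℝ i j)

section Normed

variable {E : Type*} [NormedAddCommGroup E] [NormedSpace ℝ E]

/-- A matrix-valued map is smooth if its entries are. -/
theorem contDiffOn_matrix {f : E → Mat8} {O : Set E}
    (h : ∀ i j, ContDiffOn ℝ ∞ (fun z => f z i j) O) : ContDiffOn ℝ ∞ f O := by
  have : f = fun z => ∑ i, ∑ j, f z i j • Matrix.single i j (1 : ℝ) := by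
    funext z
    conv_lhs => rw [Matrix.matrix_eq_sum_single (f z)]
    simp [Matrix.smul_single]
  rw [this]
  exact ContDiffOn.sum fun i _ => ContDiffOn.sum fun j _ => (h i j).smul contDiffOn_const

theorem fderiv_entry {f : E → Mat8} {z : E} (h : DifferentiableAt ℝ f z) (v : E) (i j : Fin 8) :
    fderiv ℝ (fun y => f y i j) z v = fderiv ℝ f z v i j := by
  have h1 := (entryCLM i j).hasFDerivAt.comp z h.hasFDerivAt
  exact congrArg (fun L => L v) h1.fderiv

/-- The derivative of the identity `τ(f) K f = K`, with `τ` linear; for the transposition `τ` it is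
the infinitesimal form of the orthogonality of `f` for the Gram matrix `K`. -/
theorem fderiv_quadratic {A : Type*} [NormedRing A] [NormedAlgebra ℝ A] {f : E → A} {z : E}
    (hf : DifferentiableAt ℝ f z) (τ : A →L[ℝ] A) {K : A}
    (h : ∀ᶠ y in nhds z, τ (f y) * K * f y = K) (v : E) :
    τ (f z) * K * fderiv ℝ f z v + τ (fderiv ℝ f z v) * K * f z = 0 := by
  have h1 := ((τ.hasFDerivAt.comp z hf.hasFDerivAt).mul_const' K).mul' hf.hasFDerivAt
  have h2 := h1.congr_of_eventuallyEq (f₁ := fun _ => K) (h.mono fun y hy => hy.symm)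
  exact congrArg (fun L => L v) (h2.unique (hasFDerivAt_const _ z))

theorem isUnit_killing : IsUnit (killing ℝ) := by
  refine (Units.mkOfMulEqOne (killing ℝ) !![0,0,0,0,0,0,0,1/6; 0,0,0,0,0,0,1/6,0;
    0,0,0,0,0,1/6,0,0; 0,0,0,1/9,1/18,0,0,0; 0,0,0,1/18,1/9,0,0,0; 0,0,1/6,0,0,0,0,0;
    0,1/6,0,0,0,0,0,0; 1/6,0,0,0,0,0,0,0] ?_).isUnit
  rw [killing_real]
  ext i j
  fin_cases i <;> fin_cases j <;>
    simp only [Fin.reduceFinMk, Fin.zero_eta, Fin.mk_one, Matrix.mul_apply, Fin.sum_univ_eight,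
      Matrix.of_apply, Matrix.cons_val, Matrix.one_apply] <;> norm_num <;> decide

theorem isUnit_of_mem_groupL {a : Mat8} (h : a ∈ groupL) : IsUnit a := by
  have h1 : IsUnit (aᵀ * killing ℝ * a) := by
    rw [show aᵀ * killing ℝ * a = killing ℝ from h]
    exact isUnit_killing
  rw [Matrix.isUnit_iff_isUnit_det] at h1 ⊢
  rw [Matrix.det_mul] at h1
  exact isUnit_of_mul_isUnit_right h1

/-- The logarithmic derivative of a map to `O(V, κ)` has values in `o(V, κ)`. -/
theorem logDeriv_skew {f : E → Mat8} {O : Set E} (hO : IsOpen O) (hf : ContDiffOn ℝ ∞ f O)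
    (hL : ∀ z ∈ O, f z ∈ groupL) {z : E} (hz : z ∈ O) (v : E) :
    (logDeriv f z v)ᵀ * killing ℝ + killing ℝ * logDeriv f z v = 0 := by
  have hd : DifferentiableAt ℝ f z := (hf.contDiffAt (hO.mem_nhds hz)).differentiableAt (by simp)
  have h3 : (f z)ᵀ * killing ℝ * fderiv ℝ f z v + (fderiv ℝ f z v)ᵀ * killing ℝ * f z = 0 :=
    fderiv_quadratic hd (LinearMap.toContinuousLinearMap
      (Matrix.transposeLinearEquiv (Fin 8) (Fin 8) ℝ ℝ).toLinearMap)
      (Filter.eventually_of_mem (hO.mem_nhds hz) hL) v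
  have hm : fderiv ℝ f z v = f z * logDeriv f z v :=
    (Ring.mul_inverse_cancel_left _ _ (isUnit_of_mem_groupL (hL z hz))).symm
  have hK : (f z)ᵀ * killing ℝ * f z = killing ℝ := hL z hz
  rw [hm, Matrix.transpose_mul] at h3
  calc _ = (logDeriv f z v)ᵀ * ((f z)ᵀ * killing ℝ * f z) +
        ((f z)ᵀ * killing ℝ * f z) * logDeriv f z v := by rw [hK]
    _ = 0 := by
      rw [add_comm, ← h3]
      simp only [Matrix.mul_assoc]

end Normed

variable {M : Type*} [TopologicalSpace M] [ChartedSpace (EuclideanSpace ℝ (Fin 3)) M]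

theorem contDiffOn_comp {E : Type*} [NormedAddCommGroup E] [NormedSpace ℝ E] {U : Set M}
    {s : M → Mat8} (hs : IsSmoothMat s U) {O : Set E} {g : E → M}
    (hg : ContMDiffOn 𝓘(ℝ, E) (𝓡 3) ∞ g O) (hmaps : Set.MapsTo g O U) :
    ContDiffOn ℝ ∞ (fun z => s (g z)) O :=
  contDiffOn_matrix fun i j => contMDiffOn_iff_contDiffOn.1 ((hs i j).comp hg hmaps)

/-- The pull-back of the Maurer-Cartan form along `s ∘ g`, for a map `g` from a normed space
to `M`, is the logarithmic derivative of `s ∘ g`. -/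
theorem omega_mfderiv {E : Type*} [NormedAddCommGroup E] [NormedSpace ℝ E] {U : Set M}
    {s : M → Mat8} (hU : IsOpen U) (hs : IsSmoothMat s U) {O : Set E} {g : E → M} (hO : IsOpen O)
    (hg : ContMDiffOn 𝓘(ℝ, E) (𝓡 3) ∞ g O) (hmaps : Set.MapsTo g O U) {z : E} (hz : z ∈ O)
    (w : E) : omega s (g z) (mfderiv 𝓘(ℝ, E) (𝓡 3) g z w) = logDeriv (fun z => s (g z)) z w := by
  have hfd : DifferentiableAt ℝ (fun z => s (g z)) z :=
    ((contDiffOn_comp hs hg hmaps).contDiffAt (hO.mem_nhds hz)).differentiableAt (by simp)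
  have hgd : MDifferentiableAt 𝓘(ℝ, E) (𝓡 3) g z :=
    (hg.contMDiffAt (hO.mem_nhds hz)).mdifferentiableAt (by simp)
  rw [omega, logDeriv_apply, ← Matrix.nonsing_inv_eq_ringInverse]
  congr 1
  ext i j
  refine Eq.trans ?_ (fderiv_entry hfd w i j)
  rw [← mfderiv_eq_fderiv]
  have hsd : MDifferentiableAt (𝓡 3) 𝓘(ℝ, ℝ) (fun y => s y i j) (g z) :=
    ((hs i j).contMDiffAt (hU.mem_nhds (hmaps hz))).mdifferentiableAt (by simp)
  exact (mfderiv_comp_apply z hsd hgd w).symm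

/-- A chart `g⁻¹` around `x` in which the frame `s` is the matrix-valued map `s ∘ g`. -/
theorem exists_chart_frame [IsManifold (𝓡 3) ∞ M] {U : Set M} {s : M → Mat8} (hU : IsOpen U)
    (hs : IsSmoothMat s U) {x : M} (hx : x ∈ U) :
    ∃ (O : Set (EuclideanSpace ℝ (Fin 3))) (g : EuclideanSpace ℝ (Fin 3) → M)
      (z₀ : EuclideanSpace ℝ (Fin 3)), IsOpen O ∧ z₀ ∈ O ∧ g z₀ = x ∧ Set.MapsTo g O U ∧
      ContMDiffOn 𝓘(ℝ, EuclideanSpace ℝ (Fin 3)) (𝓡 3) ∞ g O ∧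
      ContDiffOn ℝ ∞ (fun z => s (g z)) O ∧
      ∀ z ∈ O, Function.Bijective (mfderiv 𝓘(ℝ, EuclideanSpace ℝ (Fin 3)) (𝓡 3) g z) ∧
        ∀ w : EuclideanSpace ℝ (Fin 3),
          omega s (g z) (mfderiv 𝓘(ℝ, EuclideanSpace ℝ (Fin 3)) (𝓡 3) g z w) =
            logDeriv (fun z => s (g z)) z w := by
  have : IsManifold (𝓡 3) 1 M := IsManifold.of_le (n := ∞) (by simp)
  set g := (extChartAt (𝓡 3) x).symm with hg
  have hgT : ContMDiffOn 𝓘(ℝ, EuclideanSpace ℝ (Fin 3)) (𝓡 3) ∞ g (extChartAt (𝓡 3) x).target :=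
    contMDiffOn_extChartAt_symm x
  have hO : IsOpen ((extChartAt (𝓡 3) x).target ∩ g ⁻¹' U) :=
    hgT.continuousOn.isOpen_inter_preimage (isOpen_extChartAt_target x) hU
  have hmaps : Set.MapsTo g ((extChartAt (𝓡 3) x).target ∩ g ⁻¹' U) U := fun z hz => hz.2
  have hgO := hgT.mono (Set.inter_subset_left (t := g ⁻¹' U))
  have hf := contDiffOn_comp hs hgO hmaps
  refine ⟨(extChartAt (𝓡 3) x).target ∩ g ⁻¹' U, g, extChartAt (𝓡 3) x x, hO,
    ⟨mem_extChartAt_target x, ?_⟩, extChartAt_to_inv x, hmaps, hgO, hf, fun z hz => ⟨?_, ?_⟩⟩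
  · change g (extChartAt (𝓡 3) x x) ∈ U
    rwa [hg, extChartAt_to_inv x]
  · have h := isInvertible_mfderivWithin_extChartAt_symm (I := 𝓡 3) (x := x) hz.1
    rw [ModelWithCorners.range_eq_univ, mfderivWithin_univ] at h
    obtain ⟨A, hA⟩ := h
    rw [hg, ← hA]
    exact A.bijective
  · exact fun w => omega_mfderiv hU hs hO hgO hmaps hz w

end

/-! ### The structure equation on the normal bundle -/

section

attribute [local instance] Matrix.linftyOpNormedRing Matrix.linftyOpNormedAlgebra

theorem projI_add (X Z : Mat8) : projI (X + Z) = projI X + projI Z := by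
  ext i j
  simp [projI, add_mul, Matrix.trace_add, add_div]

theorem projI_smul (c : ℝ) (X : Mat8) : projI (c • X) = c • projI X := by
  ext i j
  simp [projI, mul_div_assoc]

theorem negPart_add (Y Z : Matrix (Fin 3) (Fin 3) ℝ) :
    negPart (Y + Z) = negPart Y + negPart Z := by
  ext i
  fin_cases i <;> rfl

theorem negPart_smul (c : ℝ) (Y : Matrix (Fin 3) (Fin 3) ℝ) :
    negPart (c • Y) = c • negPart Y := by
  ext i
  fin_cases i <;> rfl

/-- The `g₋`-component of a matrix, as a linear map. -/
def negL : Mat8 →ₗ[ℝ] (Fin 3 → ℝ) where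
  toFun X := negPart (projI X)
  map_add' X Z := by rw [projI_add, negPart_add]
  map_smul' c X := by rw [projI_smul, negPart_smul, RingHom.id_apply]

/-- A coefficient of the `Γ₃₀`-component, as a linear form. -/
def coefRL (w : Fin 10) : Mat8 →ₗ[ℝ] ℝ where
  toFun X := coefR X w
  map_add' X Z := by simp [coefR_apply, add_mul, Matrix.trace_add, add_div]
  map_smul' c X := by simp [coefR_apply, mul_div_assoc]

variable {M : Type*} [TopologicalSpace M] [ChartedSpace (EuclideanSpace ℝ (Fin 3)) M]

/-- The vectors dual to the components of `ω₋` along the section `s`. -/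
def dualVec (s : M → Mat8) (i : Fin 3) (x : M) : TangentSpace (𝓡 3) x :=
  Function.invFun (omegaNeg s x) (Pi.single i 1)

/-- The values of the Maurer-Cartan form on the frame `dualVec`. -/
def frameOmega (s : M → Mat8) (i : Fin 3) (x : M) : Mat8 := omega s x (dualVec s i x)

theorem projI_frameOmega {s : M → Mat8} {x : M} (h : Function.Bijective (omegaNeg s x))
    (i : Fin 3) : negPart (projI (frameOmega s i x)) = Pi.single i 1 :=
  Function.invFun_eq (h.2 (Pi.single i 1))

variable [IsManifold (𝓡 3) ∞ M] {φ : M → ℤ → Submodule ℝ (Fin 8 → ℝ)} {P : M → Set Mat8}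
  {U : Set M} {s : M → Mat8} {x : M}

/-- `g₋`-valued version of `exists_chart_frame`: in a chart the frame `dualVec` is `dualField`. -/
theorem exists_chart_dualField (hP : IsNormalCartanBundle φ P) (hs : IsSection P U s)
    (hx : x ∈ U) :
    ∃ (O : Set (EuclideanSpace ℝ (Fin 3))) (g : EuclideanSpace ℝ (Fin 3) → M)
      (z₀ : EuclideanSpace ℝ (Fin 3)), IsOpen O ∧ z₀ ∈ O ∧ g z₀ = x ∧ Set.MapsTo g O U ∧
      ContMDiffOn 𝓘(ℝ, EuclideanSpace ℝ (Fin 3)) (𝓡 3) ∞ g O ∧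
      ContDiffOn ℝ ∞ (fun z => s (g z)) O ∧ (∀ z ∈ O, IsUnit (s (g z))) ∧
      ∃ N : Mat8 →L[ℝ] (Fin 3 → ℝ), (∀ X, N X = negPart (projI X)) ∧ ∀ z ∈ O,
        Function.Surjective (mfderiv 𝓘(ℝ, EuclideanSpace ℝ (Fin 3)) (𝓡 3) g z) ∧
        (∀ w : EuclideanSpace ℝ (Fin 3),
          omega s (g z) (mfderiv 𝓘(ℝ, EuclideanSpace ℝ (Fin 3)) (𝓡 3) g z w) =
            logDeriv (fun z => s (g z)) z w) ∧
        Function.Bijective (N.comp (logDeriv (fun z => s (g z)) z)) ∧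
        ∀ i, dualVec s i (g z) = mfderiv 𝓘(ℝ, EuclideanSpace ℝ (Fin 3)) (𝓡 3) g z
          (dualField (E := EuclideanSpace ℝ (Fin 3)) (fun z => s (g z)) N (Pi.single i 1) z) := by
  obtain ⟨O, g, z₀, hO, hz₀, hgz, hmaps, hg, hf, h⟩ := exists_chart_frame hs.1 hs.2.1 hx
  refine ⟨O, g, z₀, hO, hz₀, hgz, hmaps, hg, hf,
    fun z hz => isUnit_of_mem_groupL (hP.mem_groupL _ _ (hs.2.2 _ (hmaps hz))),
    LinearMap.toContinuousLinearMap negL, fun X => rfl, fun z hz => ?_⟩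
  obtain ⟨hb, hom⟩ := h z hz
  have hc := hP.coframe U s hs (g z) (hmaps hz)
  have hN : ∀ w : EuclideanSpace ℝ (Fin 3),
      ((LinearMap.toContinuousLinearMap negL).comp (logDeriv (fun z => s (g z)) z)) w =
      omegaNeg s (g z) (mfderiv 𝓘(ℝ, EuclideanSpace ℝ (Fin 3)) (𝓡 3) g z w) := fun w => by
    rw [omegaNeg, hom w]
    rfl
  have hNb : Function.Bijective ((LinearMap.toContinuousLinearMap negL).comp
      (logDeriv (fun z => s (g z)) z)) := by
    refine ⟨fun a b hab => hb.1 (hc.1 ?_), fun t => ?_⟩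
    · rw [← hN, ← hN, hab]
    · obtain ⟨v, hv⟩ := hc.2 t
      obtain ⟨w, rfl⟩ := hb.2 v
      exact ⟨w, (hN w).trans hv⟩
  refine ⟨hb.2, hom, hNb, fun i => hc.1 ?_⟩
  refine Eq.trans (Function.invFun_eq (hc.2 (Pi.single i 1))) ?_
  rw [← hN]
  exact (apply_dualField hNb _).symm

/-- Along a section of the bundle, `ω` has values in `o(V, κ)`. -/
theorem omega_skew (hP : IsNormalCartanBundle φ P) (hs : IsSection P U s) (hx : x ∈ U)
    (v : TangentSpace (𝓡 3) x) : (omega s x v)ᵀ * killing ℝ + killing ℝ * omega s x v = 0 := by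
  obtain ⟨O, g, z₀, hO, hz₀, rfl, hmaps, hg, hf, -, N, -, h⟩ := exists_chart_dualField hP hs hx
  obtain ⟨hb, hom, -⟩ := h z₀ hz₀
  obtain ⟨w, rfl⟩ := hb v
  rw [hom w]
  exact logDeriv_skew hO hf (fun z hz => hP.mem_groupL _ _ (hs.2.2 _ (hmaps hz))) hz₀ w

/-- Along a section of the bundle, `ω` is determined by its `sl(3)`-component and its coefficients
in `Γ₃₀` and `Γ₀₃`. -/
theorem omega_eq_ofCoords (hP : IsNormalCartanBundle φ P) (hs : IsSection P U s) (hx : x ∈ U)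
    (v : TangentSpace (𝓡 3) x) :
    omega s x v = ofCoords (projI (omega s x v)) (coefR (omega s x v)) (coefS (omega s x v)) :=
  eq_ofCoords_of_skew _ (omega_skew hP hs hx v)

/-- The structure equation of the normal bundle along a section, evaluated on the frame
`dualVec`. -/
theorem exists_section_structure_equation (hP : IsNormalCartanBundle φ P) (hs : IsSection P U s)
    (hx : x ∈ U) :
    ∃ (D : Fin 3 → Fin 3 → Mat8) (c : Fin 3 → Fin 3 → Fin 3 → ℝ),
      (∀ i j, D i j - D j i - ∑ k, c i j k • frameOmega s k x +
        ⁅frameOmega s i x, frameOmega s j x⁆ = 0) ∧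
      ∀ (ℓ : Mat8 →ₗ[ℝ] ℝ) (a : ℝ) (j : Fin 3), (∀ y ∈ U, ℓ (frameOmega s j y) = a) →
        ∀ i, ℓ (D i j) = 0 := by
  obtain ⟨O, g, z₀, hO, hz₀, rfl, hmaps, hg, hf, hu, N, -, h⟩ := exists_chart_dualField hP hs hx
  obtain ⟨D, c, h1, h2⟩ := exists_structure_equation hO hf hu (fun z hz => (h z hz).2.2.1) hz₀
    (Ω := fun i z => frameOmega s i (g z)) (fun i z hz => by
      rw [frameOmega, (h z hz).2.2.2 i]
      exact (h z hz).2.1 _)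
  refine ⟨D, c, h1, fun ℓ a j hℓ => h2 (LinearMap.toContinuousLinearMap ℓ) a j fun y hy =>
    hℓ _ (hmaps hy)⟩

/-- The `Γ₃₀`-component of the structure equation in coordinates; `D i j w` is the derivative
of the coefficient `w` of `χ^R(eⱼ)` in the direction dual to `eᵢ`. -/
theorem exists_coefR_equation (hP : IsNormalCartanBundle φ P) (hs : IsSection P U s)
    (hx : x ∈ U) {Y : Fin 3 → Matrix (Fin 3) (Fin 3) ℝ} {r t : Fin 3 → Fin 10 → ℝ}
    (hY : ∀ i, Y i = projI (frameOmega s i x)) (hr : ∀ i, r i = coefR (frameOmega s i x))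
    (ht : ∀ i, t i = coefS (frameOmega s i x)) :
    ∃ D : Fin 3 → Fin 3 → Fin 10 → ℝ,
      (∀ j w, (∀ y ∈ U, coefR (frameOmega s j y) w = 0) → ∀ i, D i j w = 0) ∧
      ∀ i j w, D i j w - D j i w - ∑ k, (negPart ⁅Y i, Y j⁆ + bracketRS (r i) (t j) -
        bracketRS (r j) (t i)) k * r k w +
        (actR (Y i) (r j) - actR (Y j) (r i) + bracketSS (t i) (t j)) w = 0 := by
  obtain ⟨D, c, h1, h2⟩ := exists_section_structure_equation hP hs hx
  have hΩ : ∀ i, frameOmega s i x = ofCoords (Y i) (r i) (t i) := fun i => by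
    rw [hY, hr, ht]
    exact omega_eq_ofCoords hP hs hx _
  have hc : ∀ i j k, c i j k = (negPart ⁅Y i, Y j⁆ + bracketRS (r i) (t j) -
      bracketRS (r j) (t i)) k := by
    intro i j k
    have hD : ∀ i j, negL (D i j) k = 0 := fun i j =>
      h2 ((LinearMap.proj k).comp negL) _ j (fun y hy =>
        congrFun (projI_frameOmega (hP.coframe U s hs y hy) j) k) i
    have h := congrFun (congrArg negL (h1 i j)) k
    have hN : ∀ l, negL (frameOmega s l x) = Pi.single l 1 :=
      projI_frameOmega (hP.coframe U s hs x hx)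
    simp only [map_add, map_sub, map_sum, map_smul, Pi.add_apply, Pi.sub_apply, hD, hN, map_zero,
      Pi.zero_apply, Finset.sum_apply, Pi.smul_apply, smul_eq_mul, sub_zero] at h
    rw [← negPart_projI_lie, ← hΩ, ← hΩ]
    change _ = negL _ k
    have hs : ∑ l, c i j l * (Pi.single l 1 : Fin 3 → ℝ) k = c i j k := by
      simp [Pi.single_apply]
    linarith
  refine ⟨fun i j w => coefR (D i j) w, fun j w h i => h2 (coefRL w) 0 j h i, fun i j w => ?_⟩
  have h := congrArg (coefRL w) (h1 i j)
  simp only [map_add, map_sub, map_sum, map_smul, map_zero, smul_eq_mul] at h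
  rw [hΩ i, hΩ j] at h
  simp only [hc] at h
  rw [← coefR_lie]
  simp only [hr] at h ⊢
  exact h

end

/-! ### Weights and the vanishing of coefficients -/

section

/-- The degrees of the weight vectors `vecR`; the degree of `vecS i` is the opposite. -/
def degR : Fin 10 → ℤ := ![3, 2, 1, 1, 0, -1, 0, -1, -2, -3]

/-- The weights of the vectors `vecR`; the weight of `vecS i` is the opposite. -/
def wtR : Fin 10 → Fin 2 → ℤ :=
  ![![2, 1], ![1, 1], ![1, 0], ![0, 1], ![0, 0], ![0, -1], ![-1, 1], ![-1, 0], ![-1, -1],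
    ![-1, -2]]

/-- The weights of the basis of `g₋^*` dual to `e₀, e₁, e₂`. -/
def wtNeg : Fin 3 → Fin 2 → ℤ := ![![1, 1], ![1, 0], ![0, 1]]

/-- The degree of the component of `χ^R(eᵢ)` along `vecR w`. -/
def totDegR (i : Fin 3) (w : Fin 10) : ℤ := wtNeg i 0 + wtNeg i 1 + degR w

/-- The degree of the component of `χ^S(eᵢ)` along `vecS w`. -/
def totDegS (i : Fin 3) (w : Fin 10) : ℤ := wtNeg i 0 + wtNeg i 1 - degR w

/-- The component of `χ^R(eᵢ)` along `vecR w` has degree at most `e`, or degree at most `d` and a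
weight with second coordinate at most one. -/
def LowR (d e : ℤ) (i : Fin 3) (w : Fin 10) : Prop :=
  totDegR i w ≤ e ∨ (totDegR i w ≤ d ∧ wtNeg i 1 + wtR w 1 ≤ 1)

/-- The component of `χ^S(eᵢ)` along `vecS w` has degree at most zero, or degree at most `d` and a
weight with first coordinate at most one. -/
def LowS (d : ℤ) (i : Fin 3) (w : Fin 10) : Prop :=
  totDegS i w ≤ 0 ∨ (totDegS i w ≤ d ∧ wtNeg i 0 - wtR w 0 ≤ 1)

instance (d e : ℤ) (i : Fin 3) (w : Fin 10) : Decidable (LowR d e i w) :=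
  inferInstanceAs (Decidable (_ ∨ _))

instance (d : ℤ) (i : Fin 3) (w : Fin 10) : Decidable (LowS d i w) :=
  inferInstanceAs (Decidable (_ ∨ _))

/-- The weight vector `vecR w` raises the degree by `degR w`. -/
theorem coefR_eq_zero {p : ℤ} {X : Mat8} (hX : X ∈ filGl p) {w : Fin 10} (hw : degR w < p) :
    coefR X w = 0 := by
  have h : ∀ i j, degV i - degV j = degR w → X i j = 0 := fun i j e => hX i j (e ▸ hw)
  clear hw
  fin_cases w <;>
    simp (disch := decide) only [Fin.reduceFinMk, Fin.zero_eta, Fin.mk_one, coefR,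
      Matrix.cons_val, h] <;> norm_num

/-- The weight vector `vecS w` raises the degree by `-degR w`. -/
theorem coefS_eq_zero {p : ℤ} {X : Mat8} (hX : X ∈ filGl p) {w : Fin 10} (hw : -degR w < p) :
    coefS X w = 0 := by
  have h : ∀ i j, degV i - degV j = -degR w → X i j = 0 := fun i j e => hX i j (e ▸ hw)
  clear hw
  fin_cases w <;>
    simp (disch := decide) only [Fin.reduceFinMk, Fin.zero_eta, Fin.mk_one, coefS,
      Matrix.cons_val, h] <;> norm_num

theorem ofCoords_sub_ad (Y : Matrix (Fin 3) (Fin 3) ℝ) (r s : Fin 10 → ℝ) :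
    ofCoords Y r s - ad Y = ofCoords 0 r s := by
  rw [ad_eq_ofCoords]
  ext i j
  fin_cases i <;> fin_cases j <;>
    simp only [Fin.reduceFinMk, Fin.zero_eta, Fin.mk_one, ofCoords, Matrix.of_apply,
      Matrix.cons_val, Matrix.sub_apply, Pi.zero_apply, Matrix.zero_apply] <;> ring

variable {M : Type*} [TopologicalSpace M] [ChartedSpace (EuclideanSpace ℝ (Fin 3)) M]
  {φ : M → ℤ → Submodule ℝ (Fin 8 → ℝ)} {P : M → Set Mat8} {U : Set M} {s : M → Mat8} {x : M}

theorem isHomogeneousNeg_single (i : Fin 3) :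
    IsHomogeneousNeg (-(wtNeg i 0 + wtNeg i 1)) (Pi.single i 1) := by
  fin_cases i <;> simp [IsHomogeneousNeg, wtNeg]

theorem chi_single_mem (hP : IsNormalCartanBundle φ P) (hs : IsSection P U s) (hx : x ∈ U)
    (i : Fin 3) : chi s x (Pi.single i 1) ∈ filGl (-(wtNeg i 0 + wtNeg i 1) + 1) :=
  hP.positive U s hs x hx _ _ (isHomogeneousNeg_single i)

variable [IsManifold (𝓡 3) ∞ M]

theorem projII_omega (hP : IsNormalCartanBundle φ P) (hs : IsSection P U s)
    (hx : x ∈ U) (v : TangentSpace (𝓡 3) x) :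
    projII (omega s x v) = ofCoords 0 (coefR (omega s x v)) (coefS (omega s x v)) := by
  rw [projII]
  conv_lhs => enter [1]; rw [omega_eq_ofCoords hP hs hx]
  rw [ofCoords_sub_ad]

/-- The coefficients of `χ^R(eᵢ)` that satisfy `LowR d e` vanish along all sections. -/
def VanishR (d e : ℤ) (P : M → Set Mat8) : Prop :=
  ∀ U s, IsSection P U s → ∀ x ∈ U, ∀ i w, LowR d e i w → coefR (frameOmega s i x) w = 0

/-- The coefficients of `χ^S(eᵢ)` that satisfy `LowS d` vanish along all sections. -/
def VanishS (d : ℤ) (P : M → Set Mat8) : Prop :=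
  ∀ U s, IsSection P U s → ∀ x ∈ U, ∀ i w, LowS d i w → coefS (frameOmega s i x) w = 0

theorem chi_single_eq (hP : IsNormalCartanBundle φ P) (hs : IsSection P U s) (hx : x ∈ U)
    (i : Fin 3) : chi s x (Pi.single i 1) =
      ofCoords 0 (coefR (frameOmega s i x)) (coefS (frameOmega s i x)) :=
  projII_omega hP hs hx _

/-- The components of `χ^R` of degree at most zero vanish by the positivity of `χ`. -/
theorem vanishR_nonpos (hP : IsNormalCartanBundle φ P) : VanishR 0 0 P := by
  intro U s hs x hx i w h
  have h0 : totDegR i w ≤ 0 := h.elim id fun h => h.1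
  have h2 := coefR_eq_zero (chi_single_mem hP hs hx i) (w := w)
    (by unfold totDegR at h0; linarith)
  rwa [chi_single_eq hP hs hx, coefR_ofCoords] at h2

theorem vanishS_nonpos (hP : IsNormalCartanBundle φ P) : VanishS 0 P := by
  intro U s hs x hx i w h
  have h0 : totDegS i w ≤ 0 := h.elim id fun h => h.1
  have h2 := coefS_eq_zero (chi_single_mem hP hs hx i) (w := w)
    (by unfold totDegS at h0; linarith)
  rwa [chi_single_eq hP hs hx, coefS_ofCoords] at h2

/-- The `Γ₃₀`-component of the normalisation `∂* χ = 0`. -/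
theorem codiff_coefR (hP : IsNormalCartanBundle φ P) (hs : IsSection P U s) (hx : x ∈ U)
    (w : Fin 10) :
    actR (E ℝ 0 2) (coefR (frameOmega s 0 x)) w + actR (E ℝ 0 1) (coefR (frameOmega s 1 x)) w +
      actR (E ℝ 1 2) (coefR (frameOmega s 2 x)) w = 0 := by
  have h := congrArg (coefRL w) (hP.normal U s hs x hx)
  simp only [codiff, map_add, chi_single_eq hP hs hx, ad_eq_ofCoords, map_zero] at h
  have h0 : ∀ (Y : Matrix (Fin 3) (Fin 3) ℝ) (r t : Fin 10 → ℝ),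
      coefRL w ⁅ofCoords Y 0 0, ofCoords 0 r t⁆ = actR Y r w := by
    intro Y r t
    change coefR _ w = _
    rw [coefR_lie]
    have h1 : actR 0 0 = 0 := by
      funext i
      fin_cases i <;> simp [actR]
    have h2 : bracketSS 0 t = 0 := by
      funext i
      fin_cases i <;> simp [bracketSS]
    simp [h1, h2]
  simpa only [h0] using h

/-- The equations satisfied by the coefficients of `χ^R` and `χ^S` at a point of a section, for
use in the elimination of the coefficients degree by degree. -/
theorem exists_coefficients {d e d' : ℤ} (hP : IsNormalCartanBundle φ P) (hR : VanishR d e P)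
    (hS : VanishS d' P) (hs : IsSection P U s) (hx : x ∈ U) :
    ∃ (Y : Fin 3 → Matrix (Fin 3) (Fin 3) ℝ) (r t : Fin 3 → Fin 10 → ℝ)
      (D : Fin 3 → Fin 3 → Fin 10 → ℝ),
      (∀ i, coefR (frameOmega s i x) = r i) ∧
      (∀ i w, LowR d e i w → r i w = 0) ∧ (∀ i w, LowS d' i w → t i w = 0) ∧
      (∀ j w, LowR d e j w → ∀ i, D i j w = 0) ∧
      (∀ i, Y i 2 0 = (![1, 0, 0] : Fin 3 → ℝ) i) ∧ (∀ i, Y i 1 0 = (![0, 1, 0] : Fin 3 → ℝ) i) ∧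
      (∀ i, Y i 2 1 = (![0, 0, 1] : Fin 3 → ℝ) i) ∧
      (∀ w, actR (E ℝ 0 2) (r 0) w + actR (E ℝ 0 1) (r 1) w + actR (E ℝ 1 2) (r 2) w = 0) ∧
      ∀ i j w, D i j w - D j i w - ∑ k, (negPart ⁅Y i, Y j⁆ + bracketRS (r i) (t j) -
        bracketRS (r j) (t i)) k * r k w +
        (actR (Y i) (r j) - actR (Y j) (r i) + bracketSS (t i) (t j)) w = 0 := by
  obtain ⟨D, h1, h2⟩ := exists_coefR_equation hP hs hx (fun _ => rfl) (fun _ => rfl) (fun _ => rfl)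
  have h := projI_frameOmega (hP.coframe U s hs x hx)
  refine ⟨_, _, _, D, fun _ => rfl, hR U s hs x hx, hS U s hs x hx,
    fun j w hl => h1 j w fun y hy => hR U s hs y hy j w hl,
    fun i => (congrFun (h i) 0).trans ?_, fun i => (congrFun (h i) 1).trans ?_,
    fun i => (congrFun (h i) 2).trans ?_, codiff_coefR hP hs hx, h2⟩ <;>
  fin_cases i <;> simp

/-! ### Elimination of the coefficients degree by degree -/

/-- Degree one. The quadratic terms of the structure equations vanish for reasons of weight, so that
the structure equations and the normalisation are linear equations for the unknown coefficients. The
same holds in the higher degrees. -/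
theorem vanishR_degree_one (hP : IsNormalCartanBundle φ P) (hR : VanishR 0 0 P) (hS : VanishS 0 P) :
    VanishR 1 0 P := by
  intro U s hs x hx i w hl
  obtain ⟨Y, r, t, D, hr, zr, zt, zD, y1, y2, y3, hc, he⟩ := exists_coefficients hP hR hS hs hx
  have e125 := he 1 2 5
  have e127 := he 1 2 7
  have e028 := he 0 2 8
  have c2 := hc 2
  have c3 := hc 3
  simp (disch := decide) only [Fin.sum_univ_three, actR, bracketSS, bracketRS, negPart,
      Ring.lie_def,
    Pi.add_apply, Pi.sub_apply, Matrix.sub_apply, Matrix.mul_apply, Matrix.cons_val, zr, zt, zD, y1,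
    y2, y3, mul_zero, zero_mul, sub_zero, zero_sub, add_zero, zero_add, mul_one, one_mul, zero_div]
    at e125 e127 e028
  simp [actR, E] at c2 c3
  have r05 : r 0 5 = 0 := by linarith
  have r07 : r 0 7 = 0 := by linarith
  have r14 : r 1 4 = 0 := by linarith
  have r16 : r 1 6 = 0 := by linarith
  have r24 : r 2 4 = 0 := by linarith
  rw [hr]
  fin_cases i <;> fin_cases w <;>
    first | exact zr _ _ (by decide) | assumption | exact absurd hl (by decide)

/-- The coefficients of degree two and weight with second coordinate at most one. -/
theorem vanishR_degree_two (hP : IsNormalCartanBundle φ P) (hR : VanishR 1 0 P) (hS : VanishS 1 P) :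
    VanishR 2 0 P := by
  intro U s hs x hx i w hl
  obtain ⟨Y, r, t, D, hr, zr, zt, zD, y1, y2, y3, hc, he⟩ := exists_coefficients hP hR hS hs hx
  have e124 := he 1 2 4
  have e015 := he 0 1 5
  have e017 := he 0 1 7
  have e025 := he 0 2 5
  have c1 := hc 1
  simp (disch := decide) only [Fin.sum_univ_three, actR, bracketSS, bracketRS, negPart,
      Ring.lie_def,
    Pi.add_apply, Pi.sub_apply, Matrix.sub_apply, Matrix.mul_apply, Matrix.cons_val, zr, zt, zD, y1,
    y2, y3, mul_zero, zero_mul, sub_zero, zero_sub, add_zero, zero_add, mul_one, one_mul, zero_div]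
    at e124 e015 e017 e025
  simp [actR, E] at c1
  have r04 : r 0 4 = 0 := by linarith
  have r12 : r 1 2 = 0 := by linarith
  have r13 : r 1 3 = 0 := by linarith
  have r22 : r 2 2 = 0 := by linarith
  rw [hr]
  fin_cases i <;> fin_cases w <;>
    first | exact zr _ _ (by decide) | assumption | exact absurd hl (by decide)

/-- The coefficients of degree three and weight with second coordinate at most one. -/
theorem vanishR_degree_three (hP : IsNormalCartanBundle φ P) (hR : VanishR 2 0 P)
    (hS : VanishS 2 P) :
    VanishR 3 0 P := by
  intro U s hs x hx i w hl
  obtain ⟨Y, r, t, D, hr, zr, zt, zD, y1, y2, y3, hc, he⟩ := exists_coefficients hP hR hS hs hx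
  have e122 := he 1 2 2
  have c0 := hc 0
  simp (disch := decide) only [Fin.sum_univ_three, actR, bracketSS, bracketRS, negPart,
      Ring.lie_def,
    Pi.add_apply, Pi.sub_apply, Matrix.sub_apply, Matrix.mul_apply, Matrix.cons_val, zr, zt, zD, y1,
    y2, y3, mul_zero, zero_mul, sub_zero, zero_sub, add_zero, zero_add, mul_one, one_mul, zero_div]
    at e122
  simp [actR, E] at c0
  have r02 : r 0 2 = 0 := by linarith
  have r11 : r 1 1 = 0 := by linarith
  rw [hr]
  fin_cases i <;> fin_cases w <;>
    first | exact zr _ _ (by decide) | assumption | exact absurd hl (by decide)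

/-- The coefficients of degree four and weight with second coordinate at most one. -/
theorem vanishR_degree_four (hP : IsNormalCartanBundle φ P) (hR : VanishR 3 0 P)
    (hS : VanishS 3 P) :
    VanishR 4 0 P := by
  intro U s hs x hx i w hl
  obtain ⟨Y, r, t, D, hr, zr, zt, zD, y1, y2, y3, hc, he⟩ := exists_coefficients hP hR hS hs hx
  have e012 := he 0 1 2
  simp (disch := decide) only [Fin.sum_univ_three, actR, bracketSS, bracketRS, negPart,
      Ring.lie_def,
    Pi.add_apply, Pi.sub_apply, Matrix.sub_apply, Matrix.mul_apply, Matrix.cons_val, zr, zt, zD, y1,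
    y2, y3, mul_zero, zero_mul, sub_zero, add_zero, zero_add, mul_one, one_mul, zero_div]
    at e012
  have r10 : r 1 0 = 0 := by linarith
  rw [hr]
  fin_cases i <;> fin_cases w <;>
    first | exact zr _ _ (by decide) | assumption | exact absurd hl (by decide)

/-- The remaining coefficients of degree two, if the coefficient of `e₂^* ⊗ R_{-1,1}`, the only one
of degree one left by `vanishR_degree_one`, vanishes as well. -/
theorem vanishR_full_degree_two (hP : IsNormalCartanBundle φ P) (hR : VanishR 4 1 P)
    (hS : VanishS 4 P) :
    VanishR 4 2 P := by
  intro U s hs x hx i w hl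
  obtain ⟨Y, r, t, D, hr, zr, zt, zD, y1, y2, y3, hc, he⟩ := exists_coefficients hP hR hS hs hx
  have e126 := he 1 2 6
  have e027 := he 0 2 7
  simp (disch := decide) only [Fin.sum_univ_three, actR, bracketSS, bracketRS, negPart,
      Ring.lie_def,
    Pi.add_apply, Pi.sub_apply, Matrix.sub_apply, Matrix.mul_apply, Matrix.cons_val, zr, zt, zD, y1,
    y2, y3, mul_zero, zero_mul, sub_zero, zero_sub, add_zero, zero_add, mul_one, one_mul, zero_div]
    at e126 e027
  have r06 : r 0 6 = 0 := by linarith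
  have r23 : r 2 3 = 0 := by linarith
  rw [hr]
  fin_cases i <;> fin_cases w <;>
    first | exact zr _ _ (by decide) | assumption | exact absurd hl (by decide)

/-- The remaining coefficients of degree three. -/
theorem vanishR_full_degree_three (hP : IsNormalCartanBundle φ P) (hR : VanishR 4 2 P)
    (hS : VanishS 4 P) :
    VanishR 4 3 P := by
  intro U s hs x hx i w hl
  obtain ⟨Y, r, t, D, hr, zr, zt, zD, y1, y2, y3, hc, he⟩ := exists_coefficients hP hR hS hs hx
  have e123 := he 1 2 3
  have e024 := he 0 2 4
  simp (disch := decide) only [Fin.sum_univ_three, actR, bracketSS, bracketRS, negPart,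
      Ring.lie_def,
    Pi.add_apply, Pi.sub_apply, Matrix.sub_apply, Matrix.mul_apply, Matrix.cons_val, zr, zt, zD, y1,
    y2, y3, mul_zero, zero_mul, sub_zero, zero_sub, add_zero, zero_add, mul_one, one_mul, zero_div]
    at e123 e024
  have r03 : r 0 3 = 0 := by linarith
  have r21 : r 2 1 = 0 := by linarith
  rw [hr]
  fin_cases i <;> fin_cases w <;>
    first | exact zr _ _ (by decide) | assumption | exact absurd hl (by decide)

/-- The remaining coefficients of degree four. -/
theorem vanishR_full_degree_four (hP : IsNormalCartanBundle φ P) (hR : VanishR 4 3 P)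
    (hS : VanishS 4 P) :
    VanishR 4 4 P := by
  intro U s hs x hx i w hl
  obtain ⟨Y, r, t, D, hr, zr, zt, zD, y1, y2, y3, hc, he⟩ := exists_coefficients hP hR hS hs hx
  have e121 := he 1 2 1
  have e022 := he 0 2 2
  simp (disch := decide) only [Fin.sum_univ_three, actR, bracketSS, bracketRS, negPart,
      Ring.lie_def,
    Pi.add_apply, Pi.sub_apply, Matrix.sub_apply, Matrix.mul_apply, Matrix.cons_val, zr, zt, zD, y1,
    y2, y3, mul_zero, zero_mul, sub_zero, zero_sub, add_zero, zero_add, mul_one, one_mul, zero_div]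
    at e121 e022
  have r01 : r 0 1 = 0 := by linarith
  have r20 : r 2 0 = 0 := by linarith
  rw [hr]
  fin_cases i <;> fin_cases w <;>
    first | exact zr _ _ (by decide) | assumption | exact absurd hl (by decide)

/-- The remaining coefficient, that of `e₀^* ⊗ R_{2,1}`, has degree five. -/
theorem vanishR_full_degree_five (hP : IsNormalCartanBundle φ P) (hR : VanishR 4 4 P)
    (hS : VanishS 4 P) :
    VanishR 4 5 P := by
  intro U s hs x hx i w hl
  obtain ⟨Y, r, t, D, hr, zr, zt, zD, y1, y2, y3, hc, he⟩ := exists_coefficients hP hR hS hs hx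
  have e120 := he 1 2 0
  simp (disch := decide) only [Fin.sum_univ_three, actR, bracketSS, bracketRS, negPart,
      Ring.lie_def,
    Pi.add_apply, Pi.sub_apply, Matrix.sub_apply, Matrix.mul_apply, Matrix.cons_val, zr, zt, zD, y1,
    y2, y3, mul_zero, zero_mul, sub_zero, zero_sub, add_zero, zero_add, mul_one, one_mul, zero_div]
    at e120
  have r00 : r 0 0 = 0 := by linarith
  rw [hr]
  fin_cases i <;> fin_cases w <;>
    first | exact zr _ _ (by decide) | assumption

end

/-! ### The outer automorphism of sl(3) -/

section

/-- The outer automorphism of `sl(3)` preserving the grading: minus the transposition along the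
antidiagonal. It exchanges `e₁` and `e₂`. -/
def outer (Y : Matrix (Fin 3) (Fin 3) ℝ) : Matrix (Fin 3) (Fin 3) ℝ :=
  -Yᵀ.submatrix Fin.revPerm Fin.revPerm

/-- The action of `outer` on the coordinates of `g₋`. -/
def outerNeg (u : Fin 3 → ℝ) : Fin 3 → ℝ := ![-u 0, -u 2, -u 1]

/-- The permutation underlying `flip`. -/
def swapIdx : Fin 8 → Fin 8 := ![0, 2, 1, 4, 3, 6, 5, 7]

/-- The signs of the entries of `flip`. -/
def swapSign : Fin 8 → ℝ := ![-1, -1, -1, 1, 1, -1, -1, -1]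

/-- The matrix of `outer` in the basis `basisA`: an involution in `O(V, κ)` that exchanges `Γ₃₀`
and `Γ₀₃`. -/
def flip : Mat8 := Matrix.of fun p q => if swapIdx p = q then swapSign p else 0

theorem swapIdx_swapIdx (p : Fin 8) : swapIdx (swapIdx p) = p := by
  fin_cases p <;> rfl

theorem swapSign_swapIdx (p : Fin 8) : swapSign (swapIdx p) = swapSign p := by
  fin_cases p <;> rfl

theorem swapSign_mul_self (p : Fin 8) : swapSign p * swapSign p = 1 := by
  fin_cases p <;> simp [swapSign]

theorem degV_swapIdx (p : Fin 8) : degV (swapIdx p) = degV p := by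
  fin_cases p <;> rfl

theorem flip_mul_apply (X : Mat8) (p q : Fin 8) :
    (flip * X) p q = swapSign p * X (swapIdx p) q := by
  simp [flip, Matrix.mul_apply]

theorem mul_flip_apply (X : Mat8) (p q : Fin 8) :
    (X * flip) p q = X p (swapIdx q) * swapSign q := by
  rw [Matrix.mul_apply, Finset.sum_eq_single (swapIdx q)]
  · simp [flip, swapIdx_swapIdx, swapSign_swapIdx]
  · intro k _ hk
    have : swapIdx k ≠ q := fun h => hk (by rw [← h, swapIdx_swapIdx])
    simp [flip, this]
  · simp

theorem flip_mulVec (v : Fin 8 → ℝ) (p : Fin 8) :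
    (flip *ᵥ v) p = swapSign p * v (swapIdx p) := by
  simp [flip, Matrix.mulVec, dotProduct]

theorem flip_conj_apply (X : Mat8) (p q : Fin 8) :
    (flip * X * flip) p q = swapSign p * X (swapIdx p) (swapIdx q) * swapSign q := by
  rw [mul_flip_apply, flip_mul_apply]

theorem flip_mul_flip : flip * flip = 1 := by
  ext p q
  rw [flip_mul_apply, flip, Matrix.of_apply, swapIdx_swapIdx, Matrix.one_apply]
  split_ifs
  · rw [swapSign_swapIdx, swapSign_mul_self]
  · simp

theorem flip_conj_mul (X Z : Mat8) :
    (flip * X * flip) * (flip * Z * flip) = flip * (X * Z) * flip := by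
  calc _ = flip * X * (flip * flip) * Z * flip := by simp only [Matrix.mul_assoc]
    _ = _ := by simp only [flip_mul_flip, Matrix.mul_assoc, Matrix.one_mul]

theorem flip_conj_lie (X Z : Mat8) :
    ⁅flip * X * flip, flip * Z * flip⁆ = flip * ⁅X, Z⁆ * flip := by
  simp only [Ring.lie_def, flip_conj_mul, mul_sub, sub_mul]

theorem flip_mem_groupL : flip ∈ groupL := by
  have ht : flipᵀ = flip := by
    ext p q
    fin_cases p <;> fin_cases q <;> simp [flip, swapIdx, swapSign]
  change flipᵀ * killing ℝ * flip = killing ℝ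
  rw [ht, killing_real]
  ext p q
  rw [flip_conj_apply]
  fin_cases p <;> fin_cases q <;> simp [swapIdx, swapSign]

theorem mul_flip_mem_groupL {a : Mat8} (h : a ∈ groupL) : a * flip ∈ groupL := by
  change (a * flip)ᵀ * killing ℝ * (a * flip) = killing ℝ
  have h1 : aᵀ * killing ℝ * a = killing ℝ := h
  have h2 : flipᵀ * killing ℝ * flip = killing ℝ := flip_mem_groupL
  calc _ = flipᵀ * (aᵀ * killing ℝ * a) * flip := by
        simp only [Matrix.transpose_mul, Matrix.mul_assoc]
    _ = _ := by rw [h1, h2]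

theorem map_flip_filV (q : ℤ) : (filV q).map flip.mulVecLin = filV q := by
  have h1 : ∀ v ∈ filV q, flip *ᵥ v ∈ filV q := fun v hv i hi => by
    rw [flip_mulVec, hv _ (by rwa [degV_swapIdx]), mul_zero]
  apply le_antisymm
  · rintro _ ⟨v, hv, rfl⟩
    exact h1 v hv
  · intro v hv
    exact ⟨flip *ᵥ v, h1 v hv, by simp [flip_mul_flip]⟩

theorem flip_conj_mem_filGl {p : ℤ} {X : Mat8} (h : X ∈ filGl p) : flip * X * flip ∈ filGl p := by
  intro i j hij
  rw [flip_conj_apply, h _ _ (by rwa [degV_swapIdx, degV_swapIdx]), mul_zero, zero_mul]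

theorem ad_outer (Y : Matrix (Fin 3) (Fin 3) ℝ) : ad (outer Y) = flip * ad Y * flip := by
  rw [ad_eq_ofCoords, ad_eq_ofCoords]
  ext p q
  rw [flip_conj_apply]
  have hY : ∀ i j, outer Y i j = -Y (Fin.rev j) (Fin.rev i) := fun i j => rfl
  have r0 : Fin.rev (0 : Fin 3) = 2 := rfl
  have r1 : Fin.rev (1 : Fin 3) = 1 := rfl
  have r2 : Fin.rev (2 : Fin 3) = 0 := rfl
  fin_cases p <;> fin_cases q <;>
    simp only [Fin.reduceFinMk, Fin.zero_eta, Fin.mk_one, ofCoords, swapIdx, swapSign,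
      Matrix.of_apply, Matrix.cons_val, Pi.zero_apply, hY, r0, r1, r2] <;>
    ring

theorem projI_flip_conj (X : Mat8) : projI (flip * X * flip) = outer (projI X) := by
  rw [projI_eq, projI_eq]
  have hY : ∀ (Y : Matrix (Fin 3) (Fin 3) ℝ) i j, outer Y i j = -Y (Fin.rev j) (Fin.rev i) :=
    fun Y i j => rfl
  have r0 : Fin.rev (0 : Fin 3) = 2 := rfl
  have r1 : Fin.rev (1 : Fin 3) = 1 := rfl
  have r2 : Fin.rev (2 : Fin 3) = 0 := rfl
  ext i j
  fin_cases i <;> fin_cases j <;>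
    simp only [Fin.reduceFinMk, Fin.zero_eta, Fin.mk_one, flip_conj_apply, swapIdx, swapSign,
      Matrix.of_apply, Matrix.cons_val, hY, r0, r1, r2] <;>
    ring

theorem negPart_outer (Y : Matrix (Fin 3) (Fin 3) ℝ) : negPart (outer Y) = outerNeg (negPart Y) :=
  rfl

theorem projII_flip_conj (X : Mat8) : projII (flip * X * flip) = flip * projII X * flip := by
  rw [projII, projII, projI_flip_conj, ad_outer, mul_sub, sub_mul]

/-- The permutation of the weight vectors induced by the conjugation with `flip`. -/
def swapWt : Fin 10 → Fin 10 := ![9, 8, 5, 7, 4, 2, 6, 3, 1, 0]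

/-- The signs with which the conjugation with `flip` permutes the weight vectors. -/
def signWt : Fin 10 → ℝ := ![1, -1, 1, 1, -1, 1, -1, 1, -1, 1]

theorem coefR_flip_conj (X : Mat8) (w : Fin 10) :
    coefR (flip * X * flip) w = signWt w * coefS X (swapWt w) := by
  fin_cases w <;>
    simp only [Fin.reduceFinMk, Fin.zero_eta, Fin.mk_one, coefR, coefS, flip_conj_apply, swapIdx,
      swapSign, swapWt, signWt, Matrix.cons_val] <;>
    ring

theorem outerNeg_outerNeg (u : Fin 3 → ℝ) : outerNeg (outerNeg u) = u := by
  funext i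
  fin_cases i <;> simp [outerNeg]

theorem outer_mul_mul (A B C : Matrix (Fin 3) (Fin 3) ℝ) :
    outer (A * B * C) = outer C * outer B * outer A := by
  simp only [outer, Matrix.transpose_mul, neg_mul, mul_neg, neg_neg, neg_inj]
  rw [← Matrix.submatrix_mul_equiv (e₂ := Fin.revPerm), ← Matrix.submatrix_mul_equiv (e₂ :=
      Fin.revPerm),
    Matrix.mul_assoc]

/-- The outer automorphism of `SL(3, ℝ)` with differential `outer`. -/
def outerSL (h : Matrix.SpecialLinearGroup (Fin 3) ℝ) : Matrix.SpecialLinearGroup (Fin 3) ℝ :=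
  ⟨-outer (h⁻¹ : Matrix.SpecialLinearGroup (Fin 3) ℝ), by
    rw [outer, neg_neg, Matrix.det_submatrix_equiv_self, Matrix.det_transpose]
    exact (h⁻¹).2⟩

theorem outerSL_inv (h : Matrix.SpecialLinearGroup (Fin 3) ℝ) :
    (((outerSL h)⁻¹ : Matrix.SpecialLinearGroup (Fin 3) ℝ) : Matrix (Fin 3) (Fin 3) ℝ) =
      -outer h := by
  have h1 : outerSL h * outerSL h⁻¹ = 1 := by
    apply Subtype.ext
    change -outer _ * -outer _ = (1 : Matrix (Fin 3) (Fin 3) ℝ)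
    rw [inv_inv, outer, outer, neg_neg, neg_neg, Matrix.submatrix_mul_equiv,
      ← Matrix.transpose_mul, ← Matrix.SpecialLinearGroup.coe_mul]
    simp
  rw [inv_eq_of_mul_eq_one_right h1]
  change -outer _ = _
  rw [inv_inv]

theorem coord_outer (Y : Matrix (Fin 3) (Fin 3) ℝ) (i : Fin 8) :
    coord (outer Y) i = swapSign i * coord Y (swapIdx i) := by
  have hY : ∀ i j, outer Y i j = -Y (Fin.rev j) (Fin.rev i) := fun i j => rfl
  have r0 : Fin.rev (0 : Fin 3) = 2 := rfl
  have r1 : Fin.rev (1 : Fin 3) = 1 := rfl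
  have r2 : Fin.rev (2 : Fin 3) = 0 := rfl
  fin_cases i <;> simp [coord, swapSign, swapIdx, hY, r0, r1, r2]

theorem outer_basisA (j : Fin 8) : outer (basisA ℝ j) = swapSign j • basisA ℝ (swapIdx j) := by
  have hY : ∀ (Y : Matrix (Fin 3) (Fin 3) ℝ) i j, outer Y i j = -Y (Fin.rev j) (Fin.rev i) :=
    fun Y i j => rfl
  have r0 : Fin.rev (0 : Fin 3) = 2 := rfl
  have r1 : Fin.rev (1 : Fin 3) = 1 := rfl
  have r2 : Fin.rev (2 : Fin 3) = 0 := rfl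
  ext p q
  rw [hY]
  fin_cases j <;> fin_cases p <;> fin_cases q <;>
    simp [basisA, swapSign, swapIdx, E, r0, r1, r2]

theorem coord_smul (c : ℝ) (Y : Matrix (Fin 3) (Fin 3) ℝ) (i : Fin 8) :
    coord (c • Y) i = c * coord Y i := by
  fin_cases i <;> simp [coord]

theorem Ad_outerSL (h : Matrix.SpecialLinearGroup (Fin 3) ℝ) :
    Ad (outerSL h) = flip * Ad h * flip := by
  ext i j
  rw [flip_conj_apply]
  simp only [Ad, Matrix.of_apply]
  have h1 : ((outerSL h : Matrix.SpecialLinearGroup (Fin 3) ℝ) : Matrix (Fin 3) (Fin 3) ℝ) =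
    -outer (h⁻¹ : Matrix.SpecialLinearGroup (Fin 3) ℝ) := rfl
  have h2 : basisA ℝ j = swapSign j • outer (basisA ℝ (swapIdx j)) := by
    rw [outer_basisA, swapIdx_swapIdx, swapSign_swapIdx, smul_smul, swapSign_mul_self, one_smul]
  rw [outerSL_inv, h1, h2, mul_smul_comm, smul_mul_assoc, coord_smul, neg_mul, neg_mul_neg,
    ← outer_mul_mul, coord_outer]
  ring

/-- The inverse of an upper triangular matrix of SL(3) is upper triangular. -/
theorem blockTriangular_coe_inv {h : Matrix.SpecialLinearGroup (Fin 3) ℝ}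
    (hb : (h : Matrix (Fin 3) (Fin 3) ℝ).BlockTriangular id) :
    ((h⁻¹ : Matrix.SpecialLinearGroup (Fin 3) ℝ) :
      Matrix (Fin 3) (Fin 3) ℝ).BlockTriangular id := by
  have h1 : (h : Matrix (Fin 3) (Fin 3) ℝ) *
      ((h⁻¹ : Matrix.SpecialLinearGroup (Fin 3) ℝ) : Matrix (Fin 3) (Fin 3) ℝ) = 1 := by
    rw [← Matrix.SpecialLinearGroup.coe_mul, mul_inv_cancel, Matrix.SpecialLinearGroup.coe_one]
  let := invertibleOfRightInverse _ _ h1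
  rw [← Matrix.inv_eq_right_inv h1]
  exact Matrix.blockTriangular_inv_of_blockTriangular hb

theorem flip_conj_mem_groupG0 {g : Mat8} (hg : g ∈ groupG0) : flip * g * flip ∈ groupG0 := by
  obtain ⟨h, hb, rfl⟩ := hg
  refine ⟨outerSL h, fun i j hij => ?_, (Ad_outerSL h).symm⟩
  have h1 : ((h⁻¹ : Matrix.SpecialLinearGroup (Fin 3) ℝ) : Matrix (Fin 3) (Fin 3) ℝ).BlockTriangular
      id := blockTriangular_coe_inv hb
  change - -((h⁻¹ : Matrix.SpecialLinearGroup (Fin 3) ℝ) : Matrix (Fin 3) (Fin 3) ℝ)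
    (Fin.rev j) (Fin.rev i) = 0
  rw [neg_neg]
  exact h1 (Fin.rev_lt_rev.2 hij)

end

/-! ### The bundle transformed by the outer automorphism -/

section

section

variable {M : Type*}

/-- The bundle `P · flip`. It is again a normal extrinsic Cartan bundle, for which the roles of
`R` and `S` are exchanged. -/
def flipBundle (P : M → Set Mat8) (x : M) : Set Mat8 := {a | a * flip ∈ P x}

/-- The section `s · flip`. -/
def flipSection (s : M → Mat8) (x : M) : Mat8 := s x * flip

theorem mul_flip_flip (a : Mat8) : a * flip * flip = a := by
  rw [Matrix.mul_assoc, flip_mul_flip, Matrix.mul_one]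

theorem flipSection_flipSection (s : M → Mat8) : flipSection (flipSection s) = s :=
  funext fun x => mul_flip_flip (s x)

theorem flipBundle_flipBundle (P : M → Set Mat8) : flipBundle (flipBundle P) = P := by
  funext x
  ext a
  simp [flipBundle, mul_flip_flip]

end

variable {M : Type*} [TopologicalSpace M] [ChartedSpace (EuclideanSpace ℝ (Fin 3)) M]

theorem IsSmoothMat.flipSection {s : M → Mat8} {U : Set M} (h : IsSmoothMat s U) :
    IsSmoothMat (flipSection s) U := by
  intro i j
  simp only [Sl3Geometry.flipSection, mul_flip_apply]
  exact (h i (swapIdx j)).mul contMDiffOn_const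

theorem IsSection.flipSection {P : M → Set Mat8} {s : M → Mat8} {U : Set M}
    (h : IsSection P U s) : IsSection (flipBundle P) U (flipSection s) :=
  ⟨h.1, h.2.1.flipSection, fun x hx => by
    change s x * flip * flip ∈ P x
    rw [mul_flip_flip]
    exact h.2.2 x hx⟩

theorem isSection_flipBundle_iff {P : M → Set Mat8} {s : M → Mat8} {U : Set M} :
    IsSection (flipBundle P) U s ↔ IsSection P U (flipSection s) := by
  refine ⟨fun h => ?_, fun h => ?_⟩
  · have := h.flipSection
    rwa [flipBundle_flipBundle] at this
  · have := h.flipSection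
    rwa [flipSection_flipSection] at this

/-- As `flip` is constant, `ω` changes by conjugation only. -/
theorem omega_flipSection {s : M → Mat8} {U : Set M} (hU : IsOpen U) (hs : IsSmoothMat s U)
    {x : M} (hx : x ∈ U) (v : TangentSpace (𝓡 3) x) :
    omega (flipSection s) x v = flip * omega s x v * flip := by
  have hinv : (flipSection s x)⁻¹ = flip * (s x)⁻¹ := by
    rw [flipSection, Matrix.mul_inv_rev, Matrix.inv_eq_right_inv flip_mul_flip]
  rw [omega, omega, hinv, ← Matrix.mul_assoc, Matrix.mul_assoc (flip * (s x)⁻¹)]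
  congr 1
  ext i j
  rw [mul_flip_apply]
  have hd : MDifferentiableAt (𝓡 3) 𝓘(ℝ, ℝ) (fun y => s y i (swapIdx j)) x :=
    ((hs i (swapIdx j)).contMDiffAt (hU.mem_nhds hx)).mdifferentiableAt (by simp)
  have h1 : (fun y => flipSection s y i j) = swapSign j • fun y => s y i (swapIdx j) := by
    funext y
    rw [flipSection, mul_flip_apply, mul_comm]
    rfl
  refine Eq.trans ?_ (mul_comm (swapSign j) _)
  exact (congrArg (fun f : M → ℝ => (mfderiv (𝓡 3) 𝓘(ℝ, ℝ) f x v : ℝ)) h1).trans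
    (congrArg (fun L => L v) (const_smul_mfderiv hd (swapSign j)))

theorem omegaNeg_flipSection {s : M → Mat8} {U : Set M} (hU : IsOpen U) (hs : IsSmoothMat s U)
    {x : M} (hx : x ∈ U) (v : TangentSpace (𝓡 3) x) :
    omegaNeg (flipSection s) x v = outerNeg (omegaNeg s x v) := by
  rw [omegaNeg, omega_flipSection hU hs hx, projI_flip_conj, negPart_outer, omegaNeg]

theorem bijective_omegaNeg_flipSection {s : M → Mat8} {U : Set M} (hU : IsOpen U)
    (hs : IsSmoothMat s U) {x : M} (hx : x ∈ U) (hb : Function.Bijective (omegaNeg s x)) :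
    Function.Bijective (omegaNeg (flipSection s) x) := by
  have h : omegaNeg (flipSection s) x = outerNeg ∘ omegaNeg s x :=
    funext (omegaNeg_flipSection hU hs hx)
  rw [h]
  exact (Function.Involutive.bijective outerNeg_outerNeg).comp hb

theorem invFun_omegaNeg_flipSection {s : M → Mat8} {U : Set M} (hU : IsOpen U)
    (hs : IsSmoothMat s U) {x : M} (hx : x ∈ U) (hb : Function.Bijective (omegaNeg s x))
    (u : Fin 3 → ℝ) : Function.invFun (omegaNeg (flipSection s) x) u =
      Function.invFun (omegaNeg s x) (outerNeg u) := by
  apply (bijective_omegaNeg_flipSection hU hs hx hb).1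
  rw [Function.invFun_eq ((bijective_omegaNeg_flipSection hU hs hx hb).2 u),
    omegaNeg_flipSection hU hs hx, Function.invFun_eq (hb.2 _), outerNeg_outerNeg]

theorem chi_flipSection {s : M → Mat8} {U : Set M} (hU : IsOpen U) (hs : IsSmoothMat s U)
    {x : M} (hx : x ∈ U) (hb : Function.Bijective (omegaNeg s x)) (u : Fin 3 → ℝ) :
    chi (flipSection s) x u = flip * chi s x (outerNeg u) * flip := by
  rw [chi, invFun_omegaNeg_flipSection hU hs hx hb, omega_flipSection hU hs hx, projII_flip_conj,
    chi]

/-- The Maurer-Cartan form, as a linear map. -/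
def omegaL (s : M → Mat8) (x : M) : TangentSpace (𝓡 3) x →ₗ[ℝ] Mat8 where
  toFun v := omega s x v
  map_add' v w := by
    simp only [omega, map_add]
    rw [← mul_add]
    rfl
  map_smul' c v := by
    simp only [omega, map_smul, RingHom.id_apply]
    rw [← Matrix.mul_smul]
    rfl

/-- The map `ω₋` on `T_x M`, as a linear map. -/
def omegaNegL (s : M → Mat8) (x : M) : TangentSpace (𝓡 3) x →ₗ[ℝ] (Fin 3 → ℝ) :=
  negL.comp (omegaL s x)

theorem invFun_omegaNeg_eq {s : M → Mat8} {x : M} (hb : Function.Bijective (omegaNeg s x))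
    (u : Fin 3 → ℝ) : Function.invFun (omegaNeg s x) u =
      (LinearEquiv.ofBijective (omegaNegL s x) hb).symm u := by
  apply hb.1
  rw [Function.invFun_eq (hb.2 u)]
  exact ((LinearEquiv.ofBijective (omegaNegL s x) hb).apply_symm_apply u).symm

/-- The matrix of `ad`, as a linear map. -/
def adL : Matrix (Fin 3) (Fin 3) ℝ →ₗ[ℝ] Mat8 where
  toFun := ad
  map_add' Y Z := by
    ext i j
    simp only [ad, Matrix.of_apply, add_mul, mul_add, Matrix.add_apply]
    generalize basisA ℝ j = B
    fin_cases i <;> simp [coord] <;> ring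
  map_smul' c Y := by
    ext i j
    simp only [ad, Matrix.of_apply, smul_mul_assoc, mul_smul_comm, ← smul_sub, coord_smul,
      Matrix.smul_apply, RingHom.id_apply, smul_eq_mul]

/-- The `sl(3)`-component of a matrix, as a linear map. -/
def projIL : Mat8 →ₗ[ℝ] Matrix (Fin 3) (Fin 3) ℝ where
  toFun := projI
  map_add' := projI_add
  map_smul' := projI_smul

/-- The component of a matrix in `sl(3)^⊥`, as a linear map. -/
def projIIL : Mat8 →ₗ[ℝ] Mat8 := LinearMap.id - adL.comp projIL

theorem exists_chi_linear {s : M → Mat8} {x : M} (hb : Function.Bijective (omegaNeg s x)) :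
    ∃ L : (Fin 3 → ℝ) →ₗ[ℝ] Mat8, ∀ u, chi s x u = L u :=
  ⟨projIIL.comp ((omegaL s x).comp (LinearEquiv.ofBijective (omegaNegL s x) hb).symm.toLinearMap),
    fun u => by
      rw [chi, invFun_omegaNeg_eq hb]
      rfl⟩

theorem chi_neg {s : M → Mat8} {x : M} (hb : Function.Bijective (omegaNeg s x)) (u : Fin 3 → ℝ) :
    chi s x (-u) = -chi s x u := by
  obtain ⟨L, hL⟩ := exists_chi_linear hb
  rw [hL, hL, map_neg]

theorem outerNeg_single (i : Fin 3) :
    outerNeg (Pi.single i 1) = -Pi.single ((![0, 2, 1] : Fin 3 → Fin 3) i) 1 := by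
  funext j
  fin_cases i <;> fin_cases j <;> simp [outerNeg]

theorem outer_E : outer (E ℝ 0 2) = -E ℝ 0 2 ∧ outer (E ℝ 1 2) = -E ℝ 0 1 ∧
    outer (E ℝ 0 1) = -E ℝ 1 2 := by
  refine ⟨?_, ?_, ?_⟩ <;>
  · ext i j
    fin_cases i <;> fin_cases j <;> simp [outer, E, Fin.rev]

/-- The outer automorphism permutes `E₁₃, E₁₂, E₂₃` up to sign, as it does `e₀, e₁, e₂`. -/
theorem codiff_flip {c c' : (Fin 3 → ℝ) → Mat8}
    (h : ∀ i, c' (Pi.single i 1) =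
      -(flip * c (Pi.single ((![0, 2, 1] : Fin 3 → Fin 3) i) 1) * flip)) :
    codiff c' = flip * codiff c * flip := by
  have had : ∀ {Y Z : Matrix (Fin 3) (Fin 3) ℝ} (X : Mat8), outer Y = -Z →
      ⁅ad Z, -(flip * X * flip)⁆ = flip * ⁅ad Y, X⁆ * flip := by
    intro Y Z X hYZ
    have : ad Z = -(flip * ad Y * flip) := by
      rw [← ad_outer, hYZ]
      exact (neg_eq_iff_eq_neg.2 (adL.map_neg Z)).symm
    rw [this, Ring.lie_def, neg_mul_neg, neg_mul_neg, ← Ring.lie_def, flip_conj_lie]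
  rw [codiff, h 0, h 1, h 2, codiff, mul_add, mul_add, add_mul, add_mul]
  simp only [Matrix.cons_val]
  rw [had _ outer_E.1, had _ outer_E.2.1, had _ outer_E.2.2]
  abel

theorem IsHomogeneousNeg.outerNeg {p : ℤ} {u : Fin 3 → ℝ} (h : IsHomogeneousNeg p u) :
    IsHomogeneousNeg p (outerNeg u) :=
  ⟨fun hp => by simp [Sl3Geometry.outerNeg, h.1 hp], fun hp => by
    simp [Sl3Geometry.outerNeg, h.2 hp]⟩

/-- The outer automorphism preserves the filtration of `V`, the group `G⁰` and the codifferential,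
so it transforms normal bundles into normal bundles. -/
theorem IsNormalCartanBundle.flipBundle {φ : M → ℤ → Submodule ℝ (Fin 8 → ℝ)} {P : M → Set Mat8}
    (hP : IsNormalCartanBundle φ P) : IsNormalCartanBundle φ (flipBundle P) where
  mem_groupL x a ha := by
    have := mul_flip_mem_groupL (hP.mem_groupL x _ ha)
    rwa [mul_flip_flip] at this
  covers x a ha q := by
    rw [hP.covers x _ ha q, Matrix.mulVecLin_mul, Submodule.map_comp, map_flip_filV]
  torsor x a ha b := by
    change b * flip ∈ P x ↔ _
    rw [hP.torsor x _ ha]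
    constructor
    · rintro ⟨g, hg, h⟩
      refine ⟨flip * g * flip, flip_conj_mem_groupG0 hg, ?_⟩
      rw [← mul_flip_flip b, h]
      simp only [Matrix.mul_assoc]
    · rintro ⟨g, hg, h⟩
      refine ⟨flip * g * flip, flip_conj_mem_groupG0 hg, ?_⟩
      rw [h, ← Matrix.mul_assoc, ← Matrix.mul_assoc, mul_flip_flip]
  exists_section x := by
    obtain ⟨U, s, hx, hs⟩ := hP.exists_section x
    exact ⟨U, _, hx, hs.flipSection⟩
  coframe U s hs x hx := by
    have h := isSection_flipBundle_iff.1 hs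
    have := bijective_omegaNeg_flipSection h.1 h.2.1 hx (hP.coframe U _ h x hx)
    rwa [flipSection_flipSection] at this
  positive U s hs x hx p u hu := by
    have h := isSection_flipBundle_iff.1 hs
    have h1 := chi_flipSection h.1 h.2.1 hx (hP.coframe U _ h x hx) u
    rw [flipSection_flipSection] at h1
    rw [h1]
    exact flip_conj_mem_filGl (hP.positive U _ h x hx p _ hu.outerNeg)
  normal U s hs x hx := by
    have h := isSection_flipBundle_iff.1 hs
    have hb := hP.coframe U _ h x hx
    rw [codiff_flip (c := chi (flipSection s) x) fun i => ?_, hP.normal U _ h x hx]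
    · simp
    · have h1 := chi_flipSection h.1 h.2.1 hx hb (Pi.single i 1)
      rw [flipSection_flipSection] at h1
      rw [h1, outerNeg_single, chi_neg hb, mul_neg, neg_mul]

theorem frameOmega_flipSection {s : M → Mat8} {U : Set M} (hU : IsOpen U) (hs : IsSmoothMat s U)
    {x : M} (hx : x ∈ U) (hb : Function.Bijective (omegaNeg s x)) (i : Fin 3) :
    frameOmega (flipSection s) i x =
      -(flip * frameOmega s ((![0, 2, 1] : Fin 3 → Fin 3) i) x * flip) := by
  have h1 : ∀ v, omega s x (-v) = -omega s x v := (omegaL s x).map_neg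
  rw [frameOmega, dualVec, invFun_omegaNeg_flipSection hU hs hx hb, omega_flipSection hU hs hx,
    outerNeg_single, invFun_omegaNeg_eq hb, map_neg, h1, ← invFun_omegaNeg_eq hb, mul_neg, neg_mul]
  rfl

theorem coefR_frameOmega_flipSection {s : M → Mat8} {U : Set M} (hU : IsOpen U)
    (hs : IsSmoothMat s U) {x : M} (hx : x ∈ U) (hb : Function.Bijective (omegaNeg s x))
    (i : Fin 3) (w : Fin 10) :
    coefR (frameOmega (flipSection s) i x) w =
      -(signWt w * coefS (frameOmega s ((![0, 2, 1] : Fin 3 → Fin 3) i) x) (swapWt w)) := by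
  rw [frameOmega_flipSection hU hs hx hb, ← coefR_flip_conj]
  exact (coefRL w).map_neg _

/-- A coefficient of `χ^S` for `P` is, up to sign, a coefficient of `χ^R` for `flipBundle P`. -/
theorem coefS_eq_zero_iff {φ : M → ℤ → Submodule ℝ (Fin 8 → ℝ)} {P : M → Set Mat8}
    (hP : IsNormalCartanBundle φ P) {U : Set M} {s : M → Mat8} (hs : IsSection P U s) {x : M}
    (hx : x ∈ U) (i : Fin 3) (w : Fin 10) :
    coefS (frameOmega s i x) w = 0 ↔
      coefR (frameOmega (flipSection s) ((![0, 2, 1] : Fin 3 → Fin 3) i) x) (swapWt w) = 0 := by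
  rw [coefR_frameOmega_flipSection hs.1 hs.2.1 hx (hP.coframe U s hs x hx)]
  have h1 : (![0, 2, 1] : Fin 3 → Fin 3) ((![0, 2, 1] : Fin 3 → Fin 3) i) = i := by
    fin_cases i <;> rfl
  have h2 : swapWt (swapWt w) = w := by
    fin_cases w <;> rfl
  have h3 : signWt (swapWt w) ≠ 0 := by
    fin_cases w <;> simp [signWt, swapWt]
  rw [h1, h2, neg_eq_zero, mul_eq_zero, or_iff_right h3]

theorem vanishS_of_flipBundle {φ : M → ℤ → Submodule ℝ (Fin 8 → ℝ)} {P : M → Set Mat8}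
    (hP : IsNormalCartanBundle φ P) {d : ℤ} (h : VanishR d 0 (flipBundle P)) : VanishS d P := by
  intro U s hs x hx i w hl
  rw [coefS_eq_zero_iff hP hs hx]
  refine h U _ hs.flipSection x hx _ _ ?_
  unfold LowS totDegS at hl
  unfold LowR totDegR
  revert hl
  fin_cases i <;> fin_cases w <;> exact id

end

/-! ### Vanishing of `χ^R` and `χ^S` in coordinates -/

section

theorem coefS_apply (X : Mat8) (i : Fin 10) :
    coefS X i = (X * vecR ℝ i).trace / (vecS ℝ i * vecR ℝ i).trace := by
  rw [vecR_real, vecS_real]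
  fin_cases i <;>
    simp [coefS, mul_add, mul_sub, add_mul, sub_mul, Matrix.trace_mul_single] <;> norm_num <;> ring

/-- The bases `vecR` and `vecS` are dual up to nonzero factors for the trace form. -/
theorem trace_vecR_mul_vecS (i j : Fin 10) : (vecR ℝ i * vecS ℝ j).trace =
    if i = j then (![72, -72, 24, 72, -48, 24, -72, 72, -72, 72] : Fin 10 → ℝ) i else 0 := by
  have h : ∀ i j : Fin 10, (vecR ℤ i * vecS ℤ j).trace =
      if i = j then (![72, -72, 24, 72, -48, 24, -72, 72, -72, 72] : Fin 10 → ℤ) i else 0 := by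
    rw [vecR_int, vecS_int]
    decide +kernel
  have h1 : (vecR ℝ i * vecS ℝ j).trace = ((vecR ℤ i * vecS ℤ j).trace : ℤ) := by
    simp only [← vecR_map (Int.castRingHom ℝ), ← vecS_map (Int.castRingHom ℝ), ← Matrix.map_mul,
      Matrix.trace, Matrix.diag_apply, Matrix.map_apply, Int.cast_sum, eq_intCast]
  rw [h1, h]
  split_ifs
  · fin_cases i <;> simp
  · simp

theorem projR_eq (X : Mat8) : projR X = ∑ i, coefR X i • vecR ℝ i := by
  simp only [projR, coefR_apply]

theorem projS_eq (X : Mat8) : projS X = ∑ i, coefS X i • vecS ℝ i := by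
  simp only [projS, coefS_apply]

theorem projR_eq_zero_iff (X : Mat8) : projR X = 0 ↔ coefR X = 0 := by
  rw [projR_eq]
  refine ⟨fun h => funext fun j => ?_, fun h => by simp [h]⟩
  have h1 := congrArg (fun Z => (Z * vecS ℝ j).trace) h
  simp only [Finset.sum_mul, Matrix.trace_sum, smul_mul_assoc, Matrix.trace_smul,
    trace_vecR_mul_vecS, zero_mul, Matrix.trace_zero, smul_eq_mul, mul_ite, mul_zero,
    Finset.sum_ite_eq', Finset.mem_univ, if_true] at h1
  refine (mul_eq_zero.1 h1).resolve_right ?_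
  fin_cases j <;> simp

theorem projS_eq_zero_iff (X : Mat8) : projS X = 0 ↔ coefS X = 0 := by
  rw [projS_eq]
  refine ⟨fun h => funext fun j => ?_, fun h => by simp [h]⟩
  have h1 := congrArg (fun Z => (vecR ℝ j * Z).trace) h
  simp only [Finset.mul_sum, Matrix.trace_sum, mul_smul_comm, Matrix.trace_smul,
    trace_vecR_mul_vecS, mul_zero, Matrix.trace_zero, smul_eq_mul, mul_ite,
    Finset.sum_ite_eq, Finset.mem_univ, if_true] at h1
  refine (mul_eq_zero.1 h1).resolve_right ?_
  fin_cases j <;> simp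

variable {M : Type*} [TopologicalSpace M] [ChartedSpace (EuclideanSpace ℝ (Fin 3)) M]
  {φ : M → ℤ → Submodule ℝ (Fin 8 → ℝ)} {P : M → Set Mat8} {U : Set M} {s : M → Mat8} {x : M}

theorem chi_eq_sum (hb : Function.Bijective (omegaNeg s x)) (u : Fin 3 → ℝ) :
    chi s x u = ∑ i, u i • chi s x (Pi.single i 1) := by
  obtain ⟨L, hL⟩ := exists_chi_linear hb
  simp only [hL]
  conv_lhs => rw [← Finset.univ_sum_single u, map_sum]
  refine Finset.sum_congr rfl fun i _ => ?_
  rw [← map_smul, ← Pi.single_smul, smul_eq_mul, mul_one]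

variable [IsManifold (𝓡 3) ∞ M]

theorem chiR_vanishes_iff (hP : IsNormalCartanBundle φ P) : ChiRVanishes P ↔
    ∀ U s, IsSection P U s → ∀ x ∈ U, ∀ i w, coefR (frameOmega s i x) w = 0 := by
  constructor
  · intro h U s hs x hx i w
    have h1 := h U s hs x hx (Pi.single i 1)
    rw [chiR, projR_eq_zero_iff, chi_single_eq hP hs hx, coefR_ofCoords] at h1
    exact congrFun h1 w
  · intro h U s hs x hx u
    rw [chiR, projR_eq_zero_iff, chi_eq_sum (hP.coframe U s hs x hx)]
    funext w
    change coefRL w _ = 0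
    rw [map_sum]
    refine Finset.sum_eq_zero fun i _ => ?_
    rw [map_smul, chi_single_eq hP hs hx]
    change u i • coefR _ w = 0
    rw [coefR_ofCoords, h U s hs x hx, smul_zero]

theorem chiS_vanishes_iff (hP : IsNormalCartanBundle φ P) : ChiSVanishes P ↔
    ∀ U s, IsSection P U s → ∀ x ∈ U, ∀ i w, coefS (frameOmega s i x) w = 0 := by
  constructor
  · intro h U s hs x hx i w
    have h1 := h U s hs x hx (Pi.single i 1)
    rw [chiS, projS_eq_zero_iff, chi_single_eq hP hs hx, coefS_ofCoords] at h1
    exact congrFun h1 w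
  · intro h U s hs x hx u
    rw [chiS, chi_eq_sum (hP.coframe U s hs x hx), projS]
    refine Finset.sum_eq_zero fun w _ => ?_
    rw [Finset.sum_mul, Matrix.trace_sum, Finset.sum_div, Finset.sum_eq_zero, zero_smul]
    intro i _
    rw [smul_mul_assoc, Matrix.trace_smul, smul_div_assoc, ← coefS_apply, chi_single_eq hP hs hx,
      coefS_ofCoords, h U s hs x hx, smul_zero]

/-- The outer automorphism reduces the statements on `χ^S` to those on `χ^R`. -/
theorem chiS_vanishes_iff_flipBundle (hP : IsNormalCartanBundle φ P) :
    ChiSVanishes P ↔ ChiRVanishes (flipBundle P) := by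
  rw [chiS_vanishes_iff hP, chiR_vanishes_iff hP.flipBundle]
  constructor
  · intro h U s hs x hx i w
    have hs' := isSection_flipBundle_iff.1 hs
    have h1 := coefR_frameOmega_flipSection hs'.1 hs'.2.1 hx (hP.coframe U _ hs' x hx) i w
    rw [flipSection_flipSection] at h1
    rw [h1, h U _ hs' x hx, mul_zero, neg_zero]
  · intro h U s hs x hx i w
    rw [coefS_eq_zero_iff hP hs hx]
    exact h U _ hs.flipSection x hx _ _

theorem vanish_degree_one (hP : IsNormalCartanBundle φ P) : VanishR 1 0 P :=
  vanishR_degree_one hP (vanishR_nonpos hP) (vanishS_nonpos hP)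

/-- The structure equation couples `χ^R` to `χ^S`. The information needed on `χ^S` is that on `χ^R`
in lower degree, for the bundle `flipBundle P`. -/
theorem vanish_degree_two (hP : IsNormalCartanBundle φ P) : VanishR 2 0 P :=
  vanishR_degree_two hP (vanish_degree_one hP)
    (vanishS_of_flipBundle hP (vanish_degree_one hP.flipBundle))

theorem vanish_degree_three (hP : IsNormalCartanBundle φ P) : VanishR 3 0 P :=
  vanishR_degree_three hP (vanish_degree_two hP)
    (vanishS_of_flipBundle hP (vanish_degree_two hP.flipBundle))

/-- Every component of `χ^R` whose weight has second coordinate at most one vanishes. -/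
theorem vanish_degree_four (hP : IsNormalCartanBundle φ P) : VanishR 4 0 P :=
  vanishR_degree_four hP (vanish_degree_three hP)
    (vanishS_of_flipBundle hP (vanish_degree_three hP.flipBundle))

/-- `χ^R` is determined by its harmonic component of lowest degree, the coefficient of
`e₂^* ⊗ R_{-1,1}`: if it vanishes, so does `χ^R`. -/
theorem chiR_vanishes_iff_harmonic (hP : IsNormalCartanBundle φ P) : ChiRVanishes P ↔
    ∀ U s, IsSection P U s → ∀ x ∈ U, coefR (frameOmega s 2 x) 6 = 0 := by
  rw [chiR_vanishes_iff hP]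
  refine ⟨fun h U s hs x hx => h U s hs x hx 2 6, fun h => ?_⟩
  have hS : VanishS 4 P := vanishS_of_flipBundle hP (vanish_degree_four hP.flipBundle)
  have h1 : VanishR 4 1 P := by
    intro U s hs x hx i w hl
    by_cases hl' : LowR 4 0 i w
    · exact vanish_degree_four hP U s hs x hx i w hl'
    -- the only component of degree one not covered by `vanish_degree_four`
    · have : i = 2 ∧ w = 6 := by
        revert hl hl'
        revert i w
        decide
      rw [this.1, this.2]
      exact h U s hs x hx
  have h5 := vanishR_full_degree_five hP (vanishR_full_degree_four hP (vanishR_full_degree_three hP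
    (vanishR_full_degree_two hP h1 hS) hS) hS) hS
  intro U s hs x hx i w
  refine h5 U s hs x hx i w ?_
  revert i w
  decide

end

/-! ### The plane of the first two vectors of a frame -/

section

attribute [local instance] Matrix.linftyOpNormedRing Matrix.linftyOpNormedAlgebra

/-- The plane spanned by the first two basis vectors `A₁, A₂` of `V`. -/
def plane : Submodule ℝ (Fin 8 → ℝ) where
  carrier := {v | ∀ p, 2 ≤ p → v p = 0}
  add_mem' ha hb p hp := by simp [ha p hp, hb p hp]
  zero_mem' _ _ := rfl
  smul_mem' c v hv p hp := by simp [hv p hp]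

theorem eq_of_mem_plane {v : Fin 8 → ℝ} (h : v ∈ plane) :
    v = v 0 • Pi.single 0 1 + v 1 • Pi.single 1 1 := by
  funext p
  by_cases hp : 2 ≤ p
  · rw [h p hp]
    have h0 : p ≠ 0 := by rintro rfl; revert hp; decide
    have h1 : p ≠ 1 := by rintro rfl; revert hp; decide
    simp [h0, h1]
  · have : p = 0 ∨ p = 1 := by revert hp; revert p; decide
    rcases this with rfl | rfl <;> simp

theorem single_mem_plane {p : Fin 8} (hp : p < 2) : (Pi.single p 1 : Fin 8 → ℝ) ∈ plane :=
  fun q hq => Pi.single_eq_of_ne (by rintro rfl; exact absurd hq (not_le.2 hp)) 1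

theorem linearIndependent_mulVec_single {n : ℕ} (hn : n ≤ 8) {a : Mat8} (ha : IsUnit a) :
    LinearIndependent ℝ fun i : Fin n => a *ᵥ Pi.single (Fin.castLE hn i) (1 : ℝ) := by
  have h1 : LinearIndependent ℝ fun i : Fin n => (Pi.single (Fin.castLE hn i) 1 : Fin 8 → ℝ) :=
    (Pi.linearIndependent_single_one (Fin 8) ℝ).comp _ (Fin.castLE_injective hn)
  exact h1.map' a.mulVecLin (LinearMap.ker_eq_bot.2 (Matrix.mulVec_injective_of_isUnit ha))

theorem plane_eq_span :
    plane = Submodule.span ℝ (Set.range fun i : Fin 2 => (1 : Mat8) *ᵥ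
      Pi.single (Fin.castLE (by norm_num) i : Fin 8) (1 : ℝ)) := by
  apply le_antisymm
  · intro v hv
    rw [eq_of_mem_plane hv]
    refine add_mem (Submodule.smul_mem _ _ (Submodule.subset_span ⟨0, ?_⟩))
      (Submodule.smul_mem _ _ (Submodule.subset_span ⟨1, ?_⟩)) <;> exact Matrix.one_mulVec _
  · rw [Submodule.span_le]
    rintro _ ⟨i, rfl⟩
    change (1 : Mat8) *ᵥ _ ∈ plane
    rw [Matrix.one_mulVec]
    apply single_mem_plane
    revert i
    decide

theorem finrank_plane : Module.finrank ℝ plane = 2 := by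
  rw [plane_eq_span, finrank_span_eq_card (linearIndependent_mulVec_single _ isUnit_one)]
  rfl

theorem finrank_map_plane {a : Mat8} (ha : IsUnit a) :
    Module.finrank ℝ (plane.map a.mulVecLin) = 2 := by
  rw [← (Submodule.equivMapOfInjective a.mulVecLin (Matrix.mulVec_injective_of_isUnit ha)
    plane).finrank_eq, finrank_plane]

/-- The flag `⟨A₁⟩ ⊂ ⟨A₁, A₂⟩` is invariant under `G⁰`. -/
theorem groupG0_apply_eq_zero {g : Mat8} (hg : g ∈ groupG0) :
    (∀ p, p ≠ 0 → g p 0 = 0) ∧ ∀ p, 2 ≤ p → g p 1 = 0 := by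
  obtain ⟨h, hb, rfl⟩ := hg
  have hb' := blockTriangular_coe_inv hb
  have e : (h : Matrix (Fin 3) (Fin 3) ℝ) 1 0 = 0 ∧ (h : Matrix (Fin 3) (Fin 3) ℝ) 2 0 = 0 :=
    ⟨hb (by decide), hb (by decide)⟩
  have hA : ∀ a b : Fin 3, ∀ p, coord ((h : Matrix (Fin 3) (Fin 3) ℝ) * E ℝ a b *
      ((h⁻¹ : Matrix.SpecialLinearGroup (Fin 3) ℝ) : Matrix (Fin 3) (Fin 3) ℝ)) p =
          coord (Matrix.of fun i j =>
        (h : Matrix (Fin 3) (Fin 3) ℝ) i a * ((h⁻¹ : Matrix.SpecialLinearGroup (Fin 3) ℝ) :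
          Matrix (Fin 3) (Fin 3) ℝ) b j) p := by
    intro a b p
    congr 1
    ext i j
    rw [Matrix.mul_apply, Finset.sum_eq_single b]
    · rw [E, Matrix.mul_single_apply_same, mul_one, Matrix.of_apply]
    · intro c _ hc
      rw [E, Matrix.mul_single_apply_of_ne _ _ _ _ _ hc, zero_mul]
    · simp
  have e' : ((h⁻¹ : Matrix.SpecialLinearGroup (Fin 3) ℝ) : Matrix (Fin 3) (Fin 3) ℝ) 1 0 = 0 ∧
      ((h⁻¹ : Matrix.SpecialLinearGroup (Fin 3) ℝ) : Matrix (Fin 3) (Fin 3) ℝ) 2 0 = 0 ∧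
      ((h⁻¹ : Matrix.SpecialLinearGroup (Fin 3) ℝ) : Matrix (Fin 3) (Fin 3) ℝ) 2 1 = 0 :=
    ⟨hb' (by decide), hb' (by decide), hb' (by decide)⟩
  have h0 : ∀ p, Ad h p 0 = _ := hA 0 2
  have h1 : ∀ p, Ad h p 1 = _ := hA 0 1
  clear hb hb'
  generalize ((h⁻¹ : Matrix.SpecialLinearGroup (Fin 3) ℝ) : Matrix (Fin 3) (Fin 3) ℝ) = k at *
  refine ⟨fun p hp => ?_, fun p hp => ?_⟩
  · rw [h0]
    fin_cases p <;> first | exact absurd rfl hp | simp [coord, e, e']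
  · rw [h1]
    fin_cases p <;> first | exact absurd hp (by decide) | simp [coord, e, e']

/-- The plane `⟨A₁, A₂⟩` is invariant under `G⁰`. -/
theorem mulVec_mem_plane {g : Mat8} (hg : g ∈ groupG0) {v : Fin 8 → ℝ} (hv : v ∈ plane) :
    g *ᵥ v ∈ plane := by
  rw [eq_of_mem_plane hv, Matrix.mulVec_add, Matrix.mulVec_smul, Matrix.mulVec_smul]
  refine add_mem (Submodule.smul_mem _ _ fun p hp => ?_) (Submodule.smul_mem _ _ fun p hp => ?_)
  · rw [Matrix.mulVec_single_one]
    exact (groupG0_apply_eq_zero hg).1 p (by rintro rfl; revert hp; decide)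
  · rw [Matrix.mulVec_single_one]
    exact (groupG0_apply_eq_zero hg).2 p hp

section ODE

variable {A : Type*} [NormedRing A] [NormedAlgebra ℝ A]

/-- Uniqueness for the linear equation `dY/dt = Y B`, with initial value zero. -/
theorem eventually_eq_zero_of_hasDerivAt_mul {Y B : ℝ → A} {t₀ : ℝ} (hB : ContinuousAt B t₀)
    (hY : ∀ᶠ t in nhds t₀, HasDerivAt Y (Y t * B t) t) (h0 : Y t₀ = 0) :
    ∀ᶠ t in nhds t₀, Y t = 0 := by
  have hK : ∀ᶠ t in nhds t₀, ‖B t‖ < ‖B t₀‖ + 1 :=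
    hB.norm.eventually_lt_const (by linarith)
  have := ODE_solution_unique_of_eventually (E := A) (v := fun t y => y * B t)
    (s := fun _ => Set.univ) (K := (‖B t₀‖ + 1).toNNReal) (f := Y) (g := fun _ => 0) (t₀ := t₀)
    (hK.mono fun t ht => ?_) (hY.mono fun t ht => ⟨ht, trivial⟩)
    (Filter.Eventually.of_forall fun t => ⟨?_, trivial⟩) h0
  · exact this
  · refine LipschitzOnWith.of_dist_le_mul fun x _ y _ => ?_
    rw [dist_eq_norm, dist_eq_norm, ← sub_mul, Real.coe_toNNReal _ (by positivity)]
    exact (norm_mul_le _ _).trans (by rw [mul_comm]; gcongr)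
  · simpa using hasDerivAt_const t (0 : A)

theorem deriv_mem_of_eventually_mem {V : Type*} [NormedAddCommGroup V] [NormedSpace ℝ V]
    [FiniteDimensional ℝ V] {W : Submodule ℝ V} {f : ℝ → V} {f' : V} {t : ℝ}
    (hf : HasDerivAt f f' t) (h : ∀ᶠ τ in nhds t, f τ ∈ W) : f' ∈ W := by
  by_contra hn
  obtain ⟨ℓ, hℓ, hW⟩ := Submodule.exists_le_ker_of_notMem hn
  have h1 := (LinearMap.toContinuousLinearMap ℓ).hasFDerivAt.comp_hasDerivAt t hf
  have h2 : HasDerivAt (fun τ => ℓ (f τ)) 0 t :=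
    (hasDerivAt_const t (0 : ℝ)).congr_of_eventuallyEq (h.mono fun τ hτ => hW hτ)
  exact hℓ (h1.unique h2)

end ODE

variable {M : Type*} [TopologicalSpace M] [ChartedSpace (EuclideanSpace ℝ (Fin 3)) M]
  {φ : M → ℤ → Submodule ℝ (Fin 8 → ℝ)} {P : M → Set Mat8}
  {U : Set M} {s : M → Mat8} {x : M}

theorem omega_eq_sum (hb : Function.Bijective (omegaNeg s x)) (v : TangentSpace (𝓡 3) x) :
    omega s x v = ∑ i, omegaNeg s x v i • frameOmega s i x := by
  have h1 : v = ∑ i, omegaNeg s x v i • dualVec s i x := by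
    apply hb.1
    change omegaNegL s x v = omegaNegL s x _
    rw [map_sum]
    simp only [map_smul]
    have h2 : ∀ i, omegaNegL s x (dualVec s i x) = Pi.single i 1 := projI_frameOmega hb
    simp only [h2]
    ext j
    simp [Finset.sum_apply, Pi.single_apply]
    rfl
  change omegaL s x v = _
  conv_lhs => rw [h1, map_sum]
  simp only [map_smul]
  rfl

theorem coefR_omega (hb : Function.Bijective (omegaNeg s x)) (v : TangentSpace (𝓡 3) x)
    (w : Fin 10) : coefR (omega s x v) w = ∑ i, omegaNeg s x v i * coefR (frameOmega s i x) w := by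
  change coefRL w (omega s x v) = _
  rw [omega_eq_sum hb, map_sum]
  simp only [map_smul, smul_eq_mul]
  rfl

/-- A coefficient of the `Γ₀₃`-component, as a linear form. -/
def coefSL (w : Fin 10) : Mat8 →ₗ[ℝ] ℝ where
  toFun X := coefS X w
  map_add' X Z := by simp [coefS_apply, add_mul, Matrix.trace_add, add_div]
  map_smul' c X := by simp [coefS_apply, mul_div_assoc]

theorem coefS_omega (hb : Function.Bijective (omegaNeg s x)) (v : TangentSpace (𝓡 3) x)
    (w : Fin 10) : coefS (omega s x v) w = ∑ i, omegaNeg s x v i * coefS (frameOmega s i x) w := by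
  change coefSL w (omega s x v) = _
  rw [omega_eq_sum hb, map_sum]
  simp only [map_smul, smul_eq_mul]
  rfl

variable [IsManifold (𝓡 3) ∞ M]

theorem omega_apply (hP : IsNormalCartanBundle φ P) (hs : IsSection P U s) (hx : x ∈ U)
    (v : TangentSpace (𝓡 3) x) (p q : Fin 8) : omega s x v p q =
      ofCoords (projI (omega s x v)) (coefR (omega s x v)) (coefS (omega s x v)) p q :=
  congrFun₂ (omega_eq_ofCoords hP hs hx v) p q

/-- The entries of the first column of `ω` off the diagonal depend only on `ω₋`: the coefficients of
`χ` that enter vanish by `vanish_degree_one`. -/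
theorem omega_col_zero (hP : IsNormalCartanBundle φ P) (hs : IsSection P U s) (hx : x ∈ U)
    (v : TangentSpace (𝓡 3) x) (p : Fin 8) (hp : p ≠ 0) : omega s x v p 0 =
      ![0, -omegaNeg s x v 2, omegaNeg s x v 1, -omegaNeg s x v 0, -omegaNeg s x v 0, 0, 0,
          0] p := by
  have hb := hP.coframe U s hs x hx
  have hR : ∀ w, (∀ i, LowR 1 0 i w) → coefR (omega s x v) w = 0 := fun w hw => by
    rw [coefR_omega hb]
    exact Finset.sum_eq_zero fun i _ => by rw [vanish_degree_one hP U s hs x hx i w (hw i),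
        mul_zero]
  have hS : ∀ w, (∀ i, LowS 1 i w) → coefS (omega s x v) w = 0 := fun w hw => by
    rw [coefS_omega hb]
    exact Finset.sum_eq_zero fun i _ => by
      rw [vanishS_of_flipBundle hP (vanish_degree_one hP.flipBundle) U s hs x hx i w (hw i),
          mul_zero]
  have r5 := hR 5 (by decide)
  have r7 := hR 7 (by decide)
  have r8 := hR 8 (by decide)
  have r9 := hR 9 (by decide)
  have s0 := hS 0 (by decide)
  have s1 := hS 1 (by decide)
  have s2 := hS 2 (by decide)
  have s3 := hS 3 (by decide)
  have u0 : omegaNeg s x v 0 = projI (omega s x v) 2 0 := rfl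
  have u1 : omegaNeg s x v 1 = projI (omega s x v) 1 0 := rfl
  have u2 : omegaNeg s x v 2 = projI (omega s x v) 2 1 := rfl
  rw [omega_apply hP hs hx, u0, u1, u2]
  generalize projI (omega s x v) = Y at *
  generalize coefR (omega s x v) = r at *
  generalize coefS (omega s x v) = t at *
  fin_cases p <;> first | exact absurd rfl hp | simp [ofCoords, r5, r7, r8, r9, s0, s1, s2, s3]

/-- The line field `l^R` consists of the directions in which the first vector of the frame moves in
the plane of the first two. -/
theorem col_zero_mem_plane_iff (hP : IsNormalCartanBundle φ P) (hs : IsSection P U s) (hx : x ∈ U)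
    (v : TangentSpace (𝓡 3) x) : (∃ c : ℝ, omegaNeg s x v = c • Pi.single 2 1) ↔
      omega s x v *ᵥ Pi.single 0 1 ∈ plane := by
  have hc : ∀ p : Fin 8, (omega s x v *ᵥ Pi.single 0 1) p = omega s x v p 0 := fun p => by
    rw [Matrix.mulVec_single_one]; rfl
  constructor
  · rintro ⟨c, hc'⟩ p hp
    rw [hc, omega_col_zero hP hs hx v p (by rintro rfl; revert hp; decide), hc']
    fin_cases p <;> simp_all
  · intro h
    refine ⟨omegaNeg s x v 2, funext fun i => ?_⟩
    have h2 := (hc 2).symm.trans (h 2 (by decide))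
    have h3 := (hc 3).symm.trans (h 3 (by decide))
    rw [omega_col_zero hP hs hx v _ (by decide)] at h2 h3
    simp at h2 h3
    fin_cases i <;> simp [h2, h3]

/-- Along the asymptotic directions the second column of `ω` involves, below the plane, only the
coefficient of `e₂^* ⊗ R_{-1,1}`. -/
theorem omega_col_one (hP : IsNormalCartanBundle φ P) (hs : IsSection P U s) (hx : x ∈ U)
    {v : TangentSpace (𝓡 3) x} {c : ℝ} (hv : omegaNeg s x v = c • Pi.single 2 1) (p : Fin 8)
    (hp : 2 ≤ p) : omega s x v p 1 = if p =
        2 then -6 * (c * coefR (frameOmega s 2 x) 6) else 0 := by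
  have hb := hP.coframe U s hs x hx
  have hR : ∀ w, coefR (omega s x v) w = c * coefR (frameOmega s 2 x) w := fun w => by
    rw [coefR_omega hb, hv]
    simp [Fin.sum_univ_three]
  have hS : ∀ w, coefS (omega s x v) w = c * coefS (frameOmega s 2 x) w := fun w => by
    rw [coefS_omega hb, hv]
    simp [Fin.sum_univ_three]
  have hr : ∀ w, LowR 1 0 2 w → coefR (omega s x v) w = 0 := fun w hw => by
    rw [hR, vanish_degree_one hP U s hs x hx 2 w hw, mul_zero]
  have ht : ∀ w, LowS 1 2 w → coefS (omega s x v) w = 0 := fun w hw => by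
    rw [hS, vanishS_of_flipBundle hP (vanish_degree_one hP.flipBundle) U s hs x hx 2 w hw, mul_zero]
  have r7 := hr 7 (by decide)
  have r8 := hr 8 (by decide)
  have s0 := ht 0 (by decide)
  have s1 := ht 1 (by decide)
  have s2 := ht 2 (by decide)
  have u0 : projI (omega s x v) 2 0 = 0 := by
    change omegaNeg s x v 0 = 0
    rw [hv]; simp
  have u1 : projI (omega s x v) 1 0 = 0 := by
    change omegaNeg s x v 1 = 0
    rw [hv]; simp
  rw [omega_apply hP hs hx, ← hR]
  generalize projI (omega s x v) = Y at *
  generalize coefR (omega s x v) = r at *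
  generalize coefS (omega s x v) = t at *
  fin_cases p <;> first | exact absurd hp (by decide) | simp [ofCoords, r7, r8, s0, s1, s2, u0, u1]

end

/-! ### Moving frames along asymptotic curves -/

section

attribute [local instance] Matrix.linftyOpNormedRing Matrix.linftyOpNormedAlgebra

/-- The evaluation of matrices at a vector, as a continuous linear map. -/
def mulVecCLM (v : Fin 8 → ℝ) : Mat8 →L[ℝ] (Fin 8 → ℝ) :=
  LinearMap.toContinuousLinearMap
    { toFun := fun X => X *ᵥ v
      map_add' := fun X Z => Matrix.add_mulVec X Z v
      map_smul' := fun c X => Matrix.smul_mulVec c X v }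

theorem hasDerivAt_mulVec {f : ℝ → Mat8} {f' : Mat8} {t : ℝ} (hf : HasDerivAt f f' t)
    (v : Fin 8 → ℝ) : HasDerivAt (fun τ => f τ *ᵥ v) (f' *ᵥ v) t :=
  (mulVecCLM v).hasFDerivAt.comp_hasDerivAt t hf

/-- The projection of `V` onto `plane` along the other basis vectors. -/
def toPlane : Mat8 := Matrix.diagonal fun p => if 2 ≤ p then 0 else 1

/-- The projection of `V` with kernel `plane` onto the span of the other basis vectors. -/
def offPlane : Mat8 := Matrix.diagonal fun p => if 2 ≤ p then 1 else 0

theorem toPlane_add_offPlane : toPlane + offPlane = 1 := by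
  rw [toPlane, offPlane, Matrix.diagonal_add, ← Matrix.diagonal_one]
  congr 1
  funext p
  split_ifs <;> norm_num

/-- In terms of the two projections: the matrix `X` maps `plane` to itself. -/
theorem offPlane_mul_mul_toPlane_eq_zero_iff (X : Mat8) : offPlane * X * toPlane = 0 ↔
    X *ᵥ Pi.single 0 1 ∈ plane ∧ X *ᵥ Pi.single 1 1 ∈ plane := by
  simp only [Matrix.mulVec_single_one]
  constructor
  · intro h
    refine ⟨fun p hp => ?_, fun p hp => ?_⟩
    · simpa [offPlane, toPlane, hp] using congrFun₂ h p 0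
    · simpa [offPlane, toPlane, hp] using congrFun₂ h p 1
  · rintro ⟨h0, h1⟩
    ext p q
    rw [toPlane, Matrix.mul_diagonal, offPlane, Matrix.diagonal_mul]
    by_cases hp : 2 ≤ p
    · by_cases hq : 2 ≤ q
      · simp [hq]
      · have : q = 0 ∨ q = 1 := by revert hq; revert q; decide
        rcases this with rfl | rfl
        · simp [show X p 0 = 0 from h0 p hp]
        · simp [show X p 1 = 0 from h1 p hp]
    · simp [hp]

theorem mulVec_mem_plane_of {X : Mat8} (h : offPlane * X * toPlane = 0) {v : Fin 8 → ℝ}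
    (hv : v ∈ plane) : X *ᵥ v ∈ plane := by
  obtain ⟨h0, h1⟩ := (offPlane_mul_mul_toPlane_eq_zero_iff X).1 h
  rw [eq_of_mem_plane hv, Matrix.mulVec_add, Matrix.mulVec_smul, Matrix.mulVec_smul]
  exact add_mem (Submodule.smul_mem _ _ h0) (Submodule.smul_mem _ _ h1)

theorem filV_four_le_plane : filV 4 ≤ plane := by
  intro v hv p hp
  refine hv p ?_
  revert hp
  revert p
  decide

variable {M : Type*} [TopologicalSpace M] [ChartedSpace (EuclideanSpace ℝ (Fin 3)) M]
  {φ : M → ℤ → Submodule ℝ (Fin 8 → ℝ)} {P : M → Set Mat8}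
  {U : Set M} {s : M → Mat8} {x : M} {γ : ℝ → M} {I : Set ℝ} {t : ℝ}

theorem isUnit_of_mem (hP : IsNormalCartanBundle φ P) {a : Mat8} (ha : a ∈ P x) : IsUnit a :=
  isUnit_of_mem_groupL (hP.mem_groupL x a ha)

/-- The velocity of the curve `γ`. -/
def velocity (γ : ℝ → M) (t : ℝ) : TangentSpace (𝓡 3) (γ t) :=
  mfderiv 𝓘(ℝ, ℝ) (𝓡 3) γ t (1 : ℝ)

/-- The values of the Maurer-Cartan form on the velocity of `γ`. -/
def curveOmega (s : M → Mat8) (γ : ℝ → M) (t : ℝ) : Mat8 := omega s (γ t) (velocity γ t)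

theorem isOpen_inter_preimage (hs : IsSection P U s) (hI : IsOpen I)
    (hγ : ContMDiffOn 𝓘(ℝ, ℝ) (𝓡 3) ∞ γ I) : IsOpen (I ∩ γ ⁻¹' U) :=
  hγ.continuousOn.isOpen_inter_preimage hI hs.1

/-- The equations `dA/dt = A ω` of a moving frame `A = s ∘ γ` along a curve. -/
theorem hasDerivAt_frame (hP : IsNormalCartanBundle φ P) (hs : IsSection P U s) (hI : IsOpen I)
    (hγ : ContMDiffOn 𝓘(ℝ, ℝ) (𝓡 3) ∞ γ I) (ht : t ∈ I ∩ γ ⁻¹' U) :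
    HasDerivAt (fun τ => s (γ τ)) (s (γ t) * curveOmega s γ t) t := by
  have hJ := isOpen_inter_preimage hs hI hγ
  have hγ' := hγ.mono (Set.inter_subset_left (t := γ ⁻¹' U))
  have hmaps : Set.MapsTo γ (I ∩ γ ⁻¹' U) U := fun τ hτ => hτ.2
  have hf := contDiffOn_comp hs.2.1 hγ' hmaps
  have h1 := ((hf.contDiffAt (hJ.mem_nhds ht)).differentiableAt (by simp)).hasFDerivAt.hasDerivAt
  have h2 : curveOmega s γ t = _ := omega_mfderiv hs.1 hs.2.1 hJ hγ' hmaps ht (1 : ℝ)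
  rwa [h2, logDeriv_apply, Ring.mul_inverse_cancel_left _ _ (isUnit_of_mem hP (hs.2.2 _ ht.2))]

theorem continuousOn_curveOmega (hP : IsNormalCartanBundle φ P) (hs : IsSection P U s)
    (hI : IsOpen I) (hγ : ContMDiffOn 𝓘(ℝ, ℝ) (𝓡 3) ∞ γ I) :
    ContinuousOn (curveOmega s γ) (I ∩ γ ⁻¹' U) := by
  have hJ := isOpen_inter_preimage hs hI hγ
  have hγ' := hγ.mono (Set.inter_subset_left (t := γ ⁻¹' U))
  have hmaps : Set.MapsTo γ (I ∩ γ ⁻¹' U) U := fun τ hτ => hτ.2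
  have hf := contDiffOn_comp hs.2.1 hγ' hmaps
  have h1 := contDiffOn_logDeriv hJ hf fun τ hτ => isUnit_of_mem hP (hs.2.2 _ hτ.2)
  exact (h1.continuousOn.clm_apply continuousOn_const (g := fun _ => (1 : ℝ))).congr fun τ hτ =>
    omega_mfderiv hs.1 hs.2.1 hJ hγ' hmaps hτ (1 : ℝ)

/-- The plane of the first two vectors of a frame in `P x` depends only on `x`. -/
theorem map_plane_eq (hP : IsNormalCartanBundle φ P) {a b : Mat8} (ha : a ∈ P x) (hb : b ∈ P x) :
    plane.map b.mulVecLin = plane.map a.mulVecLin := by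
  obtain ⟨g, hg, rfl⟩ := (hP.torsor x a ha b).1 hb
  refine Submodule.eq_of_le_of_finrank_eq ?_ (by
    rw [finrank_map_plane (isUnit_of_mem hP hb), finrank_map_plane (isUnit_of_mem hP ha)])
  rintro _ ⟨v, hv, rfl⟩
  refine ⟨g *ᵥ v, mulVec_mem_plane hg hv, ?_⟩
  simp [Matrix.mulVec_mulVec]

variable [IsManifold (𝓡 3) ∞ M]

/-- Whether the velocity of a curve lies in the line field `l^R` can be tested with any section:
two sections differ by a map to `G⁰`, which preserves the line and the plane spanned by the first
basis vectors. -/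
theorem curveOmega_mem_plane (hP : IsNormalCartanBundle φ P) (hs : IsSection P U s) (hI : IsOpen I)
    (hγ : ContMDiffOn 𝓘(ℝ, ℝ) (𝓡 3) ∞ γ I) (ht : t ∈ I ∩ γ ⁻¹' U)
    (hl : velocity γ t ∈ dirR P (γ t)) : curveOmega s γ t *ᵥ Pi.single 0 1 ∈ plane := by
  obtain ⟨U', s', hxU', hs', hc⟩ := hl
  have ht' : t ∈ I ∩ γ ⁻¹' U' := ⟨ht.1, hxU'⟩
  have hB' : curveOmega s' γ t *ᵥ Pi.single 0 1 ∈ plane :=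
    (col_zero_mem_plane_iff hP hs' hxU' _).1 hc
  have hA := hasDerivAt_frame hP hs hI hγ ht
  have hA' := hasDerivAt_frame hP hs' hI hγ ht'
  have hu' := isUnit_of_mem hP (hs'.2.2 _ hxU')
  set G : ℝ → Mat8 := fun τ => Ring.inverse (s' (γ τ)) * s (γ τ) with hGdef
  have hGd : DifferentiableAt ℝ G t :=
    ((differentiableAt_inverse hu').comp t hA'.differentiableAt).mul hA.differentiableAt
  have hJ := (isOpen_inter_preimage hs hI hγ).inter (isOpen_inter_preimage hs' hI hγ)
  have hG : ∀ τ ∈ (I ∩ γ ⁻¹' U) ∩ (I ∩ γ ⁻¹' U'), G τ ∈ groupG0 ∧ s' (γ τ) * G τ = s (γ τ) := by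
    intro τ hτ
    obtain ⟨g, hg, h⟩ := (hP.torsor _ _ (hs'.2.2 _ hτ.2.2) _).1 (hs.2.2 _ hτ.1.2)
    have hu := isUnit_of_mem hP (hs'.2.2 _ hτ.2.2)
    have : G τ = g := by rw [hGdef]; simp only; rw [h, Ring.inverse_mul_cancel_left _ _ hu]
    rw [this]
    exact ⟨hg, h.symm⟩
  have hev := hJ.mem_nhds ⟨ht, ht'⟩
  -- the columns of `G` in the plane stay there, so do their derivatives
  have hdG : deriv G t *ᵥ Pi.single 0 1 ∈ plane :=
    deriv_mem_of_eventually_mem (hasDerivAt_mulVec hGd.hasDerivAt _)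
      (Filter.eventually_of_mem hev fun τ hτ =>
        mulVec_mem_plane (hG τ hτ).1 (single_mem_plane (by decide)))
  have hprod := (hA'.mul hGd.hasDerivAt).congr_of_eventuallyEq
    (f₁ := fun τ => s (γ τ)) (Filter.eventually_of_mem hev fun τ hτ => (hG τ hτ).2.symm)
  have h1 := hA.unique hprod
  obtain ⟨hGt, hsG⟩ := hG t ⟨ht, ht'⟩
  obtain ⟨g, hg, h⟩ := (hP.torsor _ _ (hs.2.2 _ ht.2) _).1 (hs'.2.2 _ hxU')
  have hgG : g * G t = 1 := by
    apply (isUnit_of_mem hP (hs.2.2 _ ht.2)).mul_left_cancel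
    rw [← mul_assoc, ← h, hsG, mul_one]
  have h2 : G t * curveOmega s γ t = curveOmega s' γ t * G t + deriv G t := by
    apply hu'.mul_left_cancel
    rw [← mul_assoc, hsG, h1, mul_add, mul_assoc]
    rfl
  have h3 : curveOmega s γ t = g * (curveOmega s' γ t * G t + deriv G t) := by
    rw [← h2, ← mul_assoc, hgG, one_mul]
  have h4 : G t *ᵥ Pi.single 0 1 = G t 0 0 • Pi.single 0 1 := by
    rw [Matrix.mulVec_single_one]
    funext p
    by_cases hp : p = 0
    · subst hp; simp
    · change G t p 0 = _
      rw [(groupG0_apply_eq_zero hGt).1 p hp]; simp [hp]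
  rw [h3, ← Matrix.mulVec_mulVec, Matrix.add_mulVec, ← Matrix.mulVec_mulVec, h4,
    Matrix.mulVec_smul]
  exact mulVec_mem_plane hg (add_mem (Submodule.smul_mem _ _ hB') hdG)

/-- If the harmonic coefficient of `χ^R` vanishes, then the planes spanned by the first two vectors
of the frames are constant along the asymptotic curves. -/
theorem eventually_map_plane_eq (hP : IsNormalCartanBundle φ P)
    (h6 : ∀ U s, IsSection P U s → ∀ x ∈ U, coefR (frameOmega s 2 x) 6 = 0)
    (hs : IsSection P U s) (hγ : IsIntegralCurveOfLineField (dirR P) γ I)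
    (ht : t ∈ I ∩ γ ⁻¹' U) : ∀ᶠ τ in nhds t,
      plane.map (s (γ τ)).mulVecLin = plane.map (s (γ t)).mulVecLin := by
  obtain ⟨hI, -, hγ, hl⟩ := hγ
  have hJ := isOpen_inter_preimage hs hI hγ
  have hu : ∀ τ ∈ I ∩ γ ⁻¹' U, IsUnit (s (γ τ)) := fun τ hτ => isUnit_of_mem hP (hs.2.2 _ hτ.2)
  have hB : ∀ τ ∈ I ∩ γ ⁻¹' U, offPlane * curveOmega s γ τ * toPlane = 0 := by
    intro τ hτ
    have h0 := curveOmega_mem_plane hP hs hI hγ hτ (hl τ hτ.1).2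
    refine (offPlane_mul_mul_toPlane_eq_zero_iff _).2 ⟨h0, fun p hp => ?_⟩
    obtain ⟨c, hc⟩ := (col_zero_mem_plane_iff hP hs hτ.2 _).2 h0
    rw [Matrix.mulVec_single_one]
    refine (omega_col_one hP hs hτ.2 hc p hp).trans ?_
    rw [h6 U s hs _ hτ.2]
    simp
  have hBQ : ∀ τ ∈ I ∩ γ ⁻¹' U,
      curveOmega s γ τ * toPlane = toPlane * (curveOmega s γ τ * toPlane) := fun τ hτ => by
    conv_lhs => rw [← one_mul (curveOmega s γ τ), ← toPlane_add_offPlane, add_mul, add_mul, hB τ hτ,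
      add_zero, mul_assoc]
  set X : ℝ → Mat8 := fun τ => Ring.inverse (s (γ t)) * s (γ τ) with hX
  -- the part of `X` that leads out of the plane satisfies a linear equation, as `ω` preserves the
  -- plane
  have hY : ∀ τ ∈ I ∩ γ ⁻¹' U, HasDerivAt (fun τ => offPlane * X τ * toPlane)
      (offPlane * X τ * toPlane * (curveOmega s γ τ * toPlane)) τ := fun τ hτ => by
    have h1 := (((hasDerivAt_frame hP hs hI hγ hτ).const_mul (Ring.inverse (s (γ t)))).const_mul
      offPlane).mul_const toPlane
    refine h1.congr_deriv ?_
    rw [mul_assoc (offPlane * X τ), ← hBQ τ hτ]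
    simp only [hX, mul_assoc]
  have h0 : offPlane * X t * toPlane = 0 := by
    have : X t = 1 := Ring.inverse_mul_cancel _ (hu t ht)
    rw [this, offPlane_mul_mul_toPlane_eq_zero_iff, Matrix.one_mulVec, Matrix.one_mulVec]
    exact ⟨single_mem_plane (by decide), single_mem_plane (by decide)⟩
  have hcont : ContinuousAt (fun τ => curveOmega s γ τ * toPlane) t :=
    ((continuousOn_curveOmega hP hs hI hγ).continuousAt (hJ.mem_nhds ht)).mul continuousAt_const
  have h1 := eventually_eq_zero_of_hasDerivAt_mul hcont
    (Filter.eventually_of_mem (hJ.mem_nhds ht) hY) h0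
  filter_upwards [h1, hJ.mem_nhds ht] with τ hτ hτJ
  refine Submodule.eq_of_le_of_finrank_eq ?_ (by
    rw [finrank_map_plane (hu τ hτJ), finrank_map_plane (hu t ht)])
  rintro _ ⟨v, hv, rfl⟩
  refine ⟨X τ *ᵥ v, mulVec_mem_plane_of hτ hv, ?_⟩
  rw [Matrix.mulVecLin_apply, Matrix.mulVec_mulVec, hX, Matrix.mulVecLin_apply,
    Ring.mul_inverse_cancel_left _ _ (hu t ht)]

/-- The line in `P(V)` is given by the plane of the first two vectors of the frames. -/
theorem mapsIntoLine_of_chiRVanishes (hP : IsNormalCartanBundle φ P) (hχ : ChiRVanishes P)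
    (hγ : IsIntegralCurveOfLineField (dirR P) γ I) : MapsIntoLine φ γ I := by
  have h6 := (chiR_vanishes_iff_harmonic hP).1 hχ
  have hne : ∀ x, ∃ a, a ∈ P x := fun x => by
    obtain ⟨U, s, hx, hs⟩ := hP.exists_section x
    exact ⟨s x, hs.2.2 x hx⟩
  choose a ha using hne
  have hconst : ∀ t ∈ I, ∀ τ ∈ I,
      plane.map (a (γ t)).mulVecLin = plane.map (a (γ τ)).mulVecLin := by
    intro t ht τ hτ
    refine hγ.2.1.induction₂ (fun t τ => plane.map (a (γ t)).mulVecLin =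
      plane.map (a (γ τ)).mulVecLin) (fun t ht => ?_) (fun _ _ _ _ _ _ h h' => h.trans h')
      (fun _ _ _ _ h => h.symm) ht hτ
    obtain ⟨U, s, hx, hs⟩ := hP.exists_section (γ t)
    have h1 := eventually_map_plane_eq hP h6 hs hγ ⟨ht, hx⟩
    have h2 := (isOpen_inter_preimage hs hγ.1 hγ.2.2.1).mem_nhds ⟨ht, hx⟩
    refine nhdsWithin_le_nhds ?_
    filter_upwards [h1, h2] with τ hτ hτ2
    rw [map_plane_eq hP (hs.2.2 _ hx) (ha _), ← hτ, map_plane_eq hP (hs.2.2 _ hτ2.2) (ha _)]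
  rcases I.eq_empty_or_nonempty with rfl | ⟨t₀, ht₀⟩
  · exact ⟨plane, finrank_plane, fun t ht => absurd ht (Set.notMem_empty t)⟩
  · refine ⟨plane.map (a (γ t₀)).mulVecLin, finrank_map_plane (isUnit_of_mem hP (ha _)),
      fun t ht => ?_⟩
    rw [hP.covers _ _ (ha _), hconst t₀ ht₀ t ht]
    exact Submodule.map_mono filV_four_le_plane

end

/-! ### Asymptotic curves that are straight lines -/

section

attribute [local instance] Matrix.linftyOpNormedRing Matrix.linftyOpNormedAlgebra

variable {M : Type*} [TopologicalSpace M] [ChartedSpace (EuclideanSpace ℝ (Fin 3)) M]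
  {φ : M → ℤ → Submodule ℝ (Fin 8 → ℝ)} {P : M → Set Mat8}
  {U : Set M} {s : M → Mat8} {x : M} {γ : ℝ → M} {I : Set ℝ} {t : ℝ}

/-- The outer automorphism exchanges `e₁` and `e₂` up to sign, hence the asymptotic directions. -/
theorem dirR_flipBundle (P : M → Set Mat8) : dirR (flipBundle P) = dirS P := by
  funext x
  ext v
  constructor
  · rintro ⟨U, s, hx, hs, c, hc⟩
    have hs' := isSection_flipBundle_iff.1 hs
    refine ⟨U, flipSection s, hx, hs', -c, ?_⟩
    rw [omegaNeg_flipSection hs.1 hs.2.1 hx, hc]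
    funext i
    fin_cases i <;> simp [outerNeg]
  · rintro ⟨U, s, hx, hs, c, hc⟩
    refine ⟨U, flipSection s, hx, hs.flipSection, -c, ?_⟩
    rw [omegaNeg_flipSection hs.1 hs.2.1 hx, hc]
    funext i
    fin_cases i <;> simp [outerNeg]

variable [IsManifold (𝓡 3) ∞ M]

/-- A smooth vector field has an integral curve through each point, defined on an open interval, and
this curve is smooth. -/
theorem exists_contDiffOn_integralCurve {E : Type*} [NormedAddCommGroup E] [NormedSpace ℝ E]
    [CompleteSpace E] {V : E → E} {O : Set E} (hO : IsOpen O) (hV : ContDiffOn ℝ ∞ V O) {z₀ : E}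
    (hz₀ : z₀ ∈ O) : ∃ (c : ℝ → E) (δ : ℝ), 0 < δ ∧ c 0 = z₀ ∧
      ContDiffOn ℝ ∞ c (Set.Ioo (-δ) δ) ∧
      ∀ t ∈ Set.Ioo (-δ) δ, c t ∈ O ∧ HasDerivAt c (V (c t)) t := by
  obtain ⟨c, hc0, ε, hε, hc⟩ :=
    ((hV.contDiffAt (hO.mem_nhds hz₀)).of_le (by norm_cast : (1 : WithTop ℕ∞) ≤ ∞)
      ).exists_forall_mem_closedBall_exists_eq_forall_mem_Ioo_hasDerivAt₀ 0
  have hcont : ContinuousAt c 0 := (hc 0 (by simpa using hε)).continuousAt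
  have h1 : ∀ᶠ t in nhds (0 : ℝ), c t ∈ O :=
    hcont.eventually_mem (hO.mem_nhds (hc0 ▸ hz₀))
  obtain ⟨η, hη, h2⟩ := Metric.eventually_nhds_iff_ball.1 h1
  rw [Real.ball_eq_Ioo] at h2
  have hδ : ∀ t ∈ Set.Icc (-(min ε η / 2)) (min ε η / 2), t ∈ Set.Ioo (0 - ε) (0 + ε) ∧
      t ∈ Set.Ioo (0 - η) (0 + η) := fun t ht => by
    have := min_le_left ε η
    have := min_le_right ε η
    have := lt_min hε hη
    obtain ⟨ha, hb⟩ := ht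
    refine ⟨⟨?_, ?_⟩, ?_, ?_⟩ <;> linarith
  refine ⟨c, min ε η / 2, half_pos (lt_min hε hη), hc0, ?_, fun t ht =>
    ⟨h2 t (hδ t (Set.Ioo_subset_Icc_self ht)).2, hc t (hδ t (Set.Ioo_subset_Icc_self ht)).1⟩⟩
  refine (ODE.contDiffOn_enat_Icc_of_hasDerivWithinAt (n := ⊤) (f := fun _ => V) (u := O) ?_
    (fun t ht => (hc t (hδ t ht).1).hasDerivWithinAt)
    (fun t ht => h2 t (hδ t ht).2)).mono Set.Ioo_subset_Icc_self
  exact hV.comp contDiffOn_snd fun p hp => hp.2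

/-- Through every point there passes an asymptotic curve, the integral curve of the vector field
dual to the component of `ω₋` along `e₂`. -/
theorem exists_asymptoticCurve (hP : IsNormalCartanBundle φ P) (hs : IsSection P U s)
    (hx : x ∈ U) : ∃ (γ : ℝ → M) (δ : ℝ), 0 < δ ∧ γ 0 = x ∧
      IsIntegralCurveOfLineField (dirR P) γ (Set.Ioo (-δ) δ) ∧
      ∀ t ∈ Set.Ioo (-δ) δ, γ t ∈ U ∧ omegaNeg s (γ t) (velocity γ t) = Pi.single 2 1 := by
  obtain ⟨O, g, z₀, hO, hz₀, hgz, hmaps, hg, hf, hu, N, hN, h⟩ := exists_chart_dualField hP hs hx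
  obtain ⟨c, δ, hδ, hc0, hc, hct⟩ := exists_contDiffOn_integralCurve hO
    (contDiffOn_dualField hO hf hu (fun z hz => (h z hz).2.2.1) (Pi.single 2 1)) hz₀
  have hγ : ContMDiffOn 𝓘(ℝ, ℝ) (𝓡 3) ∞ (g ∘ c) (Set.Ioo (-δ) δ) :=
    hg.comp hc.contMDiffOn fun t ht => (hct t ht).1
  have hv : ∀ t ∈ Set.Ioo (-δ) δ, (g ∘ c) t ∈ U ∧
      omegaNeg s ((g ∘ c) t) (velocity (g ∘ c) t) = Pi.single 2 1 := by
    intro t ht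
    obtain ⟨hO', hd⟩ := hct t ht
    refine ⟨hmaps hO', ?_⟩
    have hgd : MDifferentiableAt 𝓘(ℝ, EuclideanSpace ℝ (Fin 3)) (𝓡 3) g (c t) :=
      (hg.contMDiffAt (hO.mem_nhds hO')).mdifferentiableAt (by simp)
    have h1 : velocity (g ∘ c) t = dualVec s 2 (g (c t)) := by
      rw [(h _ hO').2.2.2 2]
      refine (mfderiv_comp_apply t hgd hd.differentiableAt.mdifferentiableAt (1 : ℝ)).trans ?_
      rw [mfderiv_eq_fderiv]
      congr 1
      exact hd.deriv
    rw [h1]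
    exact Function.invFun_eq ((hP.coframe U s hs _ (hmaps hO')).2 _)
  refine ⟨g ∘ c, δ, hδ, by rw [Function.comp_apply, hc0, hgz],
    ⟨isOpen_Ioo, isPreconnected_Ioo, hγ, fun t ht => ⟨fun h0 => ?_, U, s, (hv t ht).1, hs, 1, ?_⟩⟩,
    hv⟩
  · have h1 := (hv t ht).2
    change velocity (g ∘ c) t = 0 at h0
    have h2 := (omegaNegL s ((g ∘ c) t)).map_zero
    rw [h0] at h1
    have h3 := congrFun (h1.symm.trans h2) 2
    simp at h3
  · rw [one_smul]
    exact (hv t ht).2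

/-- A plane that contains the first vectors of the frames along an asymptotic curve contains the
first two derivatives of this vector, hence the third vector of the frame unless the harmonic
coefficient of `χ^R` vanishes. -/
theorem chiRVanishes_of_mapsIntoLine (hP : IsNormalCartanBundle φ P)
    (h : ∀ (γ : ℝ → M) (I : Set ℝ), IsIntegralCurveOfLineField (dirR P) γ I →
      MapsIntoLine φ γ I) : ChiRVanishes P := by
  rw [chiR_vanishes_iff_harmonic hP]
  intro U s hs x hx
  obtain ⟨γ, δ, hδ, rfl, hγ, hv⟩ := exists_asymptoticCurve hP hs hx
  obtain ⟨W, hW, hφ⟩ := h _ _ hγ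
  have h0 : (0 : ℝ) ∈ Set.Ioo (-δ) δ := by simpa using hδ
  have hev : ∀ t ∈ Set.Ioo (-δ) δ, Set.Ioo (-δ) δ ∈ nhds t := fun t ht => isOpen_Ioo.mem_nhds ht
  have hd : ∀ t ∈ Set.Ioo (-δ) δ,
      HasDerivAt (fun τ => s (γ τ)) (s (γ t) * curveOmega s γ t) t := fun t ht =>
    hasDerivAt_frame hP hs hγ.1 hγ.2.2.1 ⟨ht, (hv t ht).1⟩
  -- the first vector of the frame spans the line `φ⁴`
  have hA0 : ∀ t ∈ Set.Ioo (-δ) δ, s (γ t) *ᵥ Pi.single 0 1 ∈ W := fun t ht => by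
    apply hφ t ht
    rw [hP.covers _ _ (hs.2.2 _ (hv t ht).1)]
    refine ⟨Pi.single 0 1, fun i hi => Pi.single_eq_of_ne ?_ _, rfl⟩
    rintro rfl
    simp [degV] at hi
  -- the derivative of the first vector along the curve is minus the second one
  have hA1 : ∀ t ∈ Set.Ioo (-δ) δ, s (γ t) *ᵥ Pi.single 1 1 ∈ W := fun t ht => by
    have h1 := deriv_mem_of_eventually_mem (hasDerivAt_mulVec (hd t ht) (Pi.single 0 1))
      (Filter.eventually_of_mem (hev t ht) hA0)
    have hU := (hv t ht).1
    have h2 : curveOmega s γ t *ᵥ Pi.single 0 1 =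
        curveOmega s γ t 0 0 • Pi.single 0 1 - Pi.single 1 1 := by
      rw [Matrix.mulVec_single_one]
      funext p
      by_cases hp : p = 0
      · subst hp; simp
      · change omega s (γ t) (velocity γ t) p 0 = _
        rw [omega_col_zero hP hs hU _ p hp, (hv t ht).2]
        fin_cases p <;> simp_all
    rw [← Matrix.mulVec_mulVec, h2, Matrix.mulVec_sub, Matrix.mulVec_smul] at h1
    have h3 := sub_mem (Submodule.smul_mem W (curveOmega s γ t 0 0) (hA0 t ht)) h1
    rwa [sub_sub_cancel] at h3
  -- the derivative of the second one is a multiple of the third one, modulo the first two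
  have h1 := deriv_mem_of_eventually_mem (hasDerivAt_mulVec (hd 0 h0) (Pi.single 1 1))
    (Filter.eventually_of_mem (hev 0 h0) hA1)
  have hU := (hv 0 h0).1
  set r := coefR (frameOmega s 2 (γ 0)) 6 with hr
  have h2 : curveOmega s γ 0 *ᵥ Pi.single 1 1 = curveOmega s γ 0 0 1 • Pi.single 0 1 +
      curveOmega s γ 0 1 1 • Pi.single 1 1 + (-6 * r) • Pi.single 2 1 := by
    rw [Matrix.mulVec_single_one]
    funext p
    by_cases hp : 2 ≤ p
    · change omega s (γ 0) (velocity γ 0) p 1 = _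
      rw [omega_col_one hP hs hU (c := 1) (by rw [one_smul]; exact (hv 0 h0).2) p hp, ← hr]
      fin_cases p <;> simp_all
    · have : p = 0 ∨ p = 1 := by revert hp; revert p; decide
      rcases this with rfl | rfl <;> simp
  rw [← Matrix.mulVec_mulVec, h2, Matrix.mulVec_add, Matrix.mulVec_add, Matrix.mulVec_smul,
    Matrix.mulVec_smul, Matrix.mulVec_smul] at h1
  have h3 := (Submodule.add_mem_iff_right W (add_mem (Submodule.smul_mem W _ (hA0 0 h0))
    (Submodule.smul_mem W _ (hA1 0 h0)))).1 h1
  by_contra hne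
  have hA2 : s (γ 0) *ᵥ Pi.single 2 1 ∈ W :=
    (Submodule.smul_mem_iff W (by simpa using hne)).1 h3
  have hli := linearIndependent_mulVec_single (n := 3) (by norm_num)
    (isUnit_of_mem hP (hs.2.2 _ hU))
  have hspan : Submodule.span ℝ (Set.range fun i : Fin 3 => s (γ 0) *ᵥ
      Pi.single (Fin.castLE (by norm_num) i : Fin 8) (1 : ℝ)) ≤ W := by
    rw [Submodule.span_le]
    rintro _ ⟨i, rfl⟩
    fin_cases i
    · exact hA0 0 h0
    · exact hA1 0 h0
    · exact hA2
  have h4 := Submodule.finrank_mono hspan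
  rw [finrank_span_eq_card hli, hW] at h4
  simp at h4

theorem mapsIntoLine_dirR_iff (hP : IsNormalCartanBundle φ P) :
    (∀ (γ : ℝ → M) (I : Set ℝ), IsIntegralCurveOfLineField (dirR P) γ I → MapsIntoLine φ γ I) ↔
      ChiRVanishes P :=
  ⟨chiRVanishes_of_mapsIntoLine hP, fun h _ _ => mapsIntoLine_of_chiRVanishes hP h⟩

end

end Sl3Geometry

end

theorem mainTheorem6 {M : Type*} [TopologicalSpace M]
    [ChartedSpace (EuclideanSpace ℝ (Fin 3)) M] [IsManifold (𝓡 3) ∞ M]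
    (D : (x : M) → Submodule ℝ (TangentSpace (𝓡 3) x)) (hD : Sl3Geometry.IsContact D)
    (φ : M → ℤ → Submodule ℝ (Fin 8 → ℝ)) (hφ : Sl3Geometry.IsOsculatingMapOfTypeSl3 D φ)
    (P : M → Set Sl3Geometry.Mat8) (hP : Sl3Geometry.IsNormalCartanBundle φ P) :
    ((∀ (γ : ℝ → M) (I : Set ℝ),
        Sl3Geometry.IsIntegralCurveOfLineField (Sl3Geometry.dirR P) γ I →
          Sl3Geometry.MapsIntoLine φ γ I) ↔ Sl3Geometry.ChiRVanishes P) ∧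
    ((∀ (γ : ℝ → M) (I : Set ℝ),
        Sl3Geometry.IsIntegralCurveOfLineField (Sl3Geometry.dirS P) γ I →
          Sl3Geometry.MapsIntoLine φ γ I) ↔ Sl3Geometry.ChiSVanishes P) := by
  refine ⟨Sl3Geometry.mapsIntoLine_dirR_iff hP, ?_⟩
  rw [← Sl3Geometry.dirR_flipBundle, Sl3Geometry.chiS_vanishes_iff_flipBundle hP]
  exact Sl3Geometry.mapsIntoLine_dirR_iff hP.flipBundle
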